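/- Let $\gamma_d(dx)=\pi^{-d/2}e^{-|x|^2}dx$ on $\mathbb R^d$ and let $h_\nu$ ($\nu\in\mathbb N_0^d$) be the Hermite polynomials normalized in $L^2(\gamma_d)$. For $t>0$ put $$T_tf(x)=\frac{1}{\pi^{d/2}(1-e^{-2t})^{d/2}}\int_{\mathbb R^d}e^{-\frac{|y-e^{-t}x|^2}{1-e^{-2t}}}f(y)\,dy,\qquad P_tf(x)=\frac1{\sqrt\pi}\int_0^\infty\frac{e^{-u}}{\sqrt u}\,T_{t^2/4u}f(x)\,du .$$ Let $p:\mathbb R^d\to[1,\infty)$ be measurable with $1<p_-:=\operatorname{ess\,inf}p\le p_+:=\operatorname{ess\,sup}p<\infty$, and suppose that there are constants $C_1,C_2>0$ and $p_\infty\ge1$ such that $$|p(x)-p(y)|\le\frac{C_1}{\log(e+1/|x-y|)}\quad(x\ne y),\qquad |p(x)-p_\infty|\le\frac{C_2}{|x|^2}\quad(x\neq0).$$ Let $L^{p(\cdot)}(\gamma_d)$ be the space of measurable real functions $f$ such that $\int|f/\lambda|^{p(x)}d\gamma_d<\infty$ for some $\lambda>0$, with the norm $\|f\|_{p(\cdot),\gamma_d}=\inf\{\lambda>0:\int|f/\lambda|^{p(x)}d\gamma_d\le1\}$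 (equal to $\infty$ if there is no such $\lambda$). For $a\ge0$ let $k$ be the smallest integer greater than $a$, and let $B^a_{p(\cdot),\infty}(\gamma_d)$ be the set of $f\in L^{p(\cdot)}(\gamma_d)$ for which there is a constant $A\ge 0$ with $$\Big\|\frac{\partial^kP_tf}{\partial t^k}\Big\|_{p(\cdot),\gamma_d}\le A\,t^{-k+a}\qquad\text{for all }t>0,$$ with the norm $\|f\|_{B^a_{p(\cdot),\infty}}=\|f\|_{p(\cdot),\gamma_d}+A_k(f)$, where $A_k(f)$ is the smallest such $A$. For $\beta>0$ let the Gaussian Bessel potential $\mathcal J_\beta=(I+\sqrt{-L})^{-\beta}$, where $L=\frac12\Delta-\langle x,\nabla\rangle$, be the linear operator given on polynomials by $\mathcal J_\beta h_\nu=(1+\sqrt{|\nu|})^{-\beta}h_\nu$ and extended by continuity to $L^r(\gamma_d)$, $1<r<\infty$ (and thus defined on $L^{p(\cdot)}(\gamma_d)\subset L^{p_-}(\gamma_d)$). Let $\alpha\ge0$ and $\beta>0$. Then $\mathcal J_\beta$ is bounded from $B^\alpha_{p(\cdot),\infty}(\gamma_d)$ into $B^{\alpha+\beta}_{p(\cdot),\infty}(\gamma_d)$: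 there is a constant $C<\infty$, depending only on $d$, $p(\cdot)$, $\alpha$ and $\beta$, such that for every $f\in B^\alpha_{p(\cdot),\infty}(\gamma_d)$ the function $\mathcal J_\beta f$ is defined, belongs to $B^{\alpha+\beta}_{p(\cdot),\infty}(\gamma_d)$, and $$\|\mathcal J_\beta f\|_{B^{\alpha+\beta}_{p(\cdot),\infty}}\le C\,\|f\|_{B^\alpha_{p(\cdot),\infty}} .$$ -/

import Mathlib

open MeasureTheory Filter Topology
open scoped ENNReal NNReal

noncomputable section

namespace GaussianBesov

/-- The Gaussian measure `π^{-d/2} e^{-|x|²} dx` on `ℝ^d`. -/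
def gaussianMeasure (d : ℕ) : Measure (EuclideanSpace ℝ (Fin d)) :=
  volume.withDensity fun x =>
    ENNReal.ofReal (Real.exp (-‖x‖ ^ 2) / Real.pi ^ ((d : ℝ) / 2))

/-! ### Hermite polynomials -/

/-- The one-variable Hermite polynomial `(-1)^n e^{y²} (d/dy)^n e^{-y²}`. -/
def hermiteOne (n : ℕ) (y : ℝ) : ℝ :=
  (-1) ^ n * Real.exp (y ^ 2) * iteratedDeriv n (fun z : ℝ => Real.exp (-z ^ 2)) y

/-- The length `|ν| = ν₁ + ⋯ + ν_d` of a multi-index. -/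
def multiLength {d : ℕ} (ν : Fin d → ℕ) : ℕ := ∑ i, ν i

/-- The normalized Hermite polynomial `h_ν` in `d` variables. -/
def hermite {d : ℕ} (ν : Fin d → ℕ) (x : EuclideanSpace ℝ (Fin d)) : ℝ :=
  (∏ i, hermiteOne (ν i) (x i)) /
    Real.sqrt ((2 : ℝ) ^ multiLength ν * ∏ i, ((ν i).factorial : ℝ))

/-- The polynomial `∑_ν c_ν h_ν` (a finite sum). Every polynomial is of this form. -/
def hermiteSum {d : ℕ} (c : (Fin d → ℕ) →₀ ℝ) (x : EuclideanSpace ℝ (Fin d)) : ℝ :=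
  c.sum fun ν a => a * hermite ν x

/-! ### The Ornstein-Uhlenbeck and Poisson-Hermite semigroups -/

/-- The Ornstein-Uhlenbeck semigroup `T_t`, for `t > 0`. -/
def ouSemigroup {d : ℕ} (t : ℝ) (f : EuclideanSpace ℝ (Fin d) → ℝ)
    (x : EuclideanSpace ℝ (Fin d)) : ℝ :=
  1 / (Real.pi ^ ((d : ℝ) / 2) * (1 - Real.exp (-2 * t)) ^ ((d : ℝ) / 2)) *
    ∫ y, Real.exp (-‖y - Real.exp (-t) • x‖ ^ 2 / (1 - Real.exp (-2 * t))) * f y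

/-- The Poisson-Hermite semigroup `P_t`, for `t > 0`, by Bochner subordination. -/
def poissonHermite {d : ℕ} (t : ℝ) (f : EuclideanSpace ℝ (Fin d) → ℝ)
    (x : EuclideanSpace ℝ (Fin d)) : ℝ :=
  1 / Real.sqrt Real.pi *
    ∫ u in Set.Ioi (0 : ℝ),
      Real.exp (-u) / Real.sqrt u * ouSemigroup (t ^ 2 / (4 * u)) f x

/-- The derivative `∂^k/∂t^k P_t f (x)`. -/
def poissonDeriv {d : ℕ} (k : ℕ) (f : EuclideanSpace ℝ (Fin d) → ℝ) (t : ℝ)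
    (x : EuclideanSpace ℝ (Fin d)) : ℝ :=
  iteratedDeriv k (fun s : ℝ => poissonHermite s f x) t

/-! ### Exponent functions

All exponents below are real valued (this is part of local log-Hölder continuity), so the set
where the exponent is infinite is empty. -/

/-- Local log-Hölder continuity on `ℝ^d`. -/
def IsLogHolder {d : ℕ} (p : EuclideanSpace ℝ (Fin d) → ℝ) : Prop :=
  ∃ C : ℝ, 0 < C ∧ ∀ x y, |p x - p y| ≤ C / Real.log (Real.exp 1 + 1 / ‖x - y‖)

/-- A (real-valued) exponent function: measurable with values in `[1, ∞)`. -/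
def IsExponent {d : ℕ} (p : EuclideanSpace ℝ (Fin d) → ℝ) : Prop :=
  AEMeasurable p (gaussianMeasure d) ∧ ∀ x, 1 ≤ p x

/-- The Gaussian decay condition `|p(x) - p_∞| ≤ C / |x|²` on an exponent function. -/
def IsGaussianExponent {d : ℕ} (p : EuclideanSpace ℝ (Fin d) → ℝ) : Prop :=
  IsExponent p ∧
    ∃ C : ℝ, 0 < C ∧ ∃ pInf : ℝ, 1 ≤ pInf ∧ ∀ x, x ≠ 0 → |p x - pInf| ≤ C / ‖x‖ ^ 2

/-- `p_-`, the essential infimum of the exponent. -/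
def expMinus {d : ℕ} (p : EuclideanSpace ℝ (Fin d) → ℝ) : ℝ≥0∞ :=
  essInf (fun x => ENNReal.ofReal (p x)) (gaussianMeasure d)

/-- `p_+`, the essential supremum of the exponent. -/
def expPlus {d : ℕ} (p : EuclideanSpace ℝ (Fin d) → ℝ) : ℝ≥0∞ :=
  essSup (fun x => ENNReal.ofReal (p x)) (gaussianMeasure d)

/-! ### Variable Lebesgue spaces -/

/-- The modular `∫ |f|^{p(x)} dγ_d`. -/
def modular {d : ℕ} (p f : EuclideanSpace ℝ (Fin d) → ℝ) : ℝ≥0∞ :=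
  ∫⁻ x, ENNReal.ofReal (|f x| ^ p x) ∂gaussianMeasure d

/-- Membership in the variable Lebesgue space `L^{p(·)}(γ_d)`. -/
def MemVarLp {d : ℕ} (p f : EuclideanSpace ℝ (Fin d) → ℝ) : Prop :=
  AEMeasurable f (gaussianMeasure d) ∧
    ∃ l : ℝ, 0 < l ∧ modular p (fun x => f x / l) < ∞

/-- The Luxemburg norm of `L^{p(·)}(γ_d)`; it is `∞` if no `l` is admissible. -/
def varNorm {d : ℕ} (p f : EuclideanSpace ℝ (Fin d) → ℝ) : ℝ≥0∞ :=
  sInf {a : ℝ≥0∞ | ∃ l : ℝ, 0 < l ∧ modular p (fun x => f x / l) ≤ 1 ∧ a = ENNReal.ofReal l}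

/-! ### Variable Gaussian Besov-Lipschitz spaces with second index `∞` -/

/-- The smallest integer greater than `a`, for `a ≥ 0`. -/
def besovOrder (a : ℝ) : ℕ := ⌊a⌋₊ + 1

/-- `A` is admissible for `f`: `‖∂_t^k P_t f‖_{p(·)} ≤ A t^{-k+a}` for all `t > 0`, where `k` is
the smallest integer greater than `a`. -/
def BesovBound {d : ℕ} (p : EuclideanSpace ℝ (Fin d) → ℝ) (a : ℝ)
    (f : EuclideanSpace ℝ (Fin d) → ℝ) (A : ℝ≥0) : Prop :=
  ∀ t : ℝ, 0 < t →
    varNorm p (poissonDeriv (besovOrder a) f t) ≤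
      A * ENNReal.ofReal (t ^ (-(besovOrder a : ℝ) + a))

/-- Membership in `B^a_{p(·),∞}(γ_d)`. -/
def MemBesov {d : ℕ} (p : EuclideanSpace ℝ (Fin d) → ℝ) (a : ℝ)
    (f : EuclideanSpace ℝ (Fin d) → ℝ) : Prop :=
  MemVarLp p f ∧ ∃ A : ℝ≥0, BesovBound p a f A

/-- The norm of `B^a_{p(·),∞}(γ_d)`: the `L^{p(·)}` norm plus the smallest admissible constant. -/
def besovNorm {d : ℕ} (p : EuclideanSpace ℝ (Fin d) → ℝ) (a : ℝ)
    (f : EuclideanSpace ℝ (Fin d) → ℝ) : ℝ≥0∞ :=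
  varNorm p f + sInf {b : ℝ≥0∞ | ∃ A : ℝ≥0, BesovBound p a f A ∧ b = A}

/-! ### Gaussian Bessel potentials -/

/-- The Bessel potential `(I + √(-L))^{-β}` on polynomials: it is linear and multiplies `h_ν` by
`(1 + √|ν|)^{-β}`. -/
def besselPoly {d : ℕ} (β : ℝ) (c : (Fin d → ℕ) →₀ ℝ) (x : EuclideanSpace ℝ (Fin d)) : ℝ :=
  c.sum fun ν a => a * ((1 / (1 + Real.sqrt (multiLength ν : ℝ)) ^ β) * hermite ν x)

/-- `g = J_β f`, where `J_β` is the extension by continuity of the Bessel potential from the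
polynomials to the spaces `L^r(γ_d)`, `1 < r < ∞`: for some such `r` there are polynomials `Q_n`
with `Q_n → f` and `J_β Q_n → g` in `L^r(γ_d)`. Since the measure is finite, the choice of `r`
does not affect `g`. -/
def IsBesselPotential {d : ℕ} (β : ℝ) (f g : EuclideanSpace ℝ (Fin d) → ℝ) : Prop :=
  ∃ r : ℝ≥0∞, 1 < r ∧ r ≠ ∞ ∧
    MemLp f r (gaussianMeasure d) ∧ MemLp g r (gaussianMeasure d) ∧
    ∃ c : ℕ → ((Fin d → ℕ) →₀ ℝ),
      Tendsto (fun n => eLpNorm (fun x => hermiteSum (c n) x - f x) r (gaussianMeasure d))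
        atTop (𝓝 0) ∧
      Tendsto (fun n => eLpNorm (fun x => besselPoly β (c n) x - g x) r (gaussianMeasure d))
        atTop (𝓝 0)

end GaussianBesov

end

open MeasureTheory Filter Topology
open scoped ENNReal NNReal

noncomputable section

namespace GaussianBesov

variable {d : ℕ}

/-! The Gamma integral gives `(1 + √n)^{-β} = ∫ w(s) e^{-s√n} ds` with `w(s) = s^{β-1} e^{-s} /
Γ(β)`. On Hermite polynomials `P_s` acts as `e^{-s√|ν|}`, so `J_β f = ∫ w(s) P_s f ds` and `∂_t^n
P_t J_β f = ∫ w(s) ∂_t^n P_{t+s} f ds` (`IsBesselPotential.spec`). These identities and the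
semigroup law are verified on polynomials and extended by density and continuity in `L¹(γ_d)`.

Let `k` and `k + m` be the orders attached to `α` and `α + β`. Factoring `∂^{k+m} P_t = ∂^m P_{t/2}
∂^k P_{t/2}` and using that `t^m ∂_t^m P_t` is uniformly bounded on `L^{p(·)}`, the hypothesis on
`f` becomes `‖∂^{k+m} P_t f‖ ≤ C A t^{-(k+m)+α}` (`exists_varBound_poissonOp_higher`). Minkowski's
inequality (`varBound_of_average`) and `∫ w(s) (t+s)^{-κ} ds ≤ C t^{-κ+β}` with `κ = k + m - α > β`
(`lintegral_besselWeight_mul_rpow_le`) then give the required bound for `J_β f`.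

The hard ingredient is the uniform boundedness on `L^{p(·)}`. The derivatives of the subordinating
density are dominated by `t^{-k}` times the density at time `t/√2`, and the modular is convex, so a
bound for `T_r` uniform in `r` suffices (`exists_lintegral_ouPos_rpow_le`). No maximal function is
used: each `T_r` is treated directly. Put `δ = 1 - e^{-2r}` and `Λ = 1 + |x|² + log (1/δ)`. Where
`p(x) - p(y) ≤ K/Λ`, Jensen's inequality with an exponent within `K/Λ` of `p(x)` loses a factor
`B^{K/Λ}`, where `B ≤ e^{(1+d)Λ}`, hence a constant (`setLIntegral_mehler_rpow_le`). Elsewhere the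
log-Hölder and decay conditions force `y` to be either far from `x` relative to `δ` or much closer
to the origin than `x`; there the Mehler kernel is at most `C e^{|x|²/(2P)}`, with `P` an upper
bound of `p`, and the `P`-th power of this is Gaussian integrable
(`exists_mehler_le_of_oscillation`). -/

/-- Euclidean space of dimension `d`. -/
abbrev Euc (d : ℕ) : Type := EuclideanSpace ℝ (Fin d)

/-! ### The Gaussian measure -/

lemma measurable_gaussianDensity :
    Measurable fun x : Euc d => Real.exp (-‖x‖ ^ 2) / Real.pi ^ ((d : ℝ) / 2) := by
  fun_prop

lemma lintegral_gaussianMeasure (F : Euc d → ℝ≥0∞) :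
    ∫⁻ x, F x ∂gaussianMeasure d =
      ∫⁻ x, ENNReal.ofReal (Real.exp (-‖x‖ ^ 2) / Real.pi ^ ((d : ℝ) / 2)) * F x := by
  rw [gaussianMeasure, lintegral_withDensity_eq_lintegral_mul_non_measurable _
    measurable_gaussianDensity.ennreal_ofReal (by simp)]
  rfl

lemma integral_gaussianMeasure (f : Euc d → ℝ) :
    ∫ x, f x ∂gaussianMeasure d =
      ∫ x, Real.exp (-‖x‖ ^ 2) / Real.pi ^ ((d : ℝ) / 2) * f x := by
  rw [gaussianMeasure, integral_withDensity_eq_integral_toReal_smul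
    measurable_gaussianDensity.ennreal_ofReal (by simp)]
  refine integral_congr_ae (Eventually.of_forall fun x => ?_)
  simp only [smul_eq_mul]
  rw [ENNReal.toReal_ofReal (by positivity)]

/-- The Bochner integral of a non-integrable function is `0`, so a known positive value of the
integral already forces integrability. The same device is reused for `subord` and for the Gamma
weights. -/
lemma integrable_exp_neg_mul_sq_norm {b : ℝ} (hb : 0 < b) :
    Integrable fun v : Euc d => Real.exp (-b * ‖v‖ ^ 2) := by
  by_contra h
  have h1 := GaussianFourier.integral_rexp_neg_mul_sq_norm (V := Euc d) hb
  rw [integral_undef h] at h1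
  have : 0 < (Real.pi / b) ^ ((Module.finrank ℝ (Euc d) : ℝ) / 2) := by positivity
  linarith

lemma lintegral_exp_neg_mul_sq_norm {b : ℝ} (hb : 0 < b) :
    ∫⁻ v : Euc d, ENNReal.ofReal (Real.exp (-b * ‖v‖ ^ 2)) =
      ENNReal.ofReal ((Real.pi / b) ^ ((d : ℝ) / 2)) := by
  rw [← ofReal_integral_eq_lintegral_ofReal (integrable_exp_neg_mul_sq_norm hb)
    (Eventually.of_forall fun _ => (Real.exp_pos _).le),
    GaussianFourier.integral_rexp_neg_mul_sq_norm hb]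
  simp

/-! ### The Mehler kernel -/

/-- The Mehler kernel: the kernel of the Ornstein-Uhlenbeck semigroup with respect to the
Gaussian measure. -/
def mehler (r : ℝ) (x y : Euc d) : ℝ :=
  (1 - Real.exp (-2 * r)) ^ (-((d : ℝ) / 2)) *
    Real.exp ((2 * Real.exp (-r) * inner ℝ x y - Real.exp (-2 * r) * (‖x‖ ^ 2 + ‖y‖ ^ 2)) /
      (1 - Real.exp (-2 * r)))

lemma one_sub_exp_pos {r : ℝ} (hr : 0 < r) : 0 < 1 - Real.exp (-2 * r) := by
  have : Real.exp (-2 * r) < 1 := by rw [Real.exp_lt_one_iff]; linarith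
  linarith

lemma exp_neg_two_mul (r : ℝ) : Real.exp (-2 * r) = Real.exp (-r) ^ 2 := by
  rw [← Real.exp_nat_mul]; congr 1; push_cast; ring

lemma mehler_nonneg {r : ℝ} (hr : 0 < r) (x y : Euc d) : 0 ≤ mehler r x y := by
  have := one_sub_exp_pos hr
  unfold mehler; positivity

lemma mehler_comm (r : ℝ) (x y : Euc d) : mehler r x y = mehler r y x := by
  unfold mehler
  rw [real_inner_comm, add_comm (‖x‖ ^ 2)]

@[fun_prop]
lemma measurable_mehler :
    Measurable fun z : ℝ × Euc d × Euc d => mehler z.1 z.2.1 z.2.2 := by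
  unfold mehler
  fun_prop

@[fun_prop]
lemma measurable_mehler_comp {Ω : Type*} [MeasurableSpace Ω] {r : Ω → ℝ} {x y : Ω → Euc d}
    (hr : Measurable r) (hx : Measurable x) (hy : Measurable y) :
    Measurable fun ω => mehler (r ω) (x ω) (y ω) :=
  measurable_mehler.comp (hr.prodMk (hx.prodMk hy))

/-- Expanding the square shows that passing from Lebesgue measure to `γ_d` turns the kernel of the
definition into one symmetric in `x` and `y`. -/
lemma gaussianDensity_mul_mehler {r : ℝ} (hr : 0 < r) (x y : Euc d) :
    Real.exp (-‖y‖ ^ 2) / Real.pi ^ ((d : ℝ) / 2) * mehler r x y =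
      1 / (Real.pi ^ ((d : ℝ) / 2) * (1 - Real.exp (-2 * r)) ^ ((d : ℝ) / 2)) *
        Real.exp (-‖y - Real.exp (-r) • x‖ ^ 2 / (1 - Real.exp (-2 * r))) := by
  have hδ := one_sub_exp_pos hr
  have key : -‖y - Real.exp (-r) • x‖ ^ 2 / (1 - Real.exp (-2 * r)) =
      -‖y‖ ^ 2 + (2 * Real.exp (-r) * inner ℝ x y - Real.exp (-2 * r) * (‖x‖ ^ 2 + ‖y‖ ^ 2)) /
      (1 - Real.exp (-2 * r)) := by
    rw [norm_sub_sq_real, norm_smul, inner_smul_right, real_inner_comm, Real.norm_eq_abs,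
      abs_of_pos (Real.exp_pos _)]
    rw [exp_neg_two_mul] at hδ ⊢
    field_simp
    ring
  rw [key, Real.exp_add, mehler, Real.rpow_neg hδ.le]
  field_simp

lemma ouSemigroup_eq {r : ℝ} (hr : 0 < r) (f : Euc d → ℝ) (x : Euc d) :
    ouSemigroup r f x = ∫ y, mehler r x y * f y ∂gaussianMeasure d := by
  rw [integral_gaussianMeasure, ouSemigroup, ← integral_const_mul]
  refine integral_congr_ae (Eventually.of_forall fun y => ?_)
  simp only
  rw [← mul_assoc, ← mul_assoc, gaussianDensity_mul_mehler hr]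

lemma lintegral_mehler {r : ℝ} (hr : 0 < r) (x : Euc d) :
    ∫⁻ y, ENNReal.ofReal (mehler r x y) ∂gaussianMeasure d = 1 := by
  have hδ := one_sub_exp_pos hr
  rw [lintegral_gaussianMeasure]
  have h1 : ∀ y : Euc d, ENNReal.ofReal (Real.exp (-‖y‖ ^ 2) / Real.pi ^ ((d : ℝ) / 2)) *
      ENNReal.ofReal (mehler r x y) =
      ENNReal.ofReal (1 / (Real.pi ^ ((d : ℝ) / 2) * (1 - Real.exp (-2 * r)) ^ ((d : ℝ) / 2))) *
      ENNReal.ofReal (Real.exp (-(1 / (1 - Real.exp (-2 * r))) * ‖y - Real.exp (-r) • x‖ ^ 2)) := by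
    intro y
    rw [← ENNReal.ofReal_mul (by positivity), ← ENNReal.ofReal_mul (by positivity),
      gaussianDensity_mul_mehler hr]
    congr 3
    ring
  simp_rw [h1]
  rw [lintegral_const_mul' _ _ ENNReal.ofReal_ne_top,
    lintegral_sub_right_eq_self (fun y : Euc d =>
      ENNReal.ofReal (Real.exp (-(1 / (1 - Real.exp (-2 * r))) * ‖y‖ ^ 2))),
    lintegral_exp_neg_mul_sq_norm (by positivity), ← ENNReal.ofReal_mul (by positivity)]
  rw [show Real.pi / (1 / (1 - Real.exp (-2 * r))) = Real.pi * (1 - Real.exp (-2 * r)) by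
    field_simp, Real.mul_rpow Real.pi_pos.le hδ.le, one_div,
    inv_mul_cancel₀ (by positivity), ENNReal.ofReal_one]

lemma lintegral_mehler_left {r : ℝ} (hr : 0 < r) (y : Euc d) :
    ∫⁻ x, ENNReal.ofReal (mehler r x y) ∂gaussianMeasure d = 1 := by
  simp_rw [mehler_comm r _ y]
  exact lintegral_mehler hr y

instance isProbabilityMeasure_gaussianMeasure : IsProbabilityMeasure (gaussianMeasure d) := by
  constructor
  have h := lintegral_gaussianMeasure (d := d) (fun _ => 1)
  simp only [lintegral_one, mul_one] at h
  rw [h]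
  have h1 : ∀ y : Euc d, ENNReal.ofReal (Real.exp (-‖y‖ ^ 2) / Real.pi ^ ((d : ℝ) / 2)) =
      ENNReal.ofReal (1 / Real.pi ^ ((d : ℝ) / 2)) *
        ENNReal.ofReal (Real.exp (-1 * ‖y‖ ^ 2)) := by
    intro y
    rw [← ENNReal.ofReal_mul (by positivity)]
    congr 1
    rw [neg_one_mul]
    ring
  simp_rw [h1]
  rw [lintegral_const_mul' _ _ ENNReal.ofReal_ne_top, lintegral_exp_neg_mul_sq_norm one_pos,
    ← ENNReal.ofReal_mul (by positivity), div_one, one_div, inv_mul_cancel₀ (by positivity),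
    ENNReal.ofReal_one]

/-- The Gaussian measure integrates `e^{|x|²/2}`. -/
lemma lintegral_exp_half_sq_norm_lt_top :
    ∫⁻ x : Euc d, ENNReal.ofReal (Real.exp (‖x‖ ^ 2 / 2)) ∂gaussianMeasure d < ∞ := by
  rw [lintegral_gaussianMeasure]
  have h1 : ∀ y : Euc d, ENNReal.ofReal (Real.exp (-‖y‖ ^ 2) / Real.pi ^ ((d : ℝ) / 2)) *
      ENNReal.ofReal (Real.exp (‖y‖ ^ 2 / 2)) =
      ENNReal.ofReal (1 / Real.pi ^ ((d : ℝ) / 2)) *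
        ENNReal.ofReal (Real.exp (-(1 / 2) * ‖y‖ ^ 2)) := by
    intro y
    rw [← ENNReal.ofReal_mul (by positivity), ← ENNReal.ofReal_mul (by positivity)]
    congr 1
    rw [show -(1 / 2) * ‖y‖ ^ 2 = -‖y‖ ^ 2 + ‖y‖ ^ 2 / 2 by ring, Real.exp_add]
    ring
  simp_rw [h1]
  rw [lintegral_const_mul' _ _ ENNReal.ofReal_ne_top, lintegral_exp_neg_mul_sq_norm (by norm_num)]
  exact ENNReal.mul_lt_top ENNReal.ofReal_lt_top ENNReal.ofReal_lt_top

/-- The exponent of the Mehler kernel in terms of `|x - y|`. -/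
lemma mehler_exponent {r : ℝ} (hr : 0 < r) (x y : Euc d) :
    (2 * Real.exp (-r) * inner ℝ x y - Real.exp (-2 * r) * (‖x‖ ^ 2 + ‖y‖ ^ 2)) /
      (1 - Real.exp (-2 * r)) =
    -(Real.exp (-r) * ‖x - y‖ ^ 2 / (1 - Real.exp (-2 * r))) +
      Real.exp (-r) / (1 + Real.exp (-r)) * (‖x‖ ^ 2 + ‖y‖ ^ 2) := by
  have hδ := one_sub_exp_pos hr
  have h1 : 0 < 1 - Real.exp (-r) := by
    have : Real.exp (-r) < 1 := by rw [Real.exp_lt_one_iff]; linarith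
    linarith
  have h2 : 1 - Real.exp (-2 * r) = (1 - Real.exp (-r)) * (1 + Real.exp (-r)) := by
    rw [exp_neg_two_mul]; ring
  have h3 := Real.exp_pos (-r)
  rw [norm_sub_sq_real, h2, exp_neg_two_mul]
  field_simp
  ring

/-- With `ρ = e^{-r}`, the claim about the exponents amounts to `|x - ρ y|² ≥ 0`. The bound is crude
but uniform in `y`, and its logarithm is at most a multiple of `1 + |x|² + log (1/δ)`, which is all
that the Jensen step needs. -/
lemma mehler_le {r : ℝ} (hr : 0 < r) (x y : Euc d) :
    mehler r x y ≤ (1 - Real.exp (-2 * r)) ^ (-((d : ℝ) / 2)) * Real.exp (‖x‖ ^ 2) := by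
  have hδ := one_sub_exp_pos hr
  unfold mehler
  refine mul_le_mul_of_nonneg_left (Real.exp_le_exp.2 ?_) (by positivity)
  rw [div_le_iff₀ hδ, exp_neg_two_mul]
  have h := sq_nonneg ‖x - Real.exp (-r) • y‖
  rw [norm_sub_sq_real, norm_smul, inner_smul_right, Real.norm_eq_abs,
      abs_of_pos (Real.exp_pos _)] at h
  nlinarith

/-! ### Jensen's inequality for weights of mass at most one -/

/-- Hölder's inequality for the splitting `w F = w^{1/q'} · (w^{1/q} F)`. Mass at most one is
enough, so the Mehler kernel may be restricted to a subset. -/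
lemma rpow_lintegral_mul_le {Ω : Type*} [MeasurableSpace Ω] {μ : Measure Ω} {w F : Ω → ℝ≥0∞}
    (hw : AEMeasurable w μ) (hF : AEMeasurable F μ) (h1 : ∫⁻ ω, w ω ∂μ ≤ 1) {q : ℝ} (hq : 1 ≤ q) :
    (∫⁻ ω, w ω * F ω ∂μ) ^ q ≤ ∫⁻ ω, w ω * F ω ^ q ∂μ := by
  rcases hq.eq_or_lt with rfl | hq
  · simp
  have hq0 : 0 < q := by linarith
  have hc : q.HolderConjugate (q / (q - 1)) := Real.HolderConjugate.conjExponent hq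
  have hc' := hc.symm
  have h := ENNReal.lintegral_mul_le_Lp_mul_Lq μ hc' (f := fun ω => w ω ^ (1 / (q / (q - 1))))
    (g := fun ω => w ω ^ (1 / q) * F ω) (hw.pow_const _) ((hw.pow_const _).mul hF)
  have e1 : ∀ ω, ((fun ω => w ω ^ (1 / (q / (q - 1)))) * fun ω => w ω ^ (1 / q) * F ω) ω =
      w ω * F ω := by
    intro ω
    simp only [Pi.mul_apply]
    rw [← mul_assoc, ← ENNReal.rpow_add_of_nonneg _ _ (by have := hc'.pos; positivity)
      (by positivity)]
    have : 1 / (q / (q - 1)) + 1 / q = 1 := by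
      have : q - 1 ≠ 0 := by linarith
      field_simp
      ring
    rw [this, ENNReal.rpow_one]
  have e2 : ∀ ω, (w ω ^ (1 / (q / (q - 1)))) ^ (q / (q - 1)) = w ω := by
    intro ω
    rw [← ENNReal.rpow_mul, one_div, inv_mul_cancel₀ hc'.pos.ne', ENNReal.rpow_one]
  have e3 : ∀ ω, (w ω ^ (1 / q) * F ω) ^ q = w ω * F ω ^ q := by
    intro ω
    rw [ENNReal.mul_rpow_of_nonneg _ _ hq0.le, ← ENNReal.rpow_mul, one_div,
      inv_mul_cancel₀ hq0.ne', ENNReal.rpow_one]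
  simp only [e1, e2, e3] at h
  have h2 : (∫⁻ ω, w ω ∂μ) ^ (1 / (q / (q - 1))) ≤ 1 :=
    ENNReal.rpow_le_one h1 (by have := hc'.pos; positivity)
  calc (∫⁻ ω, w ω * F ω ∂μ) ^ q
      ≤ (1 * (∫⁻ ω, w ω * F ω ^ q ∂μ) ^ (1 / q)) ^ q := by gcongr; exact h.trans (by gcongr)
    _ = _ := by rw [one_mul, ← ENNReal.rpow_mul, one_div, inv_mul_cancel₀ hq0.ne',
        ENNReal.rpow_one]

lemma ennreal_rpow_le_one_add_rpow (a : ℝ≥0∞) {s t : ℝ} (hs : 0 ≤ s) (hst : s ≤ t) :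
    a ^ s ≤ 1 + a ^ t := by
  rcases le_total a 1 with h | h
  · exact (ENNReal.rpow_le_one h hs).trans le_self_add
  · exact (ENNReal.rpow_le_rpow_of_exponent_le h hst).trans le_add_self

/-! ### Exponents -/

/-- The quantitative content of the assumptions on the exponent. -/
structure ExponentBounds (p : Euc d → ℝ) (P C₁ C₂ pInf : ℝ) : Prop where
  measurable : Measurable p
  one_le : ∀ x, 1 ≤ p x
  le : ∀ x, p x ≤ P
  nonneg₁ : 0 ≤ C₁
  nonneg₂ : 0 ≤ C₂
  logHolder : ∀ x y, |p x - p y| ≤ C₁ / Real.log (Real.exp 1 + 1 / ‖x - y‖)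
  decay : ∀ x, x ≠ 0 → |p x - pInf| ≤ C₂ / ‖x‖ ^ 2

/-- The Ornstein-Uhlenbeck semigroup on functions with values in `[0, ∞]`. -/
def ouPos (r : ℝ) (F : Euc d → ℝ≥0∞) (x : Euc d) : ℝ≥0∞ :=
  ∫⁻ y, ENNReal.ofReal (mehler r x y) * F y ∂gaussianMeasure d

lemma measurable_ouPos {F : Euc d → ℝ≥0∞} (hF : Measurable F) :
    Measurable fun z : ℝ × Euc d => ouPos z.1 F z.2 := by
  unfold ouPos
  refine Measurable.lintegral_prod_right' (f := fun z : (ℝ × Euc d) × Euc d =>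
    ENNReal.ofReal (mehler z.1.1 z.1.2 z.2) * F z.2) ?_
  fun_prop

lemma measurable_ouPos_comp {Ω : Type*} [MeasurableSpace Ω] {F : Euc d → ℝ≥0∞} (hF : Measurable F)
    {r : Ω → ℝ} {x : Ω → Euc d} (hr : Measurable r) (hx : Measurable x) :
    Measurable fun ω => ouPos (r ω) F (x ω) := by
  have h := (measurable_ouPos hF).comp (hr.prodMk hx)
  exact h

/-- Tonelli and the symmetry of the kernel: the measure `γ_d` is invariant under `T_r`. -/
lemma lintegral_ouPos {r : ℝ} (hr : 0 < r) {F : Euc d → ℝ≥0∞} (hF : Measurable F) :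
    ∫⁻ x, ouPos r F x ∂gaussianMeasure d = ∫⁻ x, F x ∂gaussianMeasure d := by
  unfold ouPos
  rw [lintegral_lintegral_swap (by fun_prop)]
  refine lintegral_congr fun y => ?_
  rw [lintegral_mul_const _ (by fun_prop), lintegral_mehler_left hr, one_mul]

lemma ouPos_rpow_le {r : ℝ} (hr : 0 < r) {F : Euc d → ℝ≥0∞} (hF : Measurable F) {q : ℝ}
    (hq : 1 ≤ q) (x : Euc d) : ouPos r F x ^ q ≤ ouPos r (fun y => F y ^ q) x :=
  rpow_lintegral_mul_le (by fun_prop) hF.aemeasurable (lintegral_mehler hr x).le hq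

/-! ### The Mehler kernel away from the region where the exponent varies little -/

lemma quadratic_le {a b v : ℝ} (ha : 0 < a) : b * v - a * v ^ 2 ≤ b ^ 2 / (4 * a) := by
  rw [le_div_iff₀ (by positivity)]
  nlinarith [sq_nonneg (2 * a * v - b)]

lemma rpow_neg_eq_exp {δ : ℝ} (hδ : 0 < δ) (s : ℝ) : δ ^ (-s) = Real.exp (s * -Real.log δ) := by
  rw [Real.rpow_def_of_pos hδ]; congr 1; ring

/-- The Mehler kernel is small when `y` is much closer to the origin than `x`. -/
lemma mehler_le_of_norm_lt {c : ℝ} (hc : 0 < c) (hc8 : c ≤ 1 / 8) {r : ℝ} (hr : 0 < r)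
    {x y : Euc d} (hx : 1 ≤ ‖x‖) (hy : ‖y‖ ≤ c * ‖x‖) :
    mehler r x y ≤ Real.exp (d + ((d : ℝ) / 2) ^ 2 / (16 * c ^ 2)) *
      Real.exp (2 * c ^ 2 * ‖x‖ ^ 2) := by
  have hδ := one_sub_exp_pos hr
  set δ := 1 - Real.exp (-2 * r) with hδdef
  set ρ := Real.exp (-r) with hρ
  have hρ0 : 0 < ρ := Real.exp_pos _
  have hδρ : δ = 1 - ρ ^ 2 := by rw [hδdef, exp_neg_two_mul]
  have hin : inner ℝ x y ≤ c * ‖x‖ ^ 2 := by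
    refine (real_inner_le_norm x y).trans ?_
    nlinarith
  have hd : (0 : ℝ) ≤ d := Nat.cast_nonneg d
  have hnum : 2 * ρ * inner ℝ x y - Real.exp (-2 * r) * (‖x‖ ^ 2 + ‖y‖ ^ 2) ≤
      (2 * ρ * c - ρ ^ 2) * ‖x‖ ^ 2 := by
    rw [exp_neg_two_mul, ← hρ]
    nlinarith [mul_le_mul_of_nonneg_left hin hρ0.le, mul_nonneg (sq_nonneg ρ) (sq_nonneg ‖y‖)]
  have hxx : 1 ≤ ‖x‖ ^ 2 := by nlinarith
  unfold mehler
  rw [rpow_neg_eq_exp hδ, ← hδdef, ← Real.exp_add, ← Real.exp_add]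
  refine Real.exp_le_exp.2 ?_
  rcases le_total ρ (4 * c) with h | h
  -- Here `ρ ≤ 4c ≤ 1/2`, so `δ` is bounded below, and `2ρc - ρ² ≤ c²`.
  · have hδ2 : 3 / 4 ≤ δ := by rw [hδρ]; nlinarith
    have h1 : (2 * ρ * inner ℝ x y - Real.exp (-2 * r) * (‖x‖ ^ 2 + ‖y‖ ^ 2)) / δ ≤
        2 * c ^ 2 * ‖x‖ ^ 2 := by
      rw [div_le_iff₀ hδ]
      have : (2 * ρ * c - ρ ^ 2) * ‖x‖ ^ 2 ≤ c ^ 2 * ‖x‖ ^ 2 :=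
        mul_le_mul_of_nonneg_right (by nlinarith [sq_nonneg (ρ - c)]) (by positivity)
      have : 0 ≤ c ^ 2 * ‖x‖ ^ 2 := by positivity
      nlinarith
    have h2 : -Real.log δ ≤ 1 := by
      have : Real.exp (-1) ≤ δ := by
        have := Real.exp_one_gt_d9
        rw [Real.exp_neg]
        refine (inv_anti₀ (by norm_num) (show (2 : ℝ) ≤ _ by linarith)).trans ?_
        linarith
      have := (Real.le_log_iff_exp_le hδ).2 this
      linarith
    have h3 : 0 ≤ ((d : ℝ) / 2) ^ 2 / (16 * c ^ 2) := by positivity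
    nlinarith
  -- Now `2ρc - ρ² ≤ -8c²`, and `|x| ≥ 1` makes the exponent at most `-8c² e^v` with `v = -log δ`.
  -- The quadratic term of `e^v` absorbs the contribution `(d/2) v` of the prefactor `δ^{-d/2}`.
  · have h1 : (2 * ρ * inner ℝ x y - Real.exp (-2 * r) * (‖x‖ ^ 2 + ‖y‖ ^ 2)) / δ ≤
        -(8 * c ^ 2) * Real.exp (-Real.log δ) := by
      rw [Real.exp_neg, Real.exp_log hδ, ← div_eq_mul_inv]
      refine div_le_div_of_nonneg_right (hnum.trans ?_) hδ.le
      have : 2 * ρ * c - ρ ^ 2 ≤ -(8 * c ^ 2) := by nlinarith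
      nlinarith [sq_nonneg c]
    have hv : 0 ≤ -Real.log δ := by
      have := Real.log_nonpos hδ.le (by rw [hδρ]; nlinarith)
      linarith
    have h2 := Real.quadratic_le_exp_of_nonneg hv
    have h3 := quadratic_le (a := 4 * c ^ 2) (b := (d : ℝ) / 2) (v := -Real.log δ) (by positivity)
    have h4 : 0 ≤ 2 * c ^ 2 * ‖x‖ ^ 2 := by positivity
    have h5 : (8 * c ^ 2) * ((-Real.log δ) ^ 2 / 2) ≤ (8 * c ^ 2) * Real.exp (-Real.log δ) := by
      refine mul_le_mul_of_nonneg_left ?_ (by positivity)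
      linarith
    have h6 : 4 * (4 * c ^ 2) = 16 * c ^ 2 := by ring
    rw [h6] at h3
    nlinarith

/-- The Mehler kernel is bounded where `|x - y|⁴ > δ` and `|x|² + 2 < log (1/δ)`. -/
lemma mehler_le_of_lt_norm_sub {r : ℝ} (hr : 0 < r) {x y : Euc d}
    (hx : ‖x‖ ^ 2 + 2 < -Real.log (1 - Real.exp (-2 * r)))
    (hxy : (1 - Real.exp (-2 * r)) ^ (1 / 4 : ℝ) < ‖x - y‖) :
    mehler r x y ≤ Real.exp (2 * (3 + d) ^ 2) := by
  have hδ := one_sub_exp_pos hr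
  rw [mehler, mehler_exponent hr]
  set δ := 1 - Real.exp (-2 * r) with hδdef
  set ρ := Real.exp (-r) with hρ
  have hρ0 : 0 < ρ := Real.exp_pos _
  have hδρ : δ = 1 - ρ ^ 2 := by rw [hδdef, exp_neg_two_mul]
  set v := -Real.log δ with hv
  have hδv : δ = Real.exp (-v) := by rw [hv, neg_neg, Real.exp_log hδ]
  have hv2 : 2 < v := by nlinarith [sq_nonneg ‖x‖]
  have hδ4 : δ ≤ 1 / 4 := by
    have h1 := Real.quadratic_le_exp_of_nonneg (show 0 ≤ v by linarith)
    rw [hδv, Real.exp_neg, one_div]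
    exact inv_anti₀ (by norm_num) (by nlinarith)
  have hρ2 : 1 / 2 ≤ ρ := by nlinarith
  rw [rpow_neg_eq_exp hδ, ← Real.exp_add]
  refine Real.exp_le_exp.2 ?_
  have hyn : ‖y‖ ^ 2 ≤ 2 * ‖x‖ ^ 2 + 2 * ‖x - y‖ ^ 2 := by
    have h1 : ‖y‖ ≤ ‖x‖ + ‖x - y‖ := by
      rw [norm_sub_rev]; simpa using norm_add_le x (y - x)
    have h2 := norm_nonneg y
    nlinarith [sq_nonneg (‖x‖ - ‖x - y‖)]
  have h1 : ρ / (1 + ρ) * (‖x‖ ^ 2 + ‖y‖ ^ 2) ≤ 1 / 2 * (3 * ‖x‖ ^ 2 + 2 * ‖x - y‖ ^ 2) := by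
    refine mul_le_mul ?_ (by linarith) (by positivity) (by norm_num)
    rw [div_le_div_iff₀ (by positivity) (by norm_num)]
    nlinarith
  have h2 : ‖x - y‖ ^ 2 / (2 * δ) ≤ ρ * ‖x - y‖ ^ 2 / δ := by
    rw [div_le_div_iff₀ (by positivity) hδ]
    have := mul_nonneg (sq_nonneg ‖x - y‖) hδ.le
    nlinarith
  have h3 : ‖x - y‖ ^ 2 ≤ ‖x - y‖ ^ 2 / (4 * δ) := by
    rw [le_div_iff₀ (by positivity)]
    nlinarith [sq_nonneg ‖x - y‖]
  -- One quarter of `|x - y|²/δ` has been spent on the growth in `|y|`. The other quarter is at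
  -- least `e^{v/2}/4 ≥ v²/32`, because `|x - y|² > δ^{1/2}`; it absorbs `(d/2) v` from the
  -- prefactor and `(3/2)|x|² ≤ (3/2) v`.
  have h4 : Real.exp (v / 2) ≤ ‖x - y‖ ^ 2 / δ := by
    rw [le_div_iff₀ hδ]
    have e1 : Real.exp (v / 2) * δ = (δ ^ (1 / 4 : ℝ)) ^ 2 := by
      rw [← Real.rpow_mul_natCast hδ.le, Real.rpow_def_of_pos hδ, hδv, Real.log_exp,
        ← Real.exp_add]
      congr 1; push_cast; ring
    rw [e1]
    exact pow_le_pow_left₀ (by positivity) hxy.le 2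
  have h5 := Real.quadratic_le_exp_of_nonneg (show 0 ≤ v / 2 by linarith)
  have h6 := quadratic_le (a := 1 / 32) (b := (3 + (d : ℝ)) / 2) (v := v) (by norm_num)
  have h7 : ‖x - y‖ ^ 2 / (2 * δ) = ‖x - y‖ ^ 2 / (4 * δ) + ‖x - y‖ ^ 2 / δ / 4 := by
    field_simp; ring
  have h8 : (3 + (d : ℝ)) / 2 * v = d / 2 * v + 3 / 2 * v := by ring
  have h9 : ((3 + (d : ℝ)) / 2) ^ 2 / (4 * (1 / 32)) = 2 * (3 + d) ^ 2 := by ring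
  rw [← hv]
  linarith

/-- Outside of the region where `p x - p y` is controlled by
`K / (1 + |x|² + log (1 / (1 - e^{-2r})))`, the Mehler kernel grows slowly in `x`. -/
lemma exists_mehler_le_of_oscillation {p : Euc d → ℝ} {P C₁ C₂ pInf : ℝ}
    (hp : ExponentBounds p P C₁ C₂ pInf) :
    ∃ K C : ℝ, 0 ≤ K ∧ 0 ≤ C ∧ ∀ r, 0 < r → ∀ x y : Euc d,
      K < (p x - p y) * (1 + ‖x‖ ^ 2 - Real.log (1 - Real.exp (-2 * r))) →
      mehler r x y ≤ C * Real.exp (‖x‖ ^ 2 / (2 * P)) := by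
  have hP : 1 ≤ P := (hp.one_le 0).trans (hp.le 0)
  have hP0 : 0 < P := by linarith
  -- Small enough that `2c² ≤ 1/(2P)`, so that the growth for `|y| ≤ c|x|` stays below
  -- `e^{|x|²/(2P)}`.
  set c : ℝ := 1 / (8 * P) with hc
  have hc0 : 0 < c := by positivity
  have hc8 : c ≤ 1 / 8 := by
    rw [hc]; exact one_div_le_one_div_of_le (by norm_num) (by linarith)
  set K₀ := P + C₂ * (1 + 1 / c ^ 2) with hK₀
  have hK₀0 : 0 ≤ K₀ := by have := hp.nonneg₂; positivity
  set A := Real.exp (d + ((d : ℝ) / 2) ^ 2 / (16 * c ^ 2))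
  set B := Real.exp (2 * (3 + (d : ℝ)) ^ 2)
  -- Let `v = -log δ`. Outside `|y| ≤ c|x|`, `|x| ≥ 1`, decay gives `(p x - p y)|x|² ≤ K₀`. If `v ≤
  -- |x|² + 2`, then `(p x - p y)Λ ≤ 2K₀ + 3P`. If `v > |x|² + 2` and `|x - y| ≤ δ^{1/4}`,
  -- log-Hölder continuity gives `(p x - p y) v ≤ 4C₁`, hence `(p x - p y)Λ ≤ P + K₀ + 4C₁`. The
  -- threshold excludes both, leaving only the regions of the two kernel bounds.
  refine ⟨2 * K₀ + 3 * P + 4 * C₁, A + B, ?_, by positivity, ?_⟩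
  · have := hp.nonneg₁; positivity
  intro r hr x y hK
  have hδ := one_sub_exp_pos hr
  set δ := 1 - Real.exp (-2 * r) with hδdef
  have hexp1 : 1 ≤ Real.exp (‖x‖ ^ 2 / (2 * P)) := Real.one_le_exp (by positivity)
  have hA : 0 < A := Real.exp_pos _
  have hB : 0 < B := Real.exp_pos _
  have hosc : p x - p y ≤ P := by linarith [hp.le x, hp.one_le y]
  have hlogδ : Real.log δ ≤ 0 :=
    Real.log_nonpos hδ.le (by rw [hδdef]; linarith [Real.exp_pos (-2 * r)])
  have hpos : 0 < p x - p y := by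
    by_contra h
    have hL : 0 ≤ 1 + ‖x‖ ^ 2 - Real.log δ := by nlinarith [sq_nonneg ‖x‖]
    have : 0 ≤ 2 * K₀ + 3 * P + 4 * C₁ := by have := hp.nonneg₁; positivity
    nlinarith
  by_cases h1 : 1 ≤ ‖x‖ ∧ ‖y‖ ≤ c * ‖x‖
  · refine (mehler_le_of_norm_lt hc0 hc8 hr h1.1 h1.2).trans ?_
    have : 2 * c ^ 2 * ‖x‖ ^ 2 ≤ ‖x‖ ^ 2 / (2 * P) := by
      rw [hc, div_pow, le_div_iff₀ (by positivity)]
      have : 2 * (1 ^ 2 / (8 * P) ^ 2) * ‖x‖ ^ 2 * (2 * P) = ‖x‖ ^ 2 * (1 / (16 * P)) := by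
        field_simp; ring
      rw [this]
      refine mul_le_of_le_one_right (by positivity) ?_
      rw [div_le_one (by positivity)]; linarith
    exact mul_le_mul (by linarith) (Real.exp_le_exp.2 this) (by positivity) (by positivity)
  -- For `|x| < 1` the oscillation is at most `P`; otherwise `|y| > c|x|`, and the decay condition
  -- applies at both points with comparable weights.
  have h2 : (p x - p y) * ‖x‖ ^ 2 ≤ K₀ := by
    rcases lt_or_ge ‖x‖ 1 with hx | hx
    · have : ‖x‖ ^ 2 ≤ 1 := by nlinarith [norm_nonneg x]
      have h3 : 0 ≤ C₂ * (1 + 1 / c ^ 2) := by have := hp.nonneg₂; positivity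
      nlinarith [sq_nonneg ‖x‖]
    · have hy : c * ‖x‖ < ‖y‖ := by
        by_contra h; exact h1 ⟨hx, not_lt.1 h⟩
      have hx0 : x ≠ 0 := by rw [← norm_pos_iff]; linarith
      have hy0 : y ≠ 0 := by rw [← norm_pos_iff]; nlinarith
      have hxp : 0 < ‖x‖ ^ 2 := by positivity
      have e1 := (abs_le.1 (hp.decay x hx0)).2
      have e2 := (abs_le.1 (hp.decay y hy0)).1
      have e3 : C₂ / ‖y‖ ^ 2 ≤ C₂ / (c ^ 2 * ‖x‖ ^ 2) := by
        refine div_le_div_of_nonneg_left hp.nonneg₂ (by positivity) ?_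
        rw [← mul_pow]
        exact pow_le_pow_left₀ (by positivity) hy.le 2
      have e4 : p x - p y ≤ C₂ / ‖x‖ ^ 2 + C₂ / (c ^ 2 * ‖x‖ ^ 2) := by linarith
      calc (p x - p y) * ‖x‖ ^ 2 ≤ (C₂ / ‖x‖ ^ 2 + C₂ / (c ^ 2 * ‖x‖ ^ 2)) * ‖x‖ ^ 2 := by gcongr
        _ = C₂ * (1 + 1 / c ^ 2) := by field_simp
        _ ≤ K₀ := by rw [hK₀]; linarith
  have h3 : ‖x‖ ^ 2 + 2 < -Real.log δ := by
    by_contra h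
    push Not at h
    have := hp.nonneg₁
    nlinarith
  have h4 : δ ^ (1 / 4 : ℝ) < ‖x - y‖ := by
    by_contra h
    push Not at h
    rcases eq_or_ne x y with rfl | hne
    · simp at hpos
    have hn : 0 < ‖x - y‖ := by rw [norm_pos_iff, sub_ne_zero]; exact hne
    have e1 := (le_abs_self _).trans (hp.logHolder x y)
    have e2 : -Real.log δ / 4 ≤ Real.log (Real.exp 1 + 1 / ‖x - y‖) := by
      rw [Real.le_log_iff_exp_le (by positivity)]
      have : Real.exp (-Real.log δ / 4) = 1 / δ ^ (1 / 4 : ℝ) := by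
        rw [Real.rpow_def_of_pos hδ, one_div, ← Real.exp_neg]; congr 1; ring
      rw [this]
      have := one_div_le_one_div_of_le hn h
      linarith [Real.exp_pos 1]
    have e3 : p x - p y ≤ C₁ / (-Real.log δ / 4) :=
      e1.trans (div_le_div_of_nonneg_left hp.nonneg₁ (by nlinarith [sq_nonneg ‖x‖]) e2)
    rw [le_div_iff₀ (by nlinarith [sq_nonneg ‖x‖])] at e3
    have := hp.nonneg₁
    nlinarith
  refine (mehler_le_of_lt_norm_sub hr h3 h4).trans ?_
  nlinarith

/-! ### Uniform boundedness of the Ornstein-Uhlenbeck semigroup on `L^{p(·)}` -/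

/-- On the region of integration an exponent `q` with `p(x) - K/Λ ≤ q ≤ p(x)` lies below every
`p(y)`. Jensen gives `(∫)^q ≤ B` for `B = T_r(1 + F^p)`, and raising this to `p(x)/q` costs at most
`B^{K/Λ}`, bounded because `log B ≤ (1+d)Λ`. -/
lemma setLIntegral_mehler_rpow_le {r : ℝ} (hr : 0 < r) {p : Euc d → ℝ} (hp : Measurable p)
    (hp1 : ∀ x, 1 ≤ p x) {F : Euc d → ℝ≥0∞} (hF : Measurable F)
    (hFp : ∫⁻ x, F x ^ p x ∂gaussianMeasure d ≤ 1) {K : ℝ} (hK : 0 ≤ K) (x : Euc d) :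
    (∫⁻ y in {y | (p x - p y) * (1 + ‖x‖ ^ 2 - Real.log (1 - Real.exp (-2 * r))) ≤ K},
      ENNReal.ofReal (mehler r x y) * F y ∂gaussianMeasure d) ^ p x ≤
    ENNReal.ofReal (Real.exp ((1 + d) * K)) * ouPos r (fun y => 1 + F y ^ p y) x := by
  have hδ := one_sub_exp_pos hr
  have hlog : Real.log (1 - Real.exp (-2 * r)) ≤ 0 :=
    Real.log_nonpos hδ.le (by linarith [Real.exp_pos (-2 * r)])
  set v := -Real.log (1 - Real.exp (-2 * r)) with hv
  set Λ := 1 + ‖x‖ ^ 2 - Real.log (1 - Real.exp (-2 * r)) with hΛdef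
  have hΛv : Λ = 1 + ‖x‖ ^ 2 + v := by rw [hΛdef, hv]; ring
  have hv0 : 0 ≤ v := by rw [hv]; linarith
  have hΛ : 0 < Λ := by rw [hΛv]; positivity
  have hpx := hp1 x
  set G := {y | (p x - p y) * Λ ≤ K} with hG
  have hGm : MeasurableSet G := measurableSet_le (by fun_prop) measurable_const
  -- The maximum with `1` keeps Jensen's inequality available and preserves `q ≤ p y`, since `p y ≥
  -- 1`.
  set q := max 1 (p x - K / Λ) with hq
  have hq1 : 1 ≤ q := le_max_left _ _
  have hq0 : 0 < q := by linarith
  set B := ouPos r (fun y => 1 + F y ^ p y) x with hB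
  have hFpm : Measurable fun y => F y ^ p y := hF.pow hp
  have hBsplit : B = 1 + ouPos r (fun y => F y ^ p y) x := by
    rw [hB]; unfold ouPos
    simp_rw [mul_add, mul_one]
    rw [lintegral_add_left (by fun_prop), lintegral_mehler hr]
  set Lr := Real.exp (d / 2 * v + ‖x‖ ^ 2) with hLr
  have hkL : ∀ y, mehler r x y ≤ Lr := by
    intro y
    refine (mehler_le hr x y).trans_eq ?_
    rw [rpow_neg_eq_exp hδ, ← Real.exp_add]
  -- This is where the normalization of the modular of `F` is used: the uniform bound `mehler_le`
  -- times total mass at most one.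
  have hBL : B ≤ ENNReal.ofReal (Real.exp ((1 + d) * Λ)) := by
    have h1 : ouPos r (fun y => F y ^ p y) x ≤ ENNReal.ofReal Lr := by
      unfold ouPos
      calc _ ≤ ∫⁻ y, ENNReal.ofReal Lr * F y ^ p y ∂gaussianMeasure d :=
            lintegral_mono fun y => by gcongr; exact hkL y
        _ = ENNReal.ofReal Lr * ∫⁻ y, F y ^ p y ∂gaussianMeasure d :=
            lintegral_const_mul _ hFpm
        _ ≤ ENNReal.ofReal Lr * 1 := by gcongr
        _ = _ := mul_one _
    rw [hBsplit]
    calc _ ≤ ENNReal.ofReal 1 + ENNReal.ofReal Lr := by rw [ENNReal.ofReal_one]; gcongr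
      _ = ENNReal.ofReal (1 + Lr) := (ENNReal.ofReal_add zero_le_one (Real.exp_pos _).le).symm
      _ ≤ _ := by
        refine ENNReal.ofReal_le_ofReal ?_
        have h2 : 1 ≤ Lr := Real.one_le_exp (by positivity)
        have h3 : 2 ≤ Real.exp 1 := by linarith [Real.exp_one_gt_d9]
        calc 1 + Lr ≤ Real.exp 1 * Lr := by nlinarith
          _ = Real.exp (1 + (d / 2 * v + ‖x‖ ^ 2)) := by rw [hLr, ← Real.exp_add]
          _ ≤ _ := by
            refine Real.exp_le_exp.2 ?_
            rw [hΛv]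
            have hd : (0 : ℝ) ≤ d := Nat.cast_nonneg d
            nlinarith [mul_nonneg hd hv0, mul_nonneg hd (sq_nonneg ‖x‖)]
  have hB1 : 1 ≤ B := by rw [hBsplit]; exact le_self_add
  have hBtop : B ≠ ∞ := ne_top_of_le_ne_top ENNReal.ofReal_ne_top hBL
  have ha : (∫⁻ y in G, ENNReal.ofReal (mehler r x y) * F y ∂gaussianMeasure d) ^ q ≤ B := by
    refine (rpow_lintegral_mul_le (by fun_prop) hF.aemeasurable
      ((setLIntegral_le_lintegral _ _).trans (lintegral_mehler hr x).le) hq1).trans ?_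
    refine le_trans (setLIntegral_mono' hGm (g := fun y =>
      ENNReal.ofReal (mehler r x y) * (1 + F y ^ p y)) fun y hy => ?_)
      (setLIntegral_le_lintegral _ _)
    gcongr
    refine ennreal_rpow_le_one_add_rpow _ hq0.le (max_le (hp1 y) ?_)
    have hy' : (p x - p y) * Λ ≤ K := hy
    rw [← le_div_iff₀ hΛ] at hy'
    linarith
  have hexp0 : 0 ≤ (p x - q) / q := by
    refine div_nonneg (sub_nonneg.2 (max_le hpx ?_)) hq0.le
    have : 0 ≤ K / Λ := by positivity
    linarith
  have hexp1 : (p x - q) / q ≤ K / Λ := by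
    have h1 : p x - q ≤ K / Λ := by linarith [le_max_right 1 (p x - K / Λ)]
    have h2 : 0 ≤ p x - q := by
      by_contra h; exact absurd hexp0 (not_le.2 (div_neg_of_neg_of_pos (not_le.1 h) hq0))
    exact (div_le_self h2 hq1).trans h1
  calc _ = ((∫⁻ y in G, ENNReal.ofReal (mehler r x y) * F y ∂gaussianMeasure d) ^ q) ^
        (p x / q) := by
        rw [← ENNReal.rpow_mul, mul_div_cancel₀ _ hq0.ne']
    _ ≤ B ^ (p x / q) := by gcongr
    _ = B ^ ((p x - q) / q) * B := by
        rw [show p x / q = (p x - q) / q + 1 by field_simp; ring,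
          ENNReal.rpow_add _ _ (by positivity) hBtop, ENNReal.rpow_one]
    _ ≤ B ^ (K / Λ) * B := by
        gcongr
    _ ≤ ENNReal.ofReal (Real.exp ((1 + d) * Λ)) ^ (K / Λ) * B := by gcongr
    _ = _ := by
        rw [ENNReal.ofReal_rpow_of_pos (Real.exp_pos _), ← Real.exp_mul]
        congr 3
        field_simp

/-- The operators `T_r`, `r > 0`, are uniformly bounded on the unit ball of `L^{p(·)}`. -/
lemma exists_lintegral_ouPos_rpow_le {p : Euc d → ℝ} {P C₁ C₂ pInf : ℝ}
    (hp : ExponentBounds p P C₁ C₂ pInf) :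
    ∃ C : ℝ≥0∞, C ≠ ∞ ∧ ∀ r, 0 < r → ∀ F : Euc d → ℝ≥0∞, Measurable F →
      ∫⁻ x, F x ^ p x ∂gaussianMeasure d ≤ 1 →
      ∫⁻ x, ouPos r F x ^ p x ∂gaussianMeasure d ≤ C := by
  have hP : 1 ≤ P := (hp.one_le 0).trans (hp.le 0)
  have hP0 : 0 < P := by linarith
  obtain ⟨K, C, hK, hC, hbad⟩ := exists_mehler_le_of_oscillation hp
  set I := ∫⁻ x : Euc d, ENNReal.ofReal (Real.exp (‖x‖ ^ 2 / 2)) ∂gaussianMeasure d with hI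
  have hItop : I ≠ ∞ := lintegral_exp_half_sq_norm_lt_top.ne
  -- The first term comes from Jensen's region, using `∫ (1 + F^p) ≤ 2` and the invariance of `γ_d`;
  -- the second from the remaining region, where `F` enters only through `∫ F ≤ 2`.
  refine ⟨2 ^ P * (ENNReal.ofReal (Real.exp ((1 + d) * K)) * 2 +
    ENNReal.ofReal (2 * (C + 1)) ^ P * I), by finiteness, ?_⟩
  intro r hr F hF hFp
  have hpm := hp.measurable
  have hFpm : Measurable fun y => F y ^ p y := hF.pow hpm
  have h1Fp : ∫⁻ x, (1 + F x ^ p x) ∂gaussianMeasure d ≤ 2 := by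
    rw [lintegral_add_left measurable_const]
    simp only [lintegral_one, measure_univ]
    calc (1 : ℝ≥0∞) + _ ≤ 1 + 1 := by gcongr
      _ = 2 := one_add_one_eq_two
  have hF1 : ∫⁻ x, F x ∂gaussianMeasure d ≤ 2 := by
    refine le_trans (lintegral_mono fun x => ?_) h1Fp
    simpa using ennreal_rpow_le_one_add_rpow (F x) zero_le_one (hp.one_le x)
  have hpt : ∀ x, ouPos r F x ^ p x ≤ 2 ^ P * (ENNReal.ofReal (Real.exp ((1 + d) * K)) *
      ouPos r (fun y => 1 + F y ^ p y) x +
      ENNReal.ofReal (2 * (C + 1)) ^ P * ENNReal.ofReal (Real.exp (‖x‖ ^ 2 / 2))) := by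
    intro x
    have hpx := hp.one_le x
    set G := {y | (p x - p y) * (1 + ‖x‖ ^ 2 - Real.log (1 - Real.exp (-2 * r))) ≤ K} with hG
    have hGm : MeasurableSet G := measurableSet_le (by fun_prop) measurable_const
    have hsplit : ouPos r F x =
        (∫⁻ y in G, ENNReal.ofReal (mehler r x y) * F y ∂gaussianMeasure d) +
        ∫⁻ y in Gᶜ, ENNReal.ofReal (mehler r x y) * F y ∂gaussianMeasure d :=
      (lintegral_add_compl _ hGm).symm
    have hb : ∫⁻ y in Gᶜ, ENNReal.ofReal (mehler r x y) * F y ∂gaussianMeasure d ≤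
        ENNReal.ofReal (2 * (C + 1)) * ENNReal.ofReal (Real.exp (‖x‖ ^ 2 / (2 * P))) := by
      calc _ ≤ ∫⁻ y in Gᶜ, ENNReal.ofReal (C * Real.exp (‖x‖ ^ 2 / (2 * P))) * F y
              ∂gaussianMeasure d := by
            refine setLIntegral_mono' hGm.compl fun y hy => ?_
            gcongr
            exact hbad r hr x y (not_le.1 hy)
        _ ≤ ∫⁻ y, ENNReal.ofReal (C * Real.exp (‖x‖ ^ 2 / (2 * P))) * F y ∂gaussianMeasure d :=
            setLIntegral_le_lintegral _ _
        _ = ENNReal.ofReal (C * Real.exp (‖x‖ ^ 2 / (2 * P))) * ∫⁻ y, F y ∂gaussianMeasure d :=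
            lintegral_const_mul _ hF
        _ ≤ ENNReal.ofReal (C * Real.exp (‖x‖ ^ 2 / (2 * P))) * ENNReal.ofReal 2 := by
            rw [ENNReal.ofReal_ofNat]; gcongr
        _ ≤ _ := by
            rw [← ENNReal.ofReal_mul (by positivity), ← ENNReal.ofReal_mul (by positivity)]
            refine ENNReal.ofReal_le_ofReal ?_
            nlinarith [Real.exp_pos (‖x‖ ^ 2 / (2 * P))]
    rw [hsplit]
    calc _ ≤ (2 : ℝ≥0∞) ^ (p x - 1) *
          ((∫⁻ y in G, ENNReal.ofReal (mehler r x y) * F y ∂gaussianMeasure d) ^ p x +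
          (∫⁻ y in Gᶜ, ENNReal.ofReal (mehler r x y) * F y ∂gaussianMeasure d) ^ p x) :=
          ENNReal.rpow_add_le_mul_rpow_add_rpow _ _ hpx
      _ ≤ _ := by
          gcongr ?_ * (?_ + ?_)
          · exact ENNReal.rpow_le_rpow_of_exponent_le one_le_two (by linarith [hp.le x])
          · exact setLIntegral_mehler_rpow_le hr hpm hp.one_le hF hFp hK x
          · calc _ ≤ (ENNReal.ofReal (2 * (C + 1)) *
                  ENNReal.ofReal (Real.exp (‖x‖ ^ 2 / (2 * P)))) ^ p x := by gcongr
              _ ≤ (ENNReal.ofReal (2 * (C + 1)) *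
                  ENNReal.ofReal (Real.exp (‖x‖ ^ 2 / (2 * P)))) ^ P := by
                -- The `+ 1` in `2 * (C + 1)` makes the base at least one, so `p x` may be raised to
                -- `P`.
                refine ENNReal.rpow_le_rpow_of_exponent_le ?_ (hp.le x)
                rw [← ENNReal.ofReal_mul (by positivity), ENNReal.one_le_ofReal]
                have : 1 ≤ Real.exp (‖x‖ ^ 2 / (2 * P)) := Real.one_le_exp (by positivity)
                nlinarith
              _ = _ := by
                rw [ENNReal.mul_rpow_of_nonneg _ _ hP0.le,
                  ENNReal.ofReal_rpow_of_pos (Real.exp_pos _), ← Real.exp_mul]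
                congr 3
                field_simp
  refine (lintegral_mono hpt).trans ?_
  rw [lintegral_const_mul _ (by
    have := measurable_ouPos_comp (d := d) (F := fun y => 1 + F y ^ p y) (by fun_prop)
      (measurable_const (a := r)) measurable_id
    simp only [id] at this
    fun_prop), lintegral_add_right _ (by fun_prop),
    lintegral_const_mul' _ _ ENNReal.ofReal_ne_top, lintegral_const_mul' _ _ (by finiteness),
    lintegral_ouPos hr (by fun_prop)]
  gcongr

/-! ### The subordinating density and its derivatives -/

lemma exists_abs_eval_le (Q : Polynomial ℝ) {a : ℝ} (ha : 0 < a) :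
    ∃ C : ℝ, 0 ≤ C ∧ ∀ z, |Q.eval z| ≤ C * Real.exp (a * |z|) := by
  induction Q using Polynomial.induction_on' with
  | add p q hp hq =>
    obtain ⟨C, hC, h⟩ := hp
    obtain ⟨C', hC', h'⟩ := hq
    refine ⟨C + C', by positivity, fun z => ?_⟩
    rw [Polynomial.eval_add, add_mul]
    exact (abs_add_le _ _).trans (add_le_add (h z) (h' z))
  | monomial n c =>
    refine ⟨|c| * (n.factorial / a ^ n), by positivity, fun z => ?_⟩
    rw [Polynomial.eval_monomial, abs_mul, abs_pow, mul_assoc]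
    refine mul_le_mul_of_nonneg_left ?_ (abs_nonneg c)
    have h := Real.pow_div_factorial_le_exp (a * |z|) (by positivity) n
    rw [div_le_iff₀ (by positivity), mul_pow] at h
    rw [div_mul_eq_mul_div, le_div_iff₀ (by positivity)]
    linarith

/-- The density in `r` of the one-sided stable law of index `1/2` with `P_t = ∫ T_r`. -/
def subord (t r : ℝ) : ℝ :=
  t / (2 * Real.sqrt Real.pi) * r ^ (-3 / 2 : ℝ) * Real.exp (-t ^ 2 / (4 * r))

/-- The polynomials occurring in the derivatives of `subord`. -/
def subordPoly : ℕ → Polynomial ℝ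
  | 0 => 1
  | k + 1 => Polynomial.C (1 - (k : ℝ)) * subordPoly k +
      Polynomial.C 2 * Polynomial.X * (subordPoly k).derivative -
      Polynomial.C (1 / 2) * Polynomial.X * subordPoly k

/-- The `k`-th derivative in `t` of `subord t r`. -/
def subordDeriv (k : ℕ) (t r : ℝ) : ℝ :=
  subord t r * (t ^ k)⁻¹ * (subordPoly k).eval (t ^ 2 / r)

@[simp] lemma subordDeriv_zero (t r : ℝ) : subordDeriv 0 t r = subord t r := by
  simp [subordDeriv, subordPoly]

lemma subord_nonneg {t r : ℝ} (ht : 0 ≤ t) (hr : 0 < r) : 0 ≤ subord t r := by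
  unfold subord; positivity

@[fun_prop]
lemma measurable_subord_comp {Ω : Type*} [MeasurableSpace Ω] {t r : Ω → ℝ} (ht : Measurable t)
    (hr : Measurable r) : Measurable fun ω => subord (t ω) (r ω) := by
  unfold subord; fun_prop

@[fun_prop]
lemma measurable_subordDeriv_comp (k : ℕ) {Ω : Type*} [MeasurableSpace Ω] {t r : Ω → ℝ}
    (ht : Measurable t) (hr : Measurable r) : Measurable fun ω => subordDeriv k (t ω) (r ω) := by
  unfold subordDeriv
  have h : Measurable fun ω => (subordPoly k).eval (t ω ^ 2 / r ω) :=
    (subordPoly k).continuous.measurable.comp (by fun_prop)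
  fun_prop

lemma hasDerivAt_subordDeriv (k : ℕ) {t r : ℝ} (ht : 0 < t) (hr : 0 < r) :
    HasDerivAt (fun t => subordDeriv k t r) (subordDeriv (k + 1) t r) t := by
  have h1 : HasDerivAt (fun t : ℝ => Real.exp (-t ^ 2 / (4 * r)))
      (Real.exp (-t ^ 2 / (4 * r)) * (-(2 * t) / (4 * r))) t := by
    refine HasDerivAt.exp (HasDerivAt.div_const ?_ _)
    simpa using (hasDerivAt_pow 2 t).fun_neg
  have h2 : HasDerivAt (fun t : ℝ => t / (2 * Real.sqrt Real.pi) * r ^ (-3 / 2 : ℝ))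
      (1 / (2 * Real.sqrt Real.pi) * r ^ (-3 / 2 : ℝ)) t :=
    ((hasDerivAt_id t).div_const _).mul_const _
  have h3 : HasDerivAt (fun t : ℝ => (t ^ k)⁻¹) (-(k * t ^ (k - 1)) / (t ^ k) ^ 2) t :=
    (hasDerivAt_pow k t).fun_inv (by positivity)
  have h4 : HasDerivAt (fun t : ℝ => (subordPoly k).eval (t ^ 2 / r))
      ((subordPoly k).derivative.eval (t ^ 2 / r) * (2 * t / r)) t := by
    have := (hasDerivAt_pow 2 t).div_const r
    simp only [Nat.cast_ofNat, Nat.add_one_sub_one, pow_one] at this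
    exact ((subordPoly k).hasDerivAt (t ^ 2 / r)).comp t this
  have h5 := ((h2.mul h1).mul h3).mul h4
  refine h5.congr_deriv ?_
  -- For `k = 0` the truncated exponent is harmless because of the factor `k`.
  have hk : -((k : ℝ) * t ^ (k - 1)) / (t ^ k) ^ 2 = -(k * (t ^ (k + 1))⁻¹) := by
    rcases k with _ | k
    · simp
    · have : t ≠ 0 := ht.ne'
      simp only [Nat.add_sub_cancel]
      field_simp
      ring
  simp only [Pi.mul_apply]
  rw [hk]
  simp only [subordDeriv, subord, subordPoly, Polynomial.eval_sub, Polynomial.eval_add,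
    Polynomial.eval_mul, Polynomial.eval_C, Polynomial.eval_X]
  generalize Polynomial.eval (t ^ 2 / r) (subordPoly k) = A
  generalize Polynomial.eval (t ^ 2 / r) (Polynomial.derivative (subordPoly k)) = B
  generalize Real.exp (-t ^ 2 / (4 * r)) = e
  generalize r ^ (-3 / 2 : ℝ) = b
  have : Real.sqrt Real.pi ≠ 0 := by positivity
  field_simp
  ring

/-- With `z = t²/r`, the polynomial in `z` is absorbed by half of the factor `e^{-z/4}`; the
remaining `e^{-z/8}` is the exponential of `subord` at time `t/√2`. Hence `t^k ∂_t^k P_t` is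
dominated by a positive average of the `T_r`. -/
lemma exists_abs_subordDeriv_le (k : ℕ) :
    ∃ C : ℝ, 0 ≤ C ∧ ∀ t r, 0 < t → 0 < r →
      |subordDeriv k t r| ≤ C * (t ^ k)⁻¹ * subord (t / Real.sqrt 2) r := by
  obtain ⟨C, hC, h⟩ := exists_abs_eval_le (subordPoly k) (a := 1 / 8) (by norm_num)
  refine ⟨C * Real.sqrt 2, by positivity, fun t r ht hr => ?_⟩
  have h1 := h (t ^ 2 / r)
  rw [abs_of_nonneg (show 0 ≤ t ^ 2 / r by positivity)] at h1
  have h2 : subord t r * Real.exp (1 / 8 * (t ^ 2 / r)) =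
      Real.sqrt 2 * subord (t / Real.sqrt 2) r := by
    unfold subord
    rw [mul_assoc, ← Real.exp_add, div_pow, Real.sq_sqrt (by norm_num)]
    rw [show -t ^ 2 / (4 * r) + 1 / 8 * (t ^ 2 / r) = -(t ^ 2 / 2) / (4 * r) by
      field_simp; ring]
    field_simp
  rw [subordDeriv, abs_mul, abs_mul, abs_of_nonneg (subord_nonneg ht.le hr),
    abs_of_pos (by positivity : 0 < (t ^ k)⁻¹)]
  calc subord t r * (t ^ k)⁻¹ * |(subordPoly k).eval (t ^ 2 / r)|
      ≤ subord t r * (t ^ k)⁻¹ * (C * Real.exp (1 / 8 * (t ^ 2 / r))) := by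
        refine mul_le_mul_of_nonneg_left h1 (mul_nonneg (subord_nonneg ht.le hr) (by positivity))
    _ = C * (t ^ k)⁻¹ * (subord t r * Real.exp (1 / 8 * (t ^ 2 / r))) := by ring
    _ = _ := by rw [h2]; ring

/-- The substitution `r = t²/(4u)`, performed as an inversion followed by a dilation. -/
lemma integral_subord_mul {t : ℝ} (ht : 0 < t) (G : ℝ → ℝ) :
    1 / Real.sqrt Real.pi *
      ∫ u in Set.Ioi (0 : ℝ), Real.exp (-u) / Real.sqrt u * G (t ^ 2 / (4 * u)) =
    ∫ r in Set.Ioi (0 : ℝ), subord t r * G r := by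
  set g : ℝ → ℝ := fun u => Real.exp (-u) / Real.sqrt u * G (t ^ 2 / (4 * u)) with hg
  rw [← integral_comp_rpow_Ioi g (show (-1 : ℝ) ≠ 0 by norm_num)]
  have hb : 0 < 4 / t ^ 2 := by positivity
  have h := integral_comp_mul_left_Ioi
    (fun x : ℝ => (|(-1 : ℝ)| * x ^ ((-1 : ℝ) - 1)) • g (x ^ (-1 : ℝ))) 0 hb
  rw [mul_zero, smul_eq_mul] at h
  have h' : ∫ x in Set.Ioi (0 : ℝ), (|(-1 : ℝ)| * x ^ ((-1 : ℝ) - 1)) • g (x ^ (-1 : ℝ)) =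
      4 / t ^ 2 * ∫ x in Set.Ioi (0 : ℝ), (|(-1 : ℝ)| * (4 / t ^ 2 * x) ^ ((-1 : ℝ) - 1)) •
        g ((4 / t ^ 2 * x) ^ (-1 : ℝ)) := by
    rw [h, ← mul_assoc, mul_inv_cancel₀ hb.ne', one_mul]
  rw [h', ← mul_assoc, ← integral_const_mul]
  refine setIntegral_congr_fun measurableSet_Ioi fun r hr => ?_
  have hr0 : 0 < r := hr
  simp only [abs_neg, abs_one, one_mul, smul_eq_mul, hg]
  have e1 : (4 / t ^ 2 * r) ^ (-1 : ℝ) = t ^ 2 / (4 * r) := by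
    rw [Real.rpow_neg_one]; field_simp
  have e2 : (4 / t ^ 2 * r) ^ (-1 - 1 : ℝ) = (t ^ 2 / (4 * r)) ^ 2 := by
    rw [show (-1 - 1 : ℝ) = (-1 : ℝ) * (2 : ℕ) by norm_num, Real.rpow_mul_natCast (by positivity),
      e1]
  have e3 : t ^ 2 / (4 * (t ^ 2 / (4 * r))) = r := by field_simp
  have e4 : Real.sqrt (t ^ 2 / (4 * r)) = t / (2 * Real.sqrt r) := by
    rw [show t ^ 2 / (4 * r) = (t / (2 * Real.sqrt r)) ^ 2 by
      rw [div_pow, mul_pow, Real.sq_sqrt hr0.le]; norm_num]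
    exact Real.sqrt_sq (by positivity)
  have e5 : r ^ (-3 / 2 : ℝ) = Real.sqrt r / r ^ 2 := by
    rw [Real.sqrt_eq_rpow, ← Real.rpow_natCast, ← Real.rpow_sub hr0]; norm_num
  rw [e1, e2, e3, e4, subord, e5]
  have : Real.sqrt Real.pi ≠ 0 := by positivity
  have : Real.sqrt r ≠ 0 := by positivity
  rw [neg_div]
  field_simp
  ring

lemma poissonHermite_eq {t : ℝ} (ht : 0 < t) (f : Euc d → ℝ) (x : Euc d) :
    poissonHermite t f x = ∫ r in Set.Ioi (0 : ℝ), subord t r * ouSemigroup r f x :=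
  integral_subord_mul ht fun r => ouSemigroup r f x

lemma integral_exp_neg_div_sqrt :
    ∫ u in Set.Ioi (0 : ℝ), Real.exp (-u) / Real.sqrt u = Real.sqrt Real.pi := by
  rw [← Real.Gamma_one_half_eq, Real.Gamma_eq_integral (by norm_num)]
  refine setIntegral_congr_fun measurableSet_Ioi fun u hu => ?_
  have hu0 : 0 < u := hu
  rw [show (1 / 2 - 1 : ℝ) = -(1 / 2) by norm_num, Real.rpow_neg hu0.le, ← Real.sqrt_eq_rpow]
  rfl

lemma integral_subord {t : ℝ} (ht : 0 < t) : ∫ r in Set.Ioi (0 : ℝ), subord t r = 1 := by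
  have h := integral_subord_mul ht fun _ => 1
  simp only [mul_one] at h
  rw [← h, integral_exp_neg_div_sqrt, one_div, inv_mul_cancel₀ (by positivity)]

lemma integrableOn_subord {t : ℝ} (ht : 0 < t) : IntegrableOn (subord t) (Set.Ioi 0) := by
  by_contra h
  have h1 := integral_subord ht
  rw [integral_undef h] at h1
  exact zero_ne_one h1

lemma lintegral_subord {t : ℝ} (ht : 0 < t) :
    ∫⁻ r in Set.Ioi (0 : ℝ), ENNReal.ofReal (subord t r) = 1 := by
  rw [← ofReal_integral_eq_lintegral_ofReal (integrableOn_subord ht), integral_subord ht,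
    ENNReal.ofReal_one]
  exact (ae_restrict_mem measurableSet_Ioi).mono fun r hr => subord_nonneg ht.le hr

/-- The growth at `0` allowed in integrals against `subord`. -/
structure SubordGrowth (H : ℝ → ℝ) : Prop where
  aestronglyMeasurable : AEStronglyMeasurable H (volume.restrict (Set.Ioi 0))
  bound : ∀ a, 0 < a → ∃ C, 0 ≤ C ∧ ∀ r, 0 < r → |H r| ≤ C * Real.exp (a / r)

/-- An integrable majorant valid for all times near `t`, which permits differentiation under the
integral sign. -/
lemma SubordGrowth.exists_bound (k : ℕ) {H : ℝ → ℝ} (hH : SubordGrowth H) {t : ℝ} (ht : 0 < t) :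
    ∃ C, ∀ s ∈ Metric.ball t (t / 2), ∀ r, 0 < r →
      ‖subordDeriv k s r * H r‖ ≤ C * subord (t / 4) r := by
  obtain ⟨C, hC, h⟩ := exists_abs_subordDeriv_le k
  -- For `s ≥ t/2`, `subord (s / √2) r` decays like `e^{-t²/(32r)}` or faster. Spending `t²/(64r)`
  -- on `H` leaves exactly the exponential of `subord (t / 4) r`; the factor `6` comes from `s ≤ 6
  -- (t/4)`.
  obtain ⟨D, hD, hHb⟩ := hH.bound (t ^ 2 / 64) (by positivity)
  refine ⟨C * ((t / 2) ^ k)⁻¹ * (6 * D), fun s hs r hr => ?_⟩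
  rw [Metric.mem_ball, Real.dist_eq, abs_lt] at hs
  have hs1 : t / 2 ≤ s := by linarith
  have hs0 : 0 < s := by linarith
  have hs2 : s ≤ 3 * t / 2 := by linarith
  have h1 : subord (s / Real.sqrt 2) r * Real.exp (t ^ 2 / 64 / r) ≤ 6 * subord (t / 4) r := by
    unfold subord
    have hsq : 1 ≤ Real.sqrt 2 := by rw [Real.one_le_sqrt]; norm_num
    have e1 : s / Real.sqrt 2 ≤ 6 * (t / 4) := (div_le_self hs0.le hsq).trans (by linarith)
    have e2 : Real.exp (-(s / Real.sqrt 2) ^ 2 / (4 * r)) * Real.exp (t ^ 2 / 64 / r) ≤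
        Real.exp (-(t / 4) ^ 2 / (4 * r)) := by
      rw [← Real.exp_add]
      refine Real.exp_le_exp.2 ?_
      rw [div_pow, Real.sq_sqrt (by norm_num), div_add_div _ _ (by positivity) (by positivity),
        div_le_div_iff₀ (by positivity) (by positivity)]
      have : (t / 2) ^ 2 ≤ s ^ 2 := pow_le_pow_left₀ (by positivity) hs1 2
      nlinarith [mul_le_mul_of_nonneg_left this (sq_nonneg r)]
    calc _ = s / Real.sqrt 2 / (2 * Real.sqrt Real.pi) * r ^ (-3 / 2 : ℝ) *
          (Real.exp (-(s / Real.sqrt 2) ^ 2 / (4 * r)) * Real.exp (t ^ 2 / 64 / r)) := by ring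
      _ ≤ 6 * (t / 4) / (2 * Real.sqrt Real.pi) * r ^ (-3 / 2 : ℝ) *
          Real.exp (-(t / 4) ^ 2 / (4 * r)) := by gcongr
      _ = _ := by ring
  have h2 : (s ^ k)⁻¹ ≤ ((t / 2) ^ k)⁻¹ :=
    inv_anti₀ (by positivity) (pow_le_pow_left₀ (by positivity) hs1 k)
  have h3 := subord_nonneg (t := s / Real.sqrt 2) (by positivity) hr
  rw [norm_mul, Real.norm_eq_abs, Real.norm_eq_abs]
  calc _ ≤ (C * (s ^ k)⁻¹ * subord (s / Real.sqrt 2) r) * (D * Real.exp (t ^ 2 / 64 / r)) :=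
        mul_le_mul (h s r hs0 hr) (hHb r hr) (abs_nonneg _) (by positivity)
    _ = C * (s ^ k)⁻¹ * D * (subord (s / Real.sqrt 2) r * Real.exp (t ^ 2 / 64 / r)) := by ring
    _ ≤ C * ((t / 2) ^ k)⁻¹ * D * (6 * subord (t / 4) r) := by gcongr
    _ = _ := by ring

lemma SubordGrowth.integrable (k : ℕ) {H : ℝ → ℝ} (hH : SubordGrowth H) {t : ℝ} (ht : 0 < t) :
    IntegrableOn (fun r => subordDeriv k t r * H r) (Set.Ioi 0) := by
  obtain ⟨C, h⟩ := hH.exists_bound k ht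
  refine Integrable.mono' ((integrableOn_subord (show 0 < t / 4 by positivity)).const_mul C)
    (AEStronglyMeasurable.mul (Measurable.aestronglyMeasurable (by fun_prop))
      hH.aestronglyMeasurable) ?_
  exact (ae_restrict_mem measurableSet_Ioi).mono fun r hr =>
    h t (Metric.mem_ball_self (by positivity)) r hr

lemma SubordGrowth.hasDerivAt (k : ℕ) {H : ℝ → ℝ} (hH : SubordGrowth H) {t : ℝ} (ht : 0 < t) :
    HasDerivAt (fun t => ∫ r in Set.Ioi (0 : ℝ), subordDeriv k t r * H r)
      (∫ r in Set.Ioi (0 : ℝ), subordDeriv (k + 1) t r * H r) t := by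
  obtain ⟨C, h⟩ := hH.exists_bound (k + 1) ht
  refine (hasDerivAt_integral_of_dominated_loc_of_deriv_le (μ := volume.restrict (Set.Ioi 0))
    (F := fun t r => subordDeriv k t r * H r) (F' := fun t r => subordDeriv (k + 1) t r * H r)
    (bound := fun r => C * subord (t / 4) r) (Metric.ball_mem_nhds t (half_pos ht)) ?_
    (hH.integrable k ht) ?_ ?_ ?_ ?_).2
  · exact Eventually.of_forall fun s => AEStronglyMeasurable.mul
      (Measurable.aestronglyMeasurable (by fun_prop)) hH.aestronglyMeasurable
  · exact AEStronglyMeasurable.mul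
      (Measurable.aestronglyMeasurable (by fun_prop)) hH.aestronglyMeasurable
  · exact (ae_restrict_mem measurableSet_Ioi).mono fun r hr s hs => h s hs r hr
  · exact (integrableOn_subord (show 0 < t / 4 by positivity)).const_mul C
  · refine (ae_restrict_mem measurableSet_Ioi).mono fun r hr s hs => ?_
    rw [Metric.mem_ball, Real.dist_eq, abs_lt] at hs
    exact (hasDerivAt_subordDeriv k (by linarith) hr).mul_const _

lemma SubordGrowth.iteratedDeriv_eq {H : ℝ → ℝ} (hH : SubordGrowth H) {Φ : ℝ → ℝ}
    (hΦ : ∀ t, 0 < t → Φ t = ∫ r in Set.Ioi (0 : ℝ), subord t r * H r) (k : ℕ) {t : ℝ}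
    (ht : 0 < t) :
    iteratedDeriv k Φ t = ∫ r in Set.Ioi (0 : ℝ), subordDeriv k t r * H r := by
  induction k generalizing t with
  | zero => simpa using hΦ t ht
  | succ k ih =>
    rw [iteratedDeriv_succ]
    have : iteratedDeriv k Φ =ᶠ[𝓝 t] fun t => ∫ r in Set.Ioi (0 : ℝ), subordDeriv k t r * H r := by
      filter_upwards [lt_mem_nhds ht] with s hs using ih hs
    rw [this.deriv_eq, (hH.hasDerivAt k ht).deriv]

/-! ### Derivatives of the Poisson-Hermite semigroup as operators on `L¹` -/

/-- The Ornstein-Uhlenbeck semigroup as an integral against the Mehler kernel. -/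
def mehlerInt (r : ℝ) (f : Euc d → ℝ) (x : Euc d) : ℝ :=
  ∫ y, mehler r x y * f y ∂gaussianMeasure d

/-- The operator `∂_t^k P_t` on integrable functions. -/
def poissonOp (k : ℕ) (t : ℝ) (f : Euc d → ℝ) (x : Euc d) : ℝ :=
  ∫ r in Set.Ioi (0 : ℝ), subordDeriv k t r * mehlerInt r f x

/-- The Poisson-Hermite semigroup on functions with values in `[0, ∞]`. -/
def poissonPos (t : ℝ) (F : Euc d → ℝ≥0∞) (x : Euc d) : ℝ≥0∞ :=
  ∫⁻ r in Set.Ioi (0 : ℝ), ENNReal.ofReal (subord t r) * ouPos r F x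

lemma mehlerInt_congr {f g : Euc d → ℝ} (h : f =ᵐ[gaussianMeasure d] g) (r : ℝ) (x : Euc d) :
    mehlerInt r f x = mehlerInt r g x := by
  refine integral_congr_ae ?_
  filter_upwards [h] with y hy
  rw [hy]

lemma poissonOp_congr {f g : Euc d → ℝ} (h : f =ᵐ[gaussianMeasure d] g) (k : ℕ) (t : ℝ) :
    poissonOp k t f = poissonOp k t g := by
  funext x
  simp only [poissonOp, mehlerInt_congr h]

lemma integrable_mehler_mul {r : ℝ} (hr : 0 < r) {f : Euc d → ℝ}
    (hf : Integrable f (gaussianMeasure d)) (x : Euc d) :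
    Integrable (fun y => mehler r x y * f y) (gaussianMeasure d) := by
  refine hf.bdd_mul (c := (1 - Real.exp (-2 * r)) ^ (-((d : ℝ) / 2)) * Real.exp (‖x‖ ^ 2))
    (Measurable.aestronglyMeasurable (by fun_prop)) (Eventually.of_forall fun y => ?_)
  rw [Real.norm_eq_abs, abs_of_nonneg (mehler_nonneg hr x y)]
  exact mehler_le hr x y

lemma mehlerInt_sub {r : ℝ} (hr : 0 < r) {f g : Euc d → ℝ}
    (hf : Integrable f (gaussianMeasure d)) (hg : Integrable g (gaussianMeasure d)) (x : Euc d) :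
    mehlerInt r (fun y => f y - g y) x = mehlerInt r f x - mehlerInt r g x := by
  simp only [mehlerInt, mul_sub]
  exact integral_sub (integrable_mehler_mul hr hf x) (integrable_mehler_mul hr hg x)

lemma enorm_mehlerInt_le {r : ℝ} (hr : 0 < r) (f : Euc d → ℝ) (x : Euc d) :
    ‖mehlerInt r f x‖ₑ ≤ ouPos r (fun y => ‖f y‖ₑ) x := by
  refine (enorm_integral_le_lintegral_enorm _).trans_eq (lintegral_congr fun y => ?_)
  rw [enorm_mul, Real.enorm_of_nonneg (mehler_nonneg hr x y)]

lemma stronglyMeasurable_mehlerInt {f : Euc d → ℝ} (hf : Measurable f) :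
    StronglyMeasurable fun z : ℝ × Euc d => mehlerInt z.1 f z.2 := by
  refine StronglyMeasurable.integral_prod_right' (f := fun z : (ℝ × Euc d) × Euc d =>
    mehler z.1.1 z.1.2 z.2 * f z.2) (Measurable.stronglyMeasurable ?_)
  fun_prop

lemma measurable_mehlerInt_comp {Ω : Type*} [MeasurableSpace Ω] {f : Euc d → ℝ} (hf : Measurable f)
    {r : Ω → ℝ} {x : Ω → Euc d} (hr : Measurable r) (hx : Measurable x) :
    Measurable fun ω => mehlerInt (r ω) f (x ω) := by
  have h := (stronglyMeasurable_mehlerInt hf).measurable.comp (hr.prodMk hx)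
  exact h

lemma stronglyMeasurable_poissonOp (k : ℕ) {f : Euc d → ℝ} (hf : Measurable f) :
    StronglyMeasurable fun z : ℝ × Euc d => poissonOp k z.1 f z.2 := by
  refine StronglyMeasurable.integral_prod_right' (f := fun z : (ℝ × Euc d) × ℝ =>
    subordDeriv k z.1.1 z.2 * mehlerInt z.2 f z.1.2) (Measurable.stronglyMeasurable ?_)
  have := measurable_mehlerInt_comp (Ω := (ℝ × Euc d) × ℝ) hf (r := fun z => z.2)
    (x := fun z => z.1.2) (by fun_prop) (by fun_prop)
  fun_prop

lemma measurable_poissonOp_comp (k : ℕ) {Ω : Type*} [MeasurableSpace Ω] {f : Euc d → ℝ}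
    (hf : Measurable f) {t : Ω → ℝ} {x : Ω → Euc d} (ht : Measurable t) (hx : Measurable x) :
    Measurable fun ω => poissonOp k (t ω) f (x ω) := by
  have h := (stronglyMeasurable_poissonOp k hf).measurable.comp (ht.prodMk hx)
  exact h

lemma measurable_poissonOp (k : ℕ) (t : ℝ) {f : Euc d → ℝ}
    (hf : AEMeasurable f (gaussianMeasure d)) : Measurable (poissonOp k t f) := by
  rw [poissonOp_congr hf.ae_eq_mk]
  exact measurable_poissonOp_comp k hf.measurable_mk measurable_const measurable_id

lemma lintegral_poissonPos {t : ℝ} (ht : 0 < t) {F : Euc d → ℝ≥0∞} (hF : Measurable F) :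
    ∫⁻ x, poissonPos t F x ∂gaussianMeasure d = ∫⁻ x, F x ∂gaussianMeasure d := by
  unfold poissonPos
  have hm := measurable_ouPos_comp (Ω := Euc d × ℝ) hF (r := fun z => z.2)
    (x := fun z => z.1) (by fun_prop) (by fun_prop)
  rw [lintegral_lintegral_swap (Measurable.aemeasurable (by fun_prop))]
  calc _ = ∫⁻ r in Set.Ioi (0 : ℝ), ENNReal.ofReal (subord t r) *
        ∫⁻ x, F x ∂gaussianMeasure d := by
        refine setLIntegral_congr_fun measurableSet_Ioi fun r hr => ?_
        rw [lintegral_const_mul' _ _ ENNReal.ofReal_ne_top, lintegral_ouPos hr hF]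
    _ = _ := by rw [lintegral_mul_const _ (by fun_prop), lintegral_subord ht, one_mul]

/-- A pointwise domination by a positive operator, valid for every `f`. Both the `L¹` and the
`L^{p(·)}` estimates for `∂_t^k P_t` are read off from it. -/
lemma exists_enorm_poissonOp_le (k : ℕ) :
    ∃ C : ℝ, 0 ≤ C ∧ ∀ t, 0 < t → ∀ (f : Euc d → ℝ) (x : Euc d),
      ‖poissonOp k t f x‖ₑ ≤
        ENNReal.ofReal (C * (t ^ k)⁻¹) * poissonPos (t / Real.sqrt 2) (fun y => ‖f y‖ₑ) x := by
  obtain ⟨C, hC, h⟩ := exists_abs_subordDeriv_le k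
  refine ⟨C, hC, fun t ht f x => ?_⟩
  refine (enorm_integral_le_lintegral_enorm _).trans ?_
  rw [poissonPos, ← lintegral_const_mul' _ _ ENNReal.ofReal_ne_top]
  refine setLIntegral_mono' measurableSet_Ioi fun r hr => ?_
  rw [enorm_mul, ← mul_assoc, ← ENNReal.ofReal_mul (by positivity)]
  gcongr
  · rw [Real.enorm_eq_ofReal_abs]
    exact ENNReal.ofReal_le_ofReal (h t r ht hr)
  · exact enorm_mehlerInt_le hr f x

/-- Since `(1 - e^{-2r})⁻¹ ≤ 1 + 1/r`, the singularity at `r = 0` is polynomial in `1/r` and is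
beaten by any `e^{a/r}`. -/
lemma exists_rpow_neg_le_exp (s : ℝ) {a : ℝ} (ha : 0 < a) :
    ∃ C : ℝ, 0 ≤ C ∧ ∀ r, 0 < r → (1 - Real.exp (-2 * r)) ^ (-s) ≤ C * Real.exp (a / r) := by
  obtain ⟨C, hC, h⟩ := exists_abs_eval_le ((1 + Polynomial.X) ^ ⌈|s|⌉₊ : Polynomial ℝ) ha
  refine ⟨C, hC, fun r hr => ?_⟩
  have hδ := one_sub_exp_pos hr
  have h1 := h (1 / r)
  rw [Polynomial.eval_pow, Polynomial.eval_add, Polynomial.eval_one, Polynomial.eval_X,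
    abs_of_pos (show (0 : ℝ) < (1 + 1 / r) ^ ⌈|s|⌉₊ by positivity),
    abs_of_pos (show (0 : ℝ) < 1 / r by positivity), mul_one_div] at h1
  refine le_trans ?_ h1
  have hd1 : 1 - Real.exp (-2 * r) ≤ 1 := by linarith [Real.exp_pos (-2 * r)]
  have h2 : (1 - Real.exp (-2 * r))⁻¹ ≤ 1 + 1 / r := by
    have h3 : 1 + 2 * r ≤ Real.exp (2 * r) := by linarith [Real.add_one_le_exp (2 * r)]
    have h4 : Real.exp (-2 * r) ≤ 1 / (1 + 2 * r) := by
      rw [show -2 * r = -(2 * r) by ring, Real.exp_neg, ← one_div]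
      exact one_div_le_one_div_of_le (by positivity) h3
    have h5 : r / (1 + r) ≤ 1 - Real.exp (-2 * r) := by
      have : 1 / (1 + 2 * r) ≤ 1 / (1 + r) := one_div_le_one_div_of_le (by positivity) (by linarith)
      have h6 : r / (1 + r) = 1 - 1 / (1 + r) := by field_simp; ring
      rw [h6]; linarith
    calc _ ≤ (r / (1 + r))⁻¹ := inv_anti₀ (by positivity) h5
      _ = _ := by field_simp; ring
  calc (1 - Real.exp (-2 * r)) ^ (-s) = ((1 - Real.exp (-2 * r))⁻¹) ^ s := by
        rw [Real.rpow_neg hδ.le, Real.inv_rpow hδ.le]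
    _ ≤ ((1 - Real.exp (-2 * r))⁻¹) ^ (⌈|s|⌉₊ : ℝ) :=
        Real.rpow_le_rpow_of_exponent_le ((one_le_inv₀ hδ).2 hd1)
          ((le_abs_self s).trans (Nat.le_ceil _))
    _ = ((1 - Real.exp (-2 * r))⁻¹) ^ ⌈|s|⌉₊ := Real.rpow_natCast _ _
    _ ≤ _ := pow_le_pow_left₀ (by positivity) h2 _

lemma subordGrowth_mehlerInt {f : Euc d → ℝ} (hf : Integrable f (gaussianMeasure d)) (x : Euc d) :
    SubordGrowth fun r => mehlerInt r f x where
  aestronglyMeasurable := by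
    simp_rw [fun r => mehlerInt_congr hf.1.aemeasurable.ae_eq_mk r x]
    exact (measurable_mehlerInt_comp hf.1.aemeasurable.measurable_mk measurable_id
      measurable_const).aestronglyMeasurable
  bound := fun a ha => by
    obtain ⟨C, hC, h⟩ := exists_rpow_neg_le_exp ((d : ℝ) / 2) ha
    refine ⟨C * Real.exp (‖x‖ ^ 2) * ∫ y, ‖f y‖ ∂gaussianMeasure d, by positivity,
      fun r hr => ?_⟩
    rw [← Real.norm_eq_abs, mehlerInt]
    calc _ ≤ ∫ y, ‖mehler r x y * f y‖ ∂gaussianMeasure d := norm_integral_le_integral_norm _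
      _ ≤ ∫ y, C * Real.exp (a / r) * Real.exp (‖x‖ ^ 2) * ‖f y‖ ∂gaussianMeasure d := by
          refine integral_mono (integrable_mehler_mul hr hf x).norm (hf.norm.const_mul _) fun y => ?_
          simp only [norm_mul]
          refine mul_le_mul_of_nonneg_right ?_ (norm_nonneg _)
          rw [Real.norm_eq_abs, abs_of_nonneg (mehler_nonneg hr x y)]
          exact (mehler_le hr x y).trans
            (mul_le_mul_of_nonneg_right (h r hr) (Real.exp_pos _).le)
      _ = _ := by rw [integral_const_mul]; ring

/-- The Mehler kernel is bounded in `y`, so for integrable `f` differentiation under the integral is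
legitimate at every `x`, not merely almost everywhere, and `iteratedDeriv` takes no default values.
-/
lemma poissonDeriv_eq (k : ℕ) {f : Euc d → ℝ} (hf : Integrable f (gaussianMeasure d)) {t : ℝ}
    (ht : 0 < t) : poissonDeriv k f t = poissonOp k t f := by
  funext x
  refine (subordGrowth_mehlerInt hf x).iteratedDeriv_eq (fun s hs => ?_) k ht
  rw [poissonHermite_eq hs]
  refine setIntegral_congr_fun measurableSet_Ioi fun r hr => ?_
  rw [ouSemigroup_eq hr, mehlerInt]

lemma poissonOp_sub (k : ℕ) {f g : Euc d → ℝ} (hf : Integrable f (gaussianMeasure d))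
    (hg : Integrable g (gaussianMeasure d)) {t : ℝ} (ht : 0 < t) (x : Euc d) :
    poissonOp k t (fun y => f y - g y) x = poissonOp k t f x - poissonOp k t g x := by
  unfold poissonOp
  rw [← integral_sub ((subordGrowth_mehlerInt hf x).integrable k ht)
    ((subordGrowth_mehlerInt hg x).integrable k ht)]
  refine setIntegral_congr_fun measurableSet_Ioi fun r hr => ?_
  rw [mehlerInt_sub hr hf hg, mul_sub]

lemma exists_lintegral_poissonOp_le (k : ℕ) :
    ∃ C : ℝ, 0 ≤ C ∧ ∀ t, 0 < t → ∀ f : Euc d → ℝ, AEMeasurable f (gaussianMeasure d) →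
      ∫⁻ x, ‖poissonOp k t f x‖ₑ ∂gaussianMeasure d ≤
        ENNReal.ofReal (C * (t ^ k)⁻¹) * ∫⁻ x, ‖f x‖ₑ ∂gaussianMeasure d := by
  obtain ⟨C, hC, h⟩ := exists_enorm_poissonOp_le (d := d) k
  refine ⟨C, hC, fun t ht f hf => ?_⟩
  have he : ∫⁻ x, ‖f x‖ₑ ∂gaussianMeasure d = ∫⁻ x, ‖hf.mk f x‖ₑ ∂gaussianMeasure d :=
    lintegral_congr_ae (hf.ae_eq_mk.fun_comp fun a => ‖a‖ₑ)
  rw [poissonOp_congr hf.ae_eq_mk, he]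
  refine (lintegral_mono (h t ht _)).trans ?_
  rw [lintegral_const_mul' _ _ ENNReal.ofReal_ne_top,
    lintegral_poissonPos (by positivity) hf.measurable_mk.enorm]

lemma integrable_poissonOp (k : ℕ) {f : Euc d → ℝ} (hf : Integrable f (gaussianMeasure d)) {t : ℝ}
    (ht : 0 < t) : Integrable (poissonOp k t f) (gaussianMeasure d) := by
  obtain ⟨C, hC, h⟩ := exists_lintegral_poissonOp_le (d := d) k
  refine ⟨(measurable_poissonOp k t hf.1.aemeasurable).aestronglyMeasurable, ?_⟩
  exact (h t ht f hf.1.aemeasurable).trans_lt (ENNReal.mul_lt_top ENNReal.ofReal_lt_top hf.2)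

/-! ### Convexity of the modular -/

/-- The modular of an average is at most the supremum of the modulars. -/
lemma lintegral_average_rpow_le {Ω : Type*} [MeasurableSpace Ω] {μ : Measure Ω} [SFinite μ]
    {p : Euc d → ℝ} (hp : Measurable p) (hp1 : ∀ x, 1 ≤ p x) {w : Ω → ℝ≥0∞} (hw : Measurable w)
    (hw1 : ∫⁻ ω, w ω ∂μ ≤ 1) {S : Ω → Euc d → ℝ≥0∞} (hS : Measurable (Function.uncurry S))
    {C : ℝ≥0∞} (hC : ∀ᵐ ω ∂μ, ∫⁻ x, S ω x ^ p x ∂gaussianMeasure d ≤ C) :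
    ∫⁻ x, (∫⁻ ω, w ω * S ω x ∂μ) ^ p x ∂gaussianMeasure d ≤ C := by
  have hSm : Measurable fun z : Euc d × Ω => S z.2 z.1 := hS.comp measurable_swap
  have hSpm : Measurable fun z : Euc d × Ω => w z.2 * S z.2 z.1 ^ p z.1 := by fun_prop
  calc _ ≤ ∫⁻ x, ∫⁻ ω, w ω * S ω x ^ p x ∂μ ∂gaussianMeasure d := by
        refine lintegral_mono fun x => rpow_lintegral_mul_le hw.aemeasurable ?_ hw1 (hp1 x)
        exact (hS.comp measurable_prodMk_right).aemeasurable
    _ = ∫⁻ ω, ∫⁻ x, w ω * S ω x ^ p x ∂gaussianMeasure d ∂μ :=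
        lintegral_lintegral_swap hSpm.aemeasurable
    _ = ∫⁻ ω, w ω * ∫⁻ x, S ω x ^ p x ∂gaussianMeasure d ∂μ := by
        refine lintegral_congr fun ω => lintegral_const_mul _ ?_
        exact (hS.comp measurable_prodMk_left).pow hp
    _ ≤ ∫⁻ ω, w ω * C ∂μ := by
        refine lintegral_mono_ae ?_
        filter_upwards [hC] with ω hω
        gcongr
    _ = (∫⁻ ω, w ω ∂μ) * C := lintegral_mul_const _ hw
    _ ≤ 1 * C := by gcongr
    _ = C := one_mul C

lemma lintegral_poissonPos_rpow_le {p : Euc d → ℝ} (hp : Measurable p) (hp1 : ∀ x, 1 ≤ p x)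
    {F : Euc d → ℝ≥0∞} (hF : Measurable F) {C : ℝ≥0∞}
    (hC : ∀ r, 0 < r → ∫⁻ x, ouPos r F x ^ p x ∂gaussianMeasure d ≤ C) {t : ℝ} (ht : 0 < t) :
    ∫⁻ x, poissonPos t F x ^ p x ∂gaussianMeasure d ≤ C :=
  lintegral_average_rpow_le hp hp1 (by fun_prop) (lintegral_subord ht).le
    (S := fun r x => ouPos r F x) (measurable_ouPos hF)
    ((ae_restrict_mem measurableSet_Ioi).mono fun r hr => hC r hr)

/-- The operators `P_t` are contractions on `L^q` for a constant exponent `q`. -/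
lemma lintegral_poissonPos_rpow_const_le {q : ℝ} (hq : 1 ≤ q) {F : Euc d → ℝ≥0∞}
    (hF : Measurable F) {t : ℝ} (ht : 0 < t) :
    ∫⁻ x, poissonPos t F x ^ q ∂gaussianMeasure d ≤ ∫⁻ x, F x ^ q ∂gaussianMeasure d :=
  lintegral_poissonPos_rpow_le (p := fun _ => q) measurable_const (fun _ => hq) hF
    (fun _ hr => (lintegral_mono (ouPos_rpow_le hr hF hq)).trans_eq
      (lintegral_ouPos hr (hF.pow_const q))) ht

/-! ### Hermite polynomials in one variable -/

/-- The Hermite polynomials for the weight `e^{-y²}`. -/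
def hermitePoly : ℕ → Polynomial ℝ
  | 0 => 1
  | n + 1 => Polynomial.C 2 * Polynomial.X * hermitePoly n - (hermitePoly n).derivative

lemma derivative_hermitePoly_succ (n : ℕ) :
    (hermitePoly (n + 1)).derivative = Polynomial.C (2 * (n + 1 : ℝ)) * hermitePoly n := by
  induction n with
  | zero =>
    simp only [hermitePoly]
    simp
  | succ n ih =>
    rw [hermitePoly, Polynomial.derivative_sub, ih]
    simp only [Polynomial.derivative_mul, Polynomial.derivative_C, Polynomial.derivative_X, ih]
    rw [show hermitePoly (n + 1) = Polynomial.C 2 * Polynomial.X * hermitePoly n -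
      (hermitePoly n).derivative from rfl]
    simp only [map_mul, map_add, map_one, Nat.cast_add, Nat.cast_one]
    ring

lemma hasDerivAt_exp_neg_sq (y : ℝ) :
    HasDerivAt (fun z : ℝ => Real.exp (-z ^ 2)) (Real.exp (-y ^ 2) * (-(2 * y))) y := by
  refine HasDerivAt.exp ?_
  simpa using (hasDerivAt_pow 2 y).fun_neg

lemma iteratedDeriv_exp_neg_sq (n : ℕ) :
    iteratedDeriv n (fun z : ℝ => Real.exp (-z ^ 2)) =
      fun y => (-1) ^ n * (hermitePoly n).eval y * Real.exp (-y ^ 2) := by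
  induction n with
  | zero => simp [hermitePoly]
  | succ n ih =>
    rw [iteratedDeriv_succ, ih]
    funext y
    have h := (((hermitePoly n).hasDerivAt y).const_mul ((-1 : ℝ) ^ n)).mul
      (hasDerivAt_exp_neg_sq y)
    refine HasDerivAt.deriv (h.congr_deriv ?_)
    simp only [hermitePoly, Polynomial.eval_sub, Polynomial.eval_mul, Polynomial.eval_C,
      Polynomial.eval_X]
    ring

lemma hermiteOne_eq (n : ℕ) (y : ℝ) : hermiteOne n y = (hermitePoly n).eval y := by
  rw [hermiteOne, iteratedDeriv_exp_neg_sq]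
  have h1 : (-1 : ℝ) ^ n * (-1) ^ n = 1 := by rw [← mul_pow]; simp
  have h2 : Real.exp (y ^ 2) * Real.exp (-y ^ 2) = 1 := by rw [← Real.exp_add]; simp
  calc _ = ((-1 : ℝ) ^ n * (-1) ^ n) * (Real.exp (y ^ 2) * Real.exp (-y ^ 2)) *
        (hermitePoly n).eval y := by ring
    _ = _ := by rw [h1, h2, one_mul, one_mul]

lemma integrable_exp_mul_eval {s : ℝ} (hs : 0 < s) (m : ℝ) (Q : Polynomial ℝ) :
    Integrable fun y : ℝ => Real.exp (-(y - m) ^ 2 / s) * Q.eval y := by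
  obtain ⟨C, hC, h⟩ := exists_abs_eval_le (Q.comp (Polynomial.X + Polynomial.C m)) one_pos
  have h0 : Integrable fun y : ℝ =>
      Real.exp (-y ^ 2 / s) * (Q.comp (Polynomial.X + Polynomial.C m)).eval y := by
    refine Integrable.mono' ((integrable_exp_neg_mul_sq
      (show 0 < 1 / (2 * s) by positivity)).const_mul (C * Real.exp (s / 2)))
      (Continuous.aestronglyMeasurable (by fun_prop)) (Eventually.of_forall fun y => ?_)
    rw [norm_mul, Real.norm_eq_abs, Real.norm_eq_abs, abs_of_pos (Real.exp_pos _)]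
    calc _ ≤ Real.exp (-y ^ 2 / s) * (C * Real.exp (1 * |y|)) := by gcongr; exact h y
      _ = C * Real.exp (-y ^ 2 / s + |y|) := by rw [Real.exp_add, one_mul]; ring
      _ ≤ C * Real.exp (s / 2 + -(1 / (2 * s)) * y ^ 2) := by
        refine mul_le_mul_of_nonneg_left (Real.exp_le_exp.2 ?_) hC
        have h1 : -y ^ 2 / s = -(1 / (2 * s)) * y ^ 2 - y ^ 2 / (2 * s) := by field_simp; ring
        have h2 : |y| ≤ s / 2 + y ^ 2 / (2 * s) := by
          have : s / 2 + y ^ 2 / (2 * s) - |y| = (s - |y|) ^ 2 / (2 * s) := by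
            field_simp; rw [← sq_abs y]; ring
          have : 0 ≤ (s - |y|) ^ 2 / (2 * s) := by positivity
          linarith
        linarith
      _ = _ := by rw [Real.exp_add]; ring
  have h1 := h0.comp_sub_right m
  simpa using h1

/-- Integration by parts against the Gaussian `e^{-(y-m)²/s}`. -/
lemma integral_gaussian_two_mul_eval {s : ℝ} (hs : 0 < s) (m : ℝ) (Q : Polynomial ℝ) :
    ∫ y : ℝ, Real.exp (-(y - m) ^ 2 / s) * (Polynomial.C 2 * Polynomial.X * Q).eval y =
      2 * m * (∫ y : ℝ, Real.exp (-(y - m) ^ 2 / s) * Q.eval y) +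
        s * ∫ y : ℝ, Real.exp (-(y - m) ^ 2 / s) * Q.derivative.eval y := by
  have hu : ∀ y : ℝ, HasDerivAt (fun y : ℝ => Real.exp (-(y - m) ^ 2 / s))
      (Real.exp (-(y - m) ^ 2 / s) * (-(2 * (y - m)) / s)) y := by
    intro y
    refine HasDerivAt.exp (HasDerivAt.div_const ?_ _)
    simpa using (((hasDerivAt_id y).sub_const m).fun_pow 2).fun_neg
  have e1 : ∀ y : ℝ, Real.exp (-(y - m) ^ 2 / s) * (-(2 * (y - m)) / s) * Q.eval y =
      Real.exp (-(y - m) ^ 2 / s) *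
        (Polynomial.C (-2 / s) * (Polynomial.X - Polynomial.C m) * Q).eval y := by
    intro y
    simp only [Polynomial.eval_mul, Polynomial.eval_sub, Polynomial.eval_C, Polynomial.eval_X]
    ring
  have h := integral_mul_deriv_eq_deriv_mul_of_integrable (u := fun y : ℝ =>
    Real.exp (-(y - m) ^ 2 / s)) (v := fun y => Q.eval y) (fun y _ => hu y) (fun y _ => Q.hasDerivAt y)
    (integrable_exp_mul_eval hs m Q.derivative)
    (by
      have := integrable_exp_mul_eval hs m
        (Polynomial.C (-2 / s) * (Polynomial.X - Polynomial.C m) * Q)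
      refine this.congr (Eventually.of_forall fun y => ?_)
      exact (e1 y).symm)
    (integrable_exp_mul_eval hs m Q)
  have e2 : ∀ y : ℝ, Real.exp (-(y - m) ^ 2 / s) * (Polynomial.C 2 * Polynomial.X * Q).eval y =
      2 * m * (Real.exp (-(y - m) ^ 2 / s) * Q.eval y) -
      s * (Real.exp (-(y - m) ^ 2 / s) * (-(2 * (y - m)) / s) * Q.eval y) := by
    intro y
    simp only [Polynomial.eval_mul, Polynomial.eval_C, Polynomial.eval_X]
    field_simp
    ring
  simp_rw [e2]
  rw [integral_sub ((integrable_exp_mul_eval hs m Q).const_mul _), integral_const_mul,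
    integral_const_mul, h]
  · ring
  · have := integrable_exp_mul_eval hs m
      (Polynomial.C (-2 / s) * (Polynomial.X - Polynomial.C m) * Q)
    refine (this.congr (Eventually.of_forall fun y => ?_)).const_mul s
    exact (e1 y).symm

lemma integral_exp_neg_sub_sq_div {s : ℝ} (m : ℝ) :
    ∫ y : ℝ, Real.exp (-(y - m) ^ 2 / s) = Real.sqrt (Real.pi * s) := by
  rw [integral_sub_right_eq_self (fun y : ℝ => Real.exp (-y ^ 2 / s)) m]
  have := integral_gaussian (1 / s)
  rw [div_div_eq_mul_div, div_one] at this
  rw [← this]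
  congr 1
  funext y
  congr 1
  ring

/-- The one-variable Mehler formula. -/
lemma integral_gaussian_hermitePoly {ρ : ℝ} (hρ : ρ ^ 2 < 1) (x : ℝ) (n : ℕ) :
    ∫ y : ℝ, Real.exp (-(y - ρ * x) ^ 2 / (1 - ρ ^ 2)) * (hermitePoly n).eval y =
      Real.sqrt (Real.pi * (1 - ρ ^ 2)) * (ρ ^ n * (hermitePoly n).eval x) := by
  have hs : 0 < 1 - ρ ^ 2 := by linarith
  -- Integrating `2y H_n` by parts produces `(1 - ρ²) ∫ H_n'`; subtracting `∫ H_n'` leaves the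
  -- coefficient `-ρ²`. As `H_n' = 2n H_{n-1}`, this is the three-term recurrence satisfied by `ρ^n
  -- H_n(x)`.
  have hstep : ∀ n, ∫ y : ℝ, Real.exp (-(y - ρ * x) ^ 2 / (1 - ρ ^ 2)) *
      (hermitePoly (n + 1)).eval y =
      2 * (ρ * x) * (∫ y : ℝ, Real.exp (-(y - ρ * x) ^ 2 / (1 - ρ ^ 2)) * (hermitePoly n).eval y) -
      ρ ^ 2 * ∫ y : ℝ, Real.exp (-(y - ρ * x) ^ 2 / (1 - ρ ^ 2)) *
        (hermitePoly n).derivative.eval y := by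
    intro n
    have h1 := integral_gaussian_two_mul_eval hs (ρ * x) (hermitePoly n)
    simp only [hermitePoly, Polynomial.eval_sub, mul_sub]
    rw [integral_sub (integrable_exp_mul_eval hs _ _) (integrable_exp_mul_eval hs _ _), h1]
    ring
  induction n using Nat.twoStepInduction with
  | zero => simp [hermitePoly, integral_exp_neg_sub_sq_div]
  | one =>
    rw [hstep]
    simp only [hermitePoly, Polynomial.derivative_one, Polynomial.eval_one, Polynomial.eval_zero,
      mul_one, mul_zero, integral_zero, integral_exp_neg_sub_sq_div]
    simp
    ring
  | more n ih0 ih1 =>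
    rw [hstep, ih1, derivative_hermitePoly_succ]
    have h2 : ∀ y : ℝ, Real.exp (-(y - ρ * x) ^ 2 / (1 - ρ ^ 2)) *
        (Polynomial.C (2 * (n + 1 : ℝ)) * hermitePoly n).eval y = (2 * (n + 1 : ℝ)) *
        (Real.exp (-(y - ρ * x) ^ 2 / (1 - ρ ^ 2)) * (hermitePoly n).eval y) := by
      intro y
      rw [Polynomial.eval_mul, Polynomial.eval_C]; ring
    simp_rw [h2]
    rw [integral_const_mul, ih0, show hermitePoly (n + 2) = Polynomial.C 2 * Polynomial.X *
      hermitePoly (n + 1) - (hermitePoly (n + 1)).derivative from rfl,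
      derivative_hermitePoly_succ]
    simp only [Polynomial.eval_sub, Polynomial.eval_mul, Polynomial.eval_C, Polynomial.eval_X]
    ring

/-! ### Hermite polynomials are eigenfunctions -/

lemma ouSemigroup_hermite {r : ℝ} (hr : 0 < r) (ν : Fin d → ℕ) (x : Euc d) :
    ouSemigroup r (hermite ν) x = Real.exp (-(r * multiLength ν)) * hermite ν x := by
  have hδ := one_sub_exp_pos hr
  set N := Real.sqrt ((2 : ℝ) ^ multiLength ν * ∏ i, ((ν i).factorial : ℝ)) with hN
  have h1 : ∫ y : Euc d, Real.exp (-‖y - Real.exp (-r) • x‖ ^ 2 / (1 - Real.exp (-2 * r))) *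
      hermite ν y = (∏ i, (Real.sqrt (Real.pi * (1 - Real.exp (-2 * r))) *
        (Real.exp (-r) ^ ν i * hermiteOne (ν i) (x i)))) / N := by
    rw [← (PiLp.volume_preserving_toLp (Fin d)).integral_comp
      (MeasurableEquiv.toLp 2 _).measurableEmbedding]
    have h2 : ∀ y : Fin d → ℝ, Real.exp (-‖WithLp.toLp 2 y - Real.exp (-r) • x‖ ^ 2 /
        (1 - Real.exp (-2 * r))) * hermite ν (WithLp.toLp 2 y) =
        (∏ i, (Real.exp (-(y i - Real.exp (-r) * x i) ^ 2 / (1 - Real.exp (-r) ^ 2)) *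
          (hermitePoly (ν i)).eval (y i))) / N := by
      intro y
      rw [Finset.prod_mul_distrib, ← Real.exp_sum, hermite, ← hN, mul_div_assoc]
      congr 1
      · rw [EuclideanSpace.real_norm_sq_eq, ← Finset.sum_div, exp_neg_two_mul,
          ← Finset.sum_neg_distrib]
        rfl
      · simp only [hermiteOne_eq]
    simp_rw [h2]
    rw [integral_div, integral_fintype_prod_volume_eq_prod (fun i (y : ℝ) =>
      Real.exp (-(y - Real.exp (-r) * x i) ^ 2 / (1 - Real.exp (-r) ^ 2)) *
          (hermitePoly (ν i)).eval y), exp_neg_two_mul]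
    congr 1
    refine Finset.prod_congr rfl fun i _ => ?_
    rw [exp_neg_two_mul] at hδ
    rw [integral_gaussian_hermitePoly (by linarith), hermiteOne_eq]
  rw [ouSemigroup, h1, Finset.prod_mul_distrib, Finset.prod_mul_distrib, Finset.prod_const,
    Finset.card_univ, Fintype.card_fin, Finset.prod_pow_eq_pow_sum, hermite, ← hN]
  have h3 : Real.sqrt (Real.pi * (1 - Real.exp (-2 * r))) ^ d =
      Real.pi ^ ((d : ℝ) / 2) * (1 - Real.exp (-2 * r)) ^ ((d : ℝ) / 2) := by
    rw [← Real.mul_rpow Real.pi_pos.le hδ.le, Real.sqrt_eq_rpow, ← Real.rpow_mul_natCast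
      (by positivity)]
    congr 1; ring
  have h4 : Real.exp (-r) ^ (∑ i, ν i) = Real.exp (-(r * multiLength ν)) := by
    rw [← Real.exp_nat_mul, multiLength]; congr 1; push_cast; ring
  have h5 : (1 - Real.exp (-2 * r)) ^ ((d : ℝ) / 2) ≠ 0 := by positivity
  rw [h3, h4]
  generalize (1 - Real.exp (-2 * r)) ^ ((d : ℝ) / 2) = A at h5
  field_simp

lemma mehlerInt_hermite {r : ℝ} (hr : 0 < r) (ν : Fin d → ℕ) (x : Euc d) :
    mehlerInt r (hermite ν) x = Real.exp (-(r * multiLength ν)) * hermite ν x := by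
  rw [mehlerInt, ← ouSemigroup_eq hr, ouSemigroup_hermite hr]

/-! ### The subordination formula -/

/-- The Laplace-type integral behind the subordination formula. -/
def subordLaplace (b : ℝ) : ℝ :=
  ∫ u in Set.Ioi (0 : ℝ), Real.exp (-u) / Real.sqrt u * Real.exp (-b ^ 2 / u)

lemma integrableOn_exp_neg_div_sqrt :
    IntegrableOn (fun u : ℝ => Real.exp (-u) / Real.sqrt u) (Set.Ioi 0) := by
  by_contra h
  have h1 := integral_exp_neg_div_sqrt
  rw [integral_undef h] at h1
  have : 0 < Real.sqrt Real.pi := by positivity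
  linarith

lemma exp_neg_div_sqrt_mul_le {u : ℝ} (hu : 0 < u) (b : ℝ) :
    ‖Real.exp (-u) / Real.sqrt u * Real.exp (-b ^ 2 / u)‖ ≤ Real.exp (-u) / Real.sqrt u := by
  rw [Real.norm_eq_abs, abs_of_nonneg (by positivity)]
  refine mul_le_of_le_one_right (by positivity) (Real.exp_le_one_iff.2 ?_)
  exact div_nonpos_of_nonpos_of_nonneg (neg_nonpos.2 (sq_nonneg b)) hu.le

lemma continuous_subordLaplace : Continuous subordLaplace := by
  refine continuous_of_dominated (bound := fun u => Real.exp (-u) / Real.sqrt u)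
    (fun b => Measurable.aestronglyMeasurable (by fun_prop)) (fun b => ?_)
    integrableOn_exp_neg_div_sqrt (Eventually.of_forall fun u => by fun_prop)
  exact (ae_restrict_mem measurableSet_Ioi).mono fun u hu => exp_neg_div_sqrt_mul_le hu b

lemma subordLaplace_zero : subordLaplace 0 = Real.sqrt Real.pi := by
  rw [← integral_exp_neg_div_sqrt, subordLaplace]
  simp

/-- The substitution `u ↦ b²/u`. Differentiating `subordLaplace` in `b` produces this second form of
the same integral, which closes a first-order differential equation. -/
lemma subordLaplace_eq_integral_subord {b : ℝ} (hb : 0 < b) :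
    subordLaplace b = Real.sqrt Real.pi *
      ∫ u in Set.Ioi (0 : ℝ), subord (2 * b) u * Real.exp (-u) := by
  rw [← integral_subord_mul (by positivity) fun u => Real.exp (-u), ← mul_assoc, mul_one_div,
    div_self (by positivity), one_mul, subordLaplace]
  refine setIntegral_congr_fun measurableSet_Ioi fun u hu => ?_
  have hu0 : 0 < u := hu
  congr 2
  field_simp
  ring

lemma hasDerivAt_subordLaplace {b : ℝ} (hb : 0 < b) :
    HasDerivAt subordLaplace (-2 * subordLaplace b) b := by
  have hpt : ∀ s u : ℝ, 0 < u → Real.exp (-u) / Real.sqrt u *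
      (Real.exp (-s ^ 2 / u) * (-(2 * s) / u)) =
      -2 * (Real.sqrt Real.pi * (subord (2 * s) u * Real.exp (-u))) := by
    intro s u hu
    have e5 : u ^ (-3 / 2 : ℝ) = (Real.sqrt u * u)⁻¹ := by
      rw [show (-3 / 2 : ℝ) = -(1 / 2 + 1) by norm_num, Real.rpow_neg hu.le, Real.rpow_add hu,
        Real.rpow_one, ← Real.sqrt_eq_rpow]
    rw [subord, e5, show -(2 * s) ^ 2 / (4 * u) = -s ^ 2 / u by field_simp; ring]
    have : Real.sqrt Real.pi ≠ 0 := by positivity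
    have : Real.sqrt u ≠ 0 := by positivity
    field_simp
  have h := (hasDerivAt_integral_of_dominated_loc_of_deriv_le
    (μ := volume.restrict (Set.Ioi (0 : ℝ)))
    (F := fun s u => Real.exp (-u) / Real.sqrt u * Real.exp (-s ^ 2 / u))
    (F' := fun s u => Real.exp (-u) / Real.sqrt u * (Real.exp (-s ^ 2 / u) * (-(2 * s) / u)))
    (bound := fun u => 6 * Real.sqrt Real.pi * subord b u)
    (Metric.ball_mem_nhds b (half_pos hb)) ?_ ?_ ?_ ?_ ?_ ?_).2
  · have hE : ∫ u in Set.Ioi (0 : ℝ), Real.exp (-u) / Real.sqrt u *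
        (Real.exp (-b ^ 2 / u) * (-(2 * b) / u)) = -2 * subordLaplace b := by
      rw [subordLaplace_eq_integral_subord hb, ← integral_const_mul, ← integral_const_mul]
      exact setIntegral_congr_fun measurableSet_Ioi fun u hu => hpt b u hu
    rw [← hE]
    exact h
  · exact Eventually.of_forall fun s => Measurable.aestronglyMeasurable (by fun_prop)
  · refine Integrable.mono' integrableOn_exp_neg_div_sqrt
      (Measurable.aestronglyMeasurable (by fun_prop)) ?_
    exact (ae_restrict_mem measurableSet_Ioi).mono fun u hu => exp_neg_div_sqrt_mul_le hu b
  · exact Measurable.aestronglyMeasurable (by fun_prop)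
  · refine (ae_restrict_mem measurableSet_Ioi).mono fun u hu s hs => ?_
    have hu0 : 0 < u := hu
    rw [Metric.mem_ball, Real.dist_eq, abs_lt] at hs
    have hs1 : b / 2 ≤ s := by linarith
    have hs0 : 0 < s := by linarith
    rw [hpt s u hu, norm_mul, norm_mul, norm_mul, Real.norm_of_nonneg (Real.sqrt_nonneg _),
      Real.norm_of_nonneg (subord_nonneg (by positivity) hu0),
      Real.norm_of_nonneg (Real.exp_pos _).le]
    -- Here `b/2 < s < 3b/2`: the upper bound controls the linear prefactor, the lower bound the
    -- exponential.
    have h1 : subord (2 * s) u ≤ 3 * subord b u := by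
      unfold subord
      calc _ ≤ 3 * b / (2 * Real.sqrt Real.pi) * u ^ (-3 / 2 : ℝ) *
            Real.exp (-b ^ 2 / (4 * u)) := by
            gcongr ?_ / _ * _ * Real.exp (-?_ ^ 2 / _) <;> linarith
        _ = _ := by ring
    have h2 : Real.exp (-u) ≤ 1 := Real.exp_le_one_iff.2 (by linarith)
    have h3 : ‖(-2 : ℝ)‖ = 2 := by norm_num
    rw [h3]
    calc _ ≤ 2 * (Real.sqrt Real.pi * (3 * subord b u * 1)) := by
          have := subord_nonneg hb.le hu0
          gcongr
      _ = _ := by ring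
  · exact (integrableOn_subord hb).const_mul _
  · refine (ae_restrict_mem measurableSet_Ioi).mono fun u hu s hs => ?_
    refine HasDerivAt.const_mul _ (HasDerivAt.exp (HasDerivAt.div_const ?_ _))
    simpa using (hasDerivAt_pow 2 s).fun_neg

/-- The function `e^{2b} subordLaplace b` has zero derivative for `b > 0` and is continuous at `0`,
where its value is `Γ(1/2) = √π`. Continuity at the endpoint suffices for the mean value theorem. -/
lemma subordLaplace_eq {b : ℝ} (hb : 0 ≤ b) :
    subordLaplace b = Real.sqrt Real.pi * Real.exp (-(2 * b)) := by
  rcases hb.eq_or_lt with rfl | hb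
  · simp [subordLaplace_zero]
  have hd : ∀ s ∈ Set.Ioo 0 b, HasDerivAt (fun s => subordLaplace s * Real.exp (2 * s)) 0 s := by
    intro s hs
    have h1 : HasDerivAt (fun s : ℝ => Real.exp (2 * s)) (Real.exp (2 * s) * (2 * 1)) s :=
      ((hasDerivAt_id s).const_mul 2).exp
    refine ((hasDerivAt_subordLaplace hs.1).mul h1).congr_deriv ?_
    ring
  obtain ⟨c, -, hc⟩ := exists_hasDerivAt_eq_slope (fun s => subordLaplace s * Real.exp (2 * s))
    (fun _ => 0) hb (continuous_subordLaplace.mul (by fun_prop)).continuousOn hd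
  have h2 := hc.symm
  rw [div_eq_zero_iff] at h2
  have h3 : subordLaplace b * Real.exp (2 * b) = Real.sqrt Real.pi := by
    rcases h2 with h2 | h2
    · rw [mul_zero, Real.exp_zero, mul_one, subordLaplace_zero] at h2
      linarith
    · linarith
  rw [← h3, mul_assoc, ← Real.exp_add]
  simp

/-- The subordination formula `∫ subord t r e^{-λr} dr = e^{-t√λ}`. -/
lemma integral_subord_mul_exp {t : ℝ} (ht : 0 < t) {l : ℝ} (hl : 0 ≤ l) :
    ∫ r in Set.Ioi (0 : ℝ), subord t r * Real.exp (-(r * l)) =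
      Real.exp (-Real.sqrt l * t) := by
  rw [← integral_subord_mul ht fun r => Real.exp (-(r * l))]
  have h1 : ∫ u in Set.Ioi (0 : ℝ), Real.exp (-u) / Real.sqrt u *
      Real.exp (-(t ^ 2 / (4 * u) * l)) = subordLaplace (t * Real.sqrt l / 2) := by
    refine setIntegral_congr_fun measurableSet_Ioi fun u hu => ?_
    have hu0 : 0 < u := hu
    have e : -(t ^ 2 / (4 * u) * l) = -(t * Real.sqrt l / 2) ^ 2 / u := by
      rw [div_pow, mul_pow, Real.sq_sqrt hl]; field_simp; ring
    simp only [e]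
  rw [h1, subordLaplace_eq (by positivity), ← mul_assoc, one_div,
    inv_mul_cancel₀ (by positivity), one_mul]
  congr 1
  ring

lemma subordGrowth_exp {l : ℝ} (hl : 0 ≤ l) : SubordGrowth fun r => Real.exp (-(r * l)) where
  aestronglyMeasurable := Measurable.aestronglyMeasurable (by fun_prop)
  bound := fun a ha => ⟨1, zero_le_one, fun r hr => by
    rw [abs_of_pos (Real.exp_pos _), one_mul]
    refine Real.exp_le_exp.2 ?_
    have h1 : 0 ≤ r * l := by positivity
    have h2 : 0 ≤ a / r := by positivity
    linarith⟩

/-- Both sides of the subordination formula are differentiated `k` times in `t`. -/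
lemma integral_subordDeriv_mul_exp (k : ℕ) {t : ℝ} (ht : 0 < t) {l : ℝ} (hl : 0 ≤ l) :
    ∫ r in Set.Ioi (0 : ℝ), subordDeriv k t r * Real.exp (-(r * l)) =
      (-Real.sqrt l) ^ k * Real.exp (-Real.sqrt l * t) := by
  rw [← (subordGrowth_exp hl).iteratedDeriv_eq (Φ := fun t => Real.exp (-Real.sqrt l * t))
    (fun s hs => (integral_subord_mul_exp hs hl).symm) k ht, iteratedDeriv_exp_const_mul]

/-! ### Growth of Hermite polynomials and the spectral action of the semigroup -/

lemma exists_exp_norm_le (a : ℝ) :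
    ∃ C : ℝ, 0 ≤ C ∧ ∀ x : Euc d, Real.exp (a * ‖x‖) ≤ C * Real.exp (‖x‖ ^ 2 / 2) := by
  refine ⟨Real.exp (a ^ 2 / 2), by positivity, fun x => ?_⟩
  rw [← Real.exp_add]
  refine Real.exp_le_exp.2 ?_
  nlinarith [sq_nonneg (a - ‖x‖)]

lemma integrable_exp_norm (a : ℝ) :
    Integrable (fun x : Euc d => Real.exp (a * ‖x‖)) (gaussianMeasure d) := by
  obtain ⟨C, hC, h⟩ := exists_exp_norm_le (d := d) a
  have h1 : Integrable (fun x : Euc d => Real.exp (‖x‖ ^ 2 / 2)) (gaussianMeasure d) := by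
    refine ⟨Measurable.aestronglyMeasurable (by fun_prop), ?_⟩
    rw [hasFiniteIntegral_iff_ofReal (Eventually.of_forall fun _ => (Real.exp_pos _).le)]
    exact lintegral_exp_half_sq_norm_lt_top
  refine Integrable.mono' (h1.const_mul C) (Measurable.aestronglyMeasurable (by fun_prop))
    (Eventually.of_forall fun x => ?_)
  rw [Real.norm_of_nonneg (Real.exp_pos _).le]
  exact h x

lemma memLp_two_of_abs_le {f : Euc d → ℝ} (hf : Measurable f) {C a : ℝ}
    (h : ∀ x, |f x| ≤ C * Real.exp (a * ‖x‖)) : MemLp f 2 (gaussianMeasure d) := by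
  rw [memLp_two_iff_integrable_sq hf.aestronglyMeasurable]
  refine Integrable.mono' ((integrable_exp_norm (2 * a)).const_mul (C ^ 2))
    (hf.pow_const 2).aestronglyMeasurable (Eventually.of_forall fun x => ?_)
  rw [Real.norm_of_nonneg (sq_nonneg _), ← sq_abs]
  refine (pow_le_pow_left₀ (abs_nonneg _) (h x) 2).trans_eq ?_
  rw [mul_pow, ← Real.exp_nat_mul]
  congr 2
  push_cast; ring

lemma measurable_hermite (ν : Fin d → ℕ) : Measurable (hermite ν) := by
  have : hermite ν = fun x : Euc d => (∏ i, (hermitePoly (ν i)).eval (x i)) /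
    Real.sqrt ((2 : ℝ) ^ multiLength ν * ∏ i, ((ν i).factorial : ℝ)) := by
    funext x; simp only [hermite, hermiteOne_eq]
  rw [this]
  refine Continuous.measurable ?_
  fun_prop

lemma exists_abs_hermite_le (ν : Fin d → ℕ) :
    ∃ C, ∀ x : Euc d, |hermite ν x| ≤ C * Real.exp (d * ‖x‖) := by
  choose C hC h using fun i => exists_abs_eval_le (hermitePoly (ν i)) one_pos
  refine ⟨(∏ i, C i) / Real.sqrt ((2 : ℝ) ^ multiLength ν * ∏ i, ((ν i).factorial : ℝ)),
    fun x => ?_⟩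
  rw [hermite, abs_div, abs_of_nonneg (Real.sqrt_nonneg _), div_mul_eq_mul_div]
  refine div_le_div_of_nonneg_right ?_ (Real.sqrt_nonneg _)
  rw [Finset.abs_prod]
  calc ∏ i, |hermiteOne (ν i) (x i)| ≤ ∏ i, (C i * Real.exp ‖x‖) := by
        refine Finset.prod_le_prod (fun i _ => abs_nonneg _) fun i _ => ?_
        rw [hermiteOne_eq]
        refine (h i (x i)).trans ?_
        have h1 := hC i
        have h2 : |x i| ≤ ‖x‖ := PiLp.norm_apply_le x i
        rw [one_mul]
        gcongr
    _ = _ := by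
        rw [Finset.prod_mul_distrib, Finset.prod_const, Finset.card_univ, Fintype.card_fin,
          ← Real.exp_nat_mul]

lemma memLp_two_hermite (ν : Fin d → ℕ) : MemLp (hermite ν) 2 (gaussianMeasure d) := by
  obtain ⟨C, hC⟩ := exists_abs_hermite_le ν
  exact memLp_two_of_abs_le (measurable_hermite ν) hC

lemma memLp_two_hermite_sum (s : Finset (Fin d → ℕ)) (a : (Fin d → ℕ) → ℝ) :
    MemLp (fun x => ∑ ν ∈ s, a ν * hermite ν x) 2 (gaussianMeasure d) :=
  memLp_finsetSum s fun ν _ => (memLp_two_hermite ν).const_mul (a ν)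

lemma integrable_hermite_sum (s : Finset (Fin d → ℕ)) (a : (Fin d → ℕ) → ℝ) :
    Integrable (fun x => ∑ ν ∈ s, a ν * hermite ν x) (gaussianMeasure d) :=
  (memLp_two_hermite_sum s a).integrable one_le_two

lemma mehlerInt_hermite_sum {r : ℝ} (hr : 0 < r) (s : Finset (Fin d → ℕ))
    (a : (Fin d → ℕ) → ℝ) (x : Euc d) :
    mehlerInt r (fun x => ∑ ν ∈ s, a ν * hermite ν x) x =
      ∑ ν ∈ s, a ν * (Real.exp (-(r * multiLength ν)) * hermite ν x) := by
  simp only [mehlerInt, Finset.mul_sum]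
  rw [integral_finsetSum]
  · refine Finset.sum_congr rfl fun ν _ => ?_
    rw [← mehlerInt_hermite hr, mehlerInt, ← integral_const_mul]
    congr 1
    funext y
    ring
  · exact fun ν _ => integrable_mehler_mul hr
      (((memLp_two_hermite ν).integrable one_le_two).const_mul (a ν)) x

lemma poissonOp_hermite_sum (k : ℕ) {t : ℝ} (ht : 0 < t) (s : Finset (Fin d → ℕ))
    (a : (Fin d → ℕ) → ℝ) (x : Euc d) :
    poissonOp k t (fun x => ∑ ν ∈ s, a ν * hermite ν x) x =
      ∑ ν ∈ s, a ν * ((-Real.sqrt (multiLength ν)) ^ k *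
        Real.exp (-Real.sqrt (multiLength ν) * t)) * hermite ν x := by
  have h1 : poissonOp k t (fun x => ∑ ν ∈ s, a ν * hermite ν x) x =
      ∫ r in Set.Ioi (0 : ℝ), ∑ ν ∈ s, a ν * hermite ν x *
        (subordDeriv k t r * Real.exp (-(r * multiLength ν))) := by
    refine setIntegral_congr_fun measurableSet_Ioi fun r hr => ?_
    rw [mehlerInt_hermite_sum hr, Finset.mul_sum]
    exact Finset.sum_congr rfl fun ν _ => by ring
  rw [h1, integral_finsetSum]
  · refine Finset.sum_congr rfl fun ν _ => ?_
    rw [integral_const_mul, integral_subordDeriv_mul_exp k ht (Nat.cast_nonneg _)]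
    ring
  · exact fun ν _ => ((subordGrowth_exp (Nat.cast_nonneg _)).integrable k ht).const_mul _

/-! ### Density of polynomials -/

/-- The linear span of the Hermite polynomials. -/
def hermiteSpan (d : ℕ) : Submodule ℝ (Euc d → ℝ) :=
  Submodule.span ℝ (Set.range (hermite (d := d)))

lemma exists_eq_hermiteSum {F : Euc d → ℝ} (hF : F ∈ hermiteSpan d) :
    ∃ c, F = hermiteSum c := by
  obtain ⟨c, hc⟩ := Finsupp.mem_span_range_iff_exists_finsupp.1 hF
  refine ⟨c, ?_⟩
  rw [← hc]
  funext x
  simp [hermiteSum, Finsupp.sum, Finset.sum_apply]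

lemma prod_hermiteOne_mem (ν : Fin d → ℕ) :
    (fun x : Euc d => ∏ i, hermiteOne (ν i) (x i)) ∈ hermiteSpan d := by
  set N := Real.sqrt ((2 : ℝ) ^ multiLength ν * ∏ i, ((ν i).factorial : ℝ)) with hN
  have hN0 : N ≠ 0 := by
    rw [hN]
    have : 0 < ∏ i, ((ν i).factorial : ℝ) :=
      Finset.prod_pos fun i _ => by exact_mod_cast Nat.factorial_pos _
    positivity
  have : (fun x : Euc d => ∏ i, hermiteOne (ν i) (x i)) = N • hermite ν := by
    funext x
    simp only [Pi.smul_apply, smul_eq_mul, hermite, ← hN]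
    field_simp
  rw [this]
  exact Submodule.smul_mem _ _ (Submodule.subset_span ⟨ν, rfl⟩)

/-- The three-term recurrence; at `n = 0` the factor `n` removes the truncated index. -/
lemma mul_hermiteOne (n : ℕ) (y : ℝ) :
    y * hermiteOne n y = 1 / 2 * hermiteOne (n + 1) y + n * hermiteOne (n - 1) y := by
  simp only [hermiteOne_eq]
  rcases n with _ | n
  · simp [hermitePoly]
  · rw [show hermitePoly (n + 1 + 1) = Polynomial.C 2 * Polynomial.X * hermitePoly (n + 1) -
      (hermitePoly (n + 1)).derivative from rfl, derivative_hermitePoly_succ]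
    simp only [Polynomial.eval_sub, Polynomial.eval_mul, Polynomial.eval_C, Polynomial.eval_X,
      Nat.add_sub_cancel]
    push_cast
    ring

lemma coord_mul_mem_hermiteSpan (i : Fin d) {F : Euc d → ℝ} (hF : F ∈ hermiteSpan d) :
    (fun x : Euc d => x i * F x) ∈ hermiteSpan d := by
  have hp : ∀ (ν : Fin d → ℕ) (m : ℕ) (x : Euc d),
      ∏ j, hermiteOne (Function.update ν i m j) (x j) =
        hermiteOne m (x i) * ∏ j ∈ Finset.univ.erase i, hermiteOne (ν j) (x j) := by
    intro ν m x
    rw [← Finset.mul_prod_erase _ _ (Finset.mem_univ i), Function.update_self]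
    congr 1
    exact Finset.prod_congr rfl fun j hj => by
      rw [Function.update_of_ne (Finset.ne_of_mem_erase hj)]
  have hmem : ∀ ν : Fin d → ℕ, (fun x : Euc d => x i * hermite ν x) ∈ hermiteSpan d := by
    intro ν
    set N := Real.sqrt ((2 : ℝ) ^ multiLength ν * ∏ i, ((ν i).factorial : ℝ)) with hN
    have : (fun x : Euc d => x i * hermite ν x) =
        (1 / 2 / N) • (fun x : Euc d =>
          ∏ j, hermiteOne (Function.update ν i (ν i + 1) j) (x j)) +
        (ν i / N) • (fun x : Euc d =>
          ∏ j, hermiteOne (Function.update ν i (ν i - 1) j) (x j)) := by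
      funext x
      simp only [Pi.add_apply, Pi.smul_apply, smul_eq_mul, hp]
      rw [hermite, ← hN, ← Finset.mul_prod_erase _ _ (Finset.mem_univ i), mul_div_assoc',
        ← mul_assoc, mul_hermiteOne]
      ring
    rw [this]
    exact Submodule.add_mem _ (Submodule.smul_mem _ _ (prod_hermiteOne_mem _))
      (Submodule.smul_mem _ _ (prod_hermiteOne_mem _))
  induction hF using Submodule.span_induction with
  | mem F hF => obtain ⟨ν, rfl⟩ := hF; exact hmem ν
  | zero =>
    simp only [Pi.zero_apply, mul_zero]
    exact (hermiteSpan d).zero_mem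
  | add F G _ _ hF hG =>
    have := Submodule.add_mem _ hF hG
    convert this using 1
    funext x
    simp [mul_add]
  | smul a F _ hF =>
    have := Submodule.smul_mem _ a hF
    convert this using 1
    funext x
    simp only [Pi.smul_apply, smul_eq_mul]
    ring

/-- Powers of linear forms are the only polynomials needed for density: they are the Taylor terms of
the characters `e^{i⟨x,a⟩}`. -/
lemma inner_pow_mem_hermiteSpan (a : Euc d) (n : ℕ) :
    (fun x : Euc d => (inner ℝ x a) ^ n) ∈ hermiteSpan d := by
  induction n with
  | zero =>
    have := prod_hermiteOne_mem (d := d) fun _ => 0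
    simpa [hermiteOne_eq, hermitePoly] using this
  | succ n ih =>
    have : (fun x : Euc d => (inner ℝ x a) ^ (n + 1)) =
        ∑ i, a i • fun x : Euc d => x i * (inner ℝ x a) ^ n := by
      funext x
      simp only [Finset.sum_apply, Pi.smul_apply, smul_eq_mul]
      rw [pow_succ']
      nth_rewrite 1 [PiLp.inner_apply]
      rw [Finset.sum_mul]
      refine Finset.sum_congr rfl fun i _ => ?_
      simp
      ring
    rw [this]
    exact Submodule.sum_mem _ fun i _ => Submodule.smul_mem _ _ (coord_mul_mem_hermiteSpan i ih)

lemma memLp_two_of_mem_hermiteSpan {F : Euc d → ℝ} (hF : F ∈ hermiteSpan d) :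
    MemLp F 2 (gaussianMeasure d) := by
  obtain ⟨c, rfl⟩ := exists_eq_hermiteSum hF
  exact memLp_two_hermite_sum c.support c

/-- Expand the exponential and integrate term by term. The series is dominated by `|g| e^{|⟨x,a⟩|}`,
integrable as a product of two functions in `L²(γ_d)`. -/
lemma integral_mul_cexp_eq_zero {g : Euc d → ℝ} (hg : MemLp g 2 (gaussianMeasure d))
    (h : ∀ F ∈ hermiteSpan d, ∫ x, g x * F x ∂gaussianMeasure d = 0) (a : Euc d) :
    ∫ x, (g x : ℂ) * Complex.exp ((inner ℝ x a : ℝ) * Complex.I) ∂gaussianMeasure d = 0 := by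
  have hgm := hg.1
  have hS := hasSum_integral_of_dominated_convergence (μ := gaussianMeasure d)
    (F := fun n x => (g x : ℂ) * (((inner ℝ x a : ℝ) * Complex.I) ^ n / (n.factorial : ℂ)))
    (f := fun x => (g x : ℂ) * Complex.exp ((inner ℝ x a : ℝ) * Complex.I))
    (fun n x => |g x| * (|inner ℝ x a| ^ n / n.factorial)) ?_ ?_ ?_ ?_ ?_
  · have h0 : ∀ n : ℕ, ∫ x, (g x : ℂ) * (((inner ℝ x a : ℝ) * Complex.I) ^ n /
        (n.factorial : ℂ)) ∂gaussianMeasure d = 0 := by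
      intro n
      have h1 := h _ (inner_pow_mem_hermiteSpan a n)
      have h2 : ∀ x : Euc d, (g x : ℂ) * (((inner ℝ x a : ℝ) * Complex.I) ^ n /
          (n.factorial : ℂ)) = ((g x * (inner ℝ x a) ^ n : ℝ) : ℂ) *
          (Complex.I ^ n / (n.factorial : ℂ)) := by
        intro x
        push_cast
        ring
      simp_rw [h2]
      rw [integral_mul_const, integral_complex_ofReal, h1]
      simp
    simp_rw [h0] at hS
    exact hS.unique hasSum_zero
  · intro n
    exact (Complex.measurable_ofReal.comp_aemeasurable hgm.aemeasurable).aestronglyMeasurable.mul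
      (Measurable.aestronglyMeasurable (by fun_prop))
  · intro n
    refine Eventually.of_forall fun x => le_of_eq ?_
    rw [norm_mul, norm_div, norm_pow, norm_mul, Complex.norm_I, mul_one, Complex.norm_real,
      Complex.norm_real, Complex.norm_natCast, Real.norm_eq_abs, Real.norm_eq_abs]
  · exact Eventually.of_forall fun x =>
      (Real.summable_pow_div_factorial _).mul_left _
  · have h1 : ∀ x : Euc d, ∑' n : ℕ, |g x| * (|inner ℝ x a| ^ n / n.factorial) =
        |g x| * Real.exp |inner ℝ x a| := by
      intro x
      rw [tsum_mul_left, Real.exp_eq_exp_ℝ, NormedSpace.exp_eq_tsum_div]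
    simp_rw [h1]
    have h2 : MemLp (fun x : Euc d => Real.exp |inner ℝ x a|) 2 (gaussianMeasure d) := by
      refine memLp_two_of_abs_le (C := 1) (a := ‖a‖) (by fun_prop) fun x => ?_
      rw [abs_of_pos (Real.exp_pos _), one_mul, mul_comm]
      exact Real.exp_le_exp.2 (abs_real_inner_le_norm x a)
    exact hg.abs.integrable_mul h2
  · refine Eventually.of_forall fun x => HasSum.mul_left _ ?_
    rw [Complex.exp_eq_exp_ℂ]
    exact NormedSpace.expSeries_div_hasSum_exp _

/-- A function in `L²` orthogonal to all polynomials vanishes. -/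
lemma ae_eq_zero_of_orthogonal {g : Euc d → ℝ} (hg : MemLp g 2 (gaussianMeasure d))
    (h : ∀ F ∈ hermiteSpan d, ∫ x, g x * F x ∂gaussianMeasure d = 0) :
    g =ᵐ[gaussianMeasure d] 0 := by
  have hgi : Integrable g (gaussianMeasure d) := hg.integrable one_le_two
  have hm1 : AEMeasurable (fun x => ENNReal.ofReal (g x)) (gaussianMeasure d) :=
    hgi.1.aemeasurable.ennreal_ofReal
  have hm2 : AEMeasurable (fun x => ENNReal.ofReal (-g x)) (gaussianMeasure d) :=
    hgi.1.aemeasurable.neg.ennreal_ofReal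
  have hf1 : ∫⁻ x, ENNReal.ofReal (g x) ∂gaussianMeasure d ≠ ∞ := hgi.lintegral_lt_top.ne
  have hf2 : ∫⁻ x, ENNReal.ofReal (-g x) ∂gaussianMeasure d ≠ ∞ := hgi.neg.lintegral_lt_top.ne
  have : IsFiniteMeasure ((gaussianMeasure d).withDensity fun x => ENNReal.ofReal (g x)) :=
    isFiniteMeasure_withDensity hf1
  have : IsFiniteMeasure ((gaussianMeasure d).withDensity fun x => ENNReal.ofReal (-g x)) :=
    isFiniteMeasure_withDensity hf2
  -- The positive and negative parts of `g` are densities of finite measures with equal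
  -- characteristic functions.
  have heq : (gaussianMeasure d).withDensity (fun x => ENNReal.ofReal (g x)) =
      (gaussianMeasure d).withDensity fun x => ENNReal.ofReal (-g x) := by
    refine Measure.ext_of_charFun (funext fun a => ?_)
    rw [charFun_apply, charFun_apply, integral_withDensity_eq_integral_toReal_smul₀ hm1 (by simp),
      integral_withDensity_eq_integral_toReal_smul₀ hm2 (by simp), ← sub_eq_zero]
    have hb : ∀ φ : Euc d → ℝ, Integrable φ (gaussianMeasure d) →
        Integrable (fun x => φ x • Complex.exp ((inner ℝ x a : ℝ) * Complex.I))
          (gaussianMeasure d) := by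
      intro φ hφ
      refine hφ.smul_bdd 1 (Measurable.aestronglyMeasurable (by fun_prop))
        (Eventually.of_forall fun x => ?_)
      rw [Complex.norm_exp_ofReal_mul_I]
    rw [← integral_sub (hb _ (integrable_toReal_of_lintegral_ne_top hm1 hf1))
      (hb _ (integrable_toReal_of_lintegral_ne_top hm2 hf2)), ← integral_mul_cexp_eq_zero hg h a]
    refine integral_congr_ae (Eventually.of_forall fun x => ?_)
    simp only [Complex.real_smul]
    rw [← sub_mul]
    congr 1
    rw [← Complex.ofReal_sub]
    congr 1
    rcases le_total 0 (g x) with h0 | h0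
    · rw [ENNReal.toReal_ofReal h0, ENNReal.ofReal_of_nonpos (by linarith)]; simp
    · rw [ENNReal.ofReal_of_nonpos h0, ENNReal.toReal_ofReal (by linarith)]; simp
  have h1 := (withDensity_eq_iff hm1 hm2 hf1).1 heq
  filter_upwards [h1] with x hx
  rcases le_total 0 (g x) with h0 | h0
  · rw [ENNReal.ofReal_of_nonpos (show -g x ≤ 0 by linarith), ENNReal.ofReal_eq_zero] at hx
    exact le_antisymm hx h0
  · rw [ENNReal.ofReal_of_nonpos h0, eq_comm, ENNReal.ofReal_eq_zero] at hx
    simp only [Pi.zero_apply]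
    linarith

/-- The classes of polynomials in `L²`. -/
def hermiteSpanL2 (d : ℕ) : Submodule ℝ (Lp ℝ 2 (gaussianMeasure d)) where
  carrier := {u | ∃ F ∈ hermiteSpan d, u =ᵐ[gaussianMeasure d] F}
  add_mem' := by
    rintro u v ⟨F, hF, hu⟩ ⟨G, hG, hv⟩
    exact ⟨F + G, Submodule.add_mem _ hF hG, (Lp.coeFn_add u v).trans (hu.add hv)⟩
  zero_mem' := ⟨0, Submodule.zero_mem _, Lp.coeFn_zero _ _ _⟩
  smul_mem' := by
    rintro a u ⟨F, hF, hu⟩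
    exact ⟨a • F, Submodule.smul_mem _ _ hF, (Lp.coeFn_smul a u).trans (hu.const_smul a)⟩

lemma topologicalClosure_hermiteSpanL2 : (hermiteSpanL2 d).topologicalClosure = ⊤ := by
  rw [Submodule.topologicalClosure_eq_top_iff, Submodule.eq_bot_iff]
  intro g hg
  rw [Submodule.mem_orthogonal] at hg
  rw [Lp.eq_zero_iff_ae_eq_zero]
  refine ae_eq_zero_of_orthogonal (Lp.memLp g) fun F hF => ?_
  have hFm := memLp_two_of_mem_hermiteSpan hF
  have h1 := hg (hFm.toLp F) ⟨F, hF, hFm.coeFn_toLp⟩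
  rw [L2.inner_def] at h1
  rw [← h1]
  refine integral_congr_ae ?_
  filter_upwards [hFm.coeFn_toLp] with x hx
  rw [hx]
  simp

lemma exists_hermiteSum_eLpNorm_two_le {f : Euc d → ℝ} (hf : MemLp f 2 (gaussianMeasure d))
    {ε : ℝ≥0∞} (hε : ε ≠ 0) :
    ∃ c, eLpNorm (fun x => hermiteSum c x - f x) 2 (gaussianMeasure d) ≤ ε := by
  have hmem : hf.toLp f ∈ closure (hermiteSpanL2 d : Set (Lp ℝ 2 (gaussianMeasure d))) := by
    rw [← Submodule.topologicalClosure_coe, topologicalClosure_hermiteSpanL2]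
    trivial
  obtain ⟨u, ⟨F, hF, hu⟩, hdist⟩ := EMetric.mem_closure_iff.1 hmem ε (pos_iff_ne_zero.2 hε)
  obtain ⟨c, rfl⟩ := exists_eq_hermiteSum hF
  refine ⟨c, ?_⟩
  rw [edist_comm, Lp.edist_def] at hdist
  refine le_of_eq_of_le (eLpNorm_congr_ae ?_) hdist.le
  filter_upwards [hu, hf.coeFn_toLp] with x h1 h2
  rw [Pi.sub_apply, h1, h2]

/-- Polynomials are dense in `L^q` for `1 ≤ q ≤ 2`. -/
lemma exists_hermiteSum_eLpNorm_le {q : ℝ≥0∞} (hq1 : 1 ≤ q) (hq2 : q ≤ 2) {f : Euc d → ℝ}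
    (hf : MemLp f q (gaussianMeasure d)) {ε : ℝ≥0∞} (hε : ε ≠ 0) :
    ∃ c, eLpNorm (fun x => hermiteSum c x - f x) q (gaussianMeasure d) ≤ ε := by
  have hqtop : q ≠ ∞ := ne_top_of_le_ne_top ENNReal.ofNat_ne_top hq2
  have hε2 : ε / 2 ≠ 0 := by simpa using hε
  -- Simple functions link `L^q` with `L²`: they are dense in `L^q`, lie in `L²`, and the `L²` norm
  -- dominates the `L^q` norm of a probability measure.
  obtain ⟨g, hg, hgm⟩ := hf.exists_simpleFunc_eLpNorm_sub_lt hqtop hε2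
  have hg2 : MemLp g 2 (gaussianMeasure d) := g.memLp_of_isFiniteMeasure _ _
  obtain ⟨c, hc⟩ := exists_hermiteSum_eLpNorm_two_le hg2 hε2
  have hcm : MemLp (hermiteSum c) 2 (gaussianMeasure d) := memLp_two_hermite_sum c.support c
  refine ⟨c, ?_⟩
  have hsplit : (fun x => hermiteSum c x - f x) =
      (fun x => hermiteSum c x - g x) - (f - ⇑g) := by
    funext x; simp
  rw [hsplit]
  calc _ ≤ eLpNorm (fun x => hermiteSum c x - g x) q (gaussianMeasure d) +
        eLpNorm (f - ⇑g) q (gaussianMeasure d) :=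
        eLpNorm_sub_le (hcm.sub hg2).1 (hf.1.sub hgm.1) hq1
    _ ≤ ε / 2 + ε / 2 := by
        gcongr
        exact (eLpNorm_le_eLpNorm_of_exponent_le hq2 (hcm.sub hg2).1).trans hc
    _ = ε := ENNReal.add_halves ε

/-! ### Bessel potentials as averages of the Poisson-Hermite semigroup -/

/-- The density of the Gamma distribution with parameter `β`. -/
def besselWeight (β s : ℝ) : ℝ := s ^ (β - 1) * Real.exp (-s) / Real.Gamma β

/-- The average of `∂_t^k P_{t+s} f` in `s` against the Gamma distribution: this is
`∂_t^k P_t J_β f`. -/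
def besselOp (β : ℝ) (k : ℕ) (t : ℝ) (f : Euc d → ℝ) (x : Euc d) : ℝ :=
  ∫ s in Set.Ioi (0 : ℝ), besselWeight β s * poissonOp k (t + s) f x

@[fun_prop]
lemma measurable_besselWeight (β : ℝ) : Measurable (besselWeight β) := by
  unfold besselWeight; fun_prop

lemma besselWeight_nonneg {β s : ℝ} (hβ : 0 < β) (hs : 0 < s) : 0 ≤ besselWeight β s := by
  have := Real.Gamma_pos_of_pos hβ
  unfold besselWeight; positivity

/-- With `l = √|ν|` this expresses the Bessel multiplier as an average of the Poisson multipliers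
`e^{-s√|ν|}`. -/
lemma integral_besselWeight_mul_exp {β l : ℝ} (hβ : 0 < β) (hl : 0 ≤ l) :
    ∫ s in Set.Ioi (0 : ℝ), besselWeight β s * Real.exp (-(l * s)) = 1 / (1 + l) ^ β := by
  have hΓ := Real.Gamma_pos_of_pos hβ
  have h := Real.integral_rpow_mul_exp_neg_mul_Ioi hβ (show 0 < 1 + l by linarith)
  have h1 : ∀ s : ℝ, besselWeight β s * Real.exp (-(l * s)) =
      s ^ (β - 1) * Real.exp (-((1 + l) * s)) / Real.Gamma β := by
    intro s
    rw [besselWeight, show -((1 + l) * s) = -s + -(l * s) by ring, Real.exp_add]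
    ring
  simp_rw [h1]
  rw [integral_div, h, Real.div_rpow zero_le_one (by positivity), Real.one_rpow]
  field_simp

lemma integrableOn_besselWeight_mul_exp {β l : ℝ} (hβ : 0 < β) (hl : 0 ≤ l) :
    IntegrableOn (fun s => besselWeight β s * Real.exp (-(l * s))) (Set.Ioi 0) := by
  by_contra h
  have h1 := integral_besselWeight_mul_exp hβ hl
  rw [integral_undef h] at h1
  have : 0 < 1 / (1 + l) ^ β := by positivity
  linarith

lemma lintegral_besselWeight {β : ℝ} (hβ : 0 < β) :
    ∫⁻ s in Set.Ioi (0 : ℝ), ENNReal.ofReal (besselWeight β s) = 1 := by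
  have h1 := integral_besselWeight_mul_exp hβ le_rfl
  have h2 := integrableOn_besselWeight_mul_exp hβ le_rfl
  simp only [zero_mul, neg_zero, Real.exp_zero, mul_one, add_zero, Real.one_rpow, div_one]
    at h1 h2
  rw [← ofReal_integral_eq_lintegral_ofReal h2, h1, ENNReal.ofReal_one]
  exact (ae_restrict_mem measurableSet_Ioi).mono fun s hs => besselWeight_nonneg hβ hs

lemma besselOp_congr {f g : Euc d → ℝ} (h : f =ᵐ[gaussianMeasure d] g) (β : ℝ) (k : ℕ) (t : ℝ) :
    besselOp β k t f = besselOp β k t g := by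
  funext x
  simp only [besselOp, poissonOp_congr h]

lemma measurable_besselOp (β : ℝ) (k : ℕ) (t : ℝ) {f : Euc d → ℝ}
    (hf : AEMeasurable f (gaussianMeasure d)) : Measurable (besselOp β k t f) := by
  rw [besselOp_congr hf.ae_eq_mk]
  refine (StronglyMeasurable.integral_prod_right' (f := fun z : Euc d × ℝ =>
    besselWeight β z.2 * poissonOp k (t + z.2) (hf.mk f) z.1)
    (Measurable.stronglyMeasurable ?_)).measurable
  have := measurable_poissonOp_comp k (Ω := Euc d × ℝ) hf.measurable_mk (t := fun z => t + z.2)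
    (x := fun z => z.1) (by fun_prop) (by fun_prop)
  fun_prop

lemma enorm_besselOp_le {β : ℝ} (hβ : 0 < β) (k : ℕ) (t : ℝ) (f : Euc d → ℝ) (x : Euc d) :
    ‖besselOp β k t f x‖ₑ ≤ ∫⁻ s in Set.Ioi (0 : ℝ),
      ENNReal.ofReal (besselWeight β s) * ‖poissonOp k (t + s) f x‖ₑ := by
  refine (enorm_integral_le_lintegral_enorm _).trans_eq ?_
  refine setLIntegral_congr_fun measurableSet_Ioi fun s hs => ?_
  rw [enorm_mul, Real.enorm_of_nonneg (besselWeight_nonneg hβ hs)]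

/-- The conditions `0 ≤ t` and `0 < t ^ k` cover at once all `t > 0` and the case `t = 0`, `k = 0`,
which is `J_β` itself. -/
lemma exists_lintegral_besselWeight_poissonOp_le {β : ℝ} (hβ : 0 < β) (k : ℕ) :
    ∃ C : ℝ, ∀ t, 0 ≤ t → 0 < t ^ k → ∀ f : Euc d → ℝ, AEMeasurable f (gaussianMeasure d) →
      ∫⁻ x, (∫⁻ s in Set.Ioi (0 : ℝ), ENNReal.ofReal (besselWeight β s) *
        ‖poissonOp k (t + s) f x‖ₑ) ∂gaussianMeasure d ≤
        ENNReal.ofReal (C * (t ^ k)⁻¹) * ∫⁻ x, ‖f x‖ₑ ∂gaussianMeasure d := by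
  obtain ⟨C, hC, h⟩ := exists_lintegral_poissonOp_le (d := d) k
  refine ⟨C, fun t ht htk f hf => ?_⟩
  have hm := measurable_poissonOp_comp k (Ω := Euc d × ℝ) hf.measurable_mk (t := fun z => t + z.2)
    (x := fun z => z.1) (by fun_prop) (by fun_prop)
  have he := fun s => poissonOp_congr hf.ae_eq_mk k s
  rw [lintegral_lintegral_swap (by simp_rw [he]; exact Measurable.aemeasurable (by fun_prop))]
  calc _ ≤ ∫⁻ s in Set.Ioi (0 : ℝ), ENNReal.ofReal (besselWeight β s) *
        (ENNReal.ofReal (C * (t ^ k)⁻¹) * ∫⁻ x, ‖f x‖ₑ ∂gaussianMeasure d) := by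
        refine setLIntegral_mono' measurableSet_Ioi fun s hs => ?_
        have hs0 : 0 < s := hs
        rw [lintegral_const_mul' _ _ ENNReal.ofReal_ne_top]
        gcongr
        refine (h (t + s) (by linarith) f hf).trans ?_
        gcongr
        linarith
    _ = _ := by
        rw [lintegral_mul_const _ (by fun_prop), lintegral_besselWeight hβ, one_mul]

lemma ae_integrable_besselWeight_mul_poissonOp {β : ℝ} (hβ : 0 < β) {k : ℕ} {t : ℝ} (ht : 0 ≤ t)
    (htk : 0 < t ^ k) {f : Euc d → ℝ} (hf : Integrable f (gaussianMeasure d)) :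
    ∀ᵐ x ∂gaussianMeasure d,
      IntegrableOn (fun s => besselWeight β s * poissonOp k (t + s) f x) (Set.Ioi 0) := by
  obtain ⟨C, h⟩ := exists_lintegral_besselWeight_poissonOp_le (d := d) hβ k
  have hfm := hf.1.aemeasurable
  have he := fun s => poissonOp_congr hfm.ae_eq_mk k s
  have hm := measurable_poissonOp_comp k (Ω := Euc d × ℝ) hfm.measurable_mk
    (t := fun z => t + z.2) (x := fun z => z.1) (by fun_prop) (by fun_prop)
  have hfin := ae_lt_top' (μ := gaussianMeasure d) (f := fun x => ∫⁻ s in Set.Ioi (0 : ℝ),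
    ENNReal.ofReal (besselWeight β s) * ‖poissonOp k (t + s) f x‖ₑ) (by
      simp_rw [he]
      refine (Measurable.lintegral_prod_right' (f := fun z : Euc d × ℝ =>
        ENNReal.ofReal (besselWeight β z.2) *
          ‖poissonOp k (t + z.2) (hfm.mk f) z.1‖ₑ) ?_).aemeasurable
      fun_prop)
    ((h t ht htk f hfm).trans_lt (ENNReal.mul_lt_top ENNReal.ofReal_lt_top hf.2)).ne
  filter_upwards [hfin] with x hx
  refine ⟨?_, ?_⟩
  · simp_rw [he]
    have := hm.comp (measurable_prodMk_left (x := x))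
    exact ((measurable_besselWeight β).mul this).aestronglyMeasurable
  · refine lt_of_eq_of_lt ?_ hx
    refine setLIntegral_congr_fun measurableSet_Ioi fun s hs => ?_
    rw [enorm_mul, Real.enorm_of_nonneg (besselWeight_nonneg hβ hs)]

lemma besselOp_hermite_sum {β : ℝ} (hβ : 0 < β) (k : ℕ) {t : ℝ} (ht : 0 ≤ t)
    (S : Finset (Fin d → ℕ)) (a : (Fin d → ℕ) → ℝ) (x : Euc d) :
    besselOp β k t (fun x => ∑ ν ∈ S, a ν * hermite ν x) x =
      ∑ ν ∈ S, a ν * ((-Real.sqrt (multiLength ν)) ^ k *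
        Real.exp (-Real.sqrt (multiLength ν) * t)) *
          (1 / (1 + Real.sqrt (multiLength ν)) ^ β) * hermite ν x := by
  have h1 : besselOp β k t (fun x => ∑ ν ∈ S, a ν * hermite ν x) x =
      ∫ s in Set.Ioi (0 : ℝ), ∑ ν ∈ S, a ν * ((-Real.sqrt (multiLength ν)) ^ k *
        Real.exp (-Real.sqrt (multiLength ν) * t)) * hermite ν x *
        (besselWeight β s * Real.exp (-(Real.sqrt (multiLength ν) * s))) := by
    refine setIntegral_congr_fun measurableSet_Ioi fun s hs => ?_
    have hs0 : 0 < s := hs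
    rw [poissonOp_hermite_sum k (by linarith), Finset.mul_sum]
    refine Finset.sum_congr rfl fun ν _ => ?_
    rw [show -Real.sqrt (multiLength ν) * (t + s) =
      -Real.sqrt (multiLength ν) * t + -(Real.sqrt (multiLength ν) * s) by ring, Real.exp_add]
    ring
  rw [h1, integral_finsetSum]
  · refine Finset.sum_congr rfl fun ν _ => ?_
    rw [integral_const_mul, integral_besselWeight_mul_exp hβ (Real.sqrt_nonneg _)]
    ring
  · exact fun ν _ => (integrableOn_besselWeight_mul_exp hβ (Real.sqrt_nonneg _)).const_mul _

/-! ### Passage to the limit in `L¹` -/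

lemma ae_eq_of_tendsto_lintegral {u : ℕ → Euc d → ℝ} {v w : Euc d → ℝ}
    (hu : ∀ n, AEMeasurable (u n) (gaussianMeasure d)) (hv : AEMeasurable v (gaussianMeasure d))
    (hw : AEMeasurable w (gaussianMeasure d))
    (h1 : Tendsto (fun n => ∫⁻ x, ‖u n x - v x‖ₑ ∂gaussianMeasure d) atTop (𝓝 0))
    (h2 : Tendsto (fun n => ∫⁻ x, ‖u n x - w x‖ₑ ∂gaussianMeasure d) atTop (𝓝 0)) :
    v =ᵐ[gaussianMeasure d] w := by
  have h0 : ∫⁻ x, ‖v x - w x‖ₑ ∂gaussianMeasure d ≤ 0 := by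
    refine ge_of_tendsto (by simpa using h1.add h2) (Eventually.of_forall fun n => ?_)
    have hm : AEMeasurable (fun x => ‖u n x - v x‖ₑ) (gaussianMeasure d) := ((hu n).sub hv).enorm
    rw [← lintegral_add_left' hm]
    refine lintegral_mono fun x => ?_
    calc ‖v x - w x‖ₑ = ‖(u n x - w x) - (u n x - v x)‖ₑ := by congr 1; ring
      _ ≤ ‖u n x - w x‖ₑ + ‖u n x - v x‖ₑ := enorm_sub_le
      _ = _ := add_comm _ _
  have h3 := (lintegral_eq_zero_iff' (hv.sub hw).enorm).1 (le_zero_iff.1 h0)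
  filter_upwards [h3] with x hx
  have : ‖v x - w x‖ₑ = 0 := hx
  rw [enorm_eq_zero] at this
  linarith

lemma tendsto_poissonOp (k : ℕ) {t : ℝ} (ht : 0 < t) {u : ℕ → Euc d → ℝ} {f : Euc d → ℝ}
    (hu : ∀ n, Integrable (u n) (gaussianMeasure d)) (hf : Integrable f (gaussianMeasure d))
    (h : Tendsto (fun n => ∫⁻ x, ‖u n x - f x‖ₑ ∂gaussianMeasure d) atTop (𝓝 0)) :
    Tendsto (fun n => ∫⁻ x, ‖poissonOp k t (u n) x - poissonOp k t f x‖ₑ ∂gaussianMeasure d)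
      atTop (𝓝 0) := by
  obtain ⟨C, hC, hb⟩ := exists_lintegral_poissonOp_le (d := d) k
  have h1 := ENNReal.Tendsto.const_mul (a := ENNReal.ofReal (C * (t ^ k)⁻¹)) h
    (Or.inr ENNReal.ofReal_ne_top)
  rw [mul_zero] at h1
  refine tendsto_of_tendsto_of_tendsto_of_le_of_le tendsto_const_nhds h1 (fun _ => zero_le)
    fun n => ?_
  simp_rw [← poissonOp_sub k (hu n) hf ht]
  exact hb t ht _ ((hu n).sub hf).1.aemeasurable

lemma besselOp_sub {β : ℝ} (hβ : 0 < β) {k : ℕ} {t : ℝ} (ht : 0 ≤ t) (htk : 0 < t ^ k)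
    {f g : Euc d → ℝ} (hf : Integrable f (gaussianMeasure d))
    (hg : Integrable g (gaussianMeasure d)) :
    besselOp β k t (fun y => f y - g y) =ᵐ[gaussianMeasure d]
      fun x => besselOp β k t f x - besselOp β k t g x := by
  filter_upwards [ae_integrable_besselWeight_mul_poissonOp hβ ht htk hf,
    ae_integrable_besselWeight_mul_poissonOp hβ ht htk hg] with x h2 h3
  rw [besselOp, besselOp, besselOp, ← integral_sub h2 h3]
  refine setIntegral_congr_fun measurableSet_Ioi fun s hs => ?_
  have hs0 : 0 < s := hs
  rw [← mul_sub, ← poissonOp_sub k hf hg (by linarith)]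

lemma tendsto_besselOp {β : ℝ} (hβ : 0 < β) {k : ℕ} {t : ℝ} (ht : 0 ≤ t) (htk : 0 < t ^ k)
    {u : ℕ → Euc d → ℝ} {f : Euc d → ℝ} (hu : ∀ n, Integrable (u n) (gaussianMeasure d))
    (hf : Integrable f (gaussianMeasure d))
    (h : Tendsto (fun n => ∫⁻ x, ‖u n x - f x‖ₑ ∂gaussianMeasure d) atTop (𝓝 0)) :
    Tendsto (fun n => ∫⁻ x, ‖besselOp β k t (u n) x - besselOp β k t f x‖ₑ ∂gaussianMeasure d)
      atTop (𝓝 0) := by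
  obtain ⟨C, hb⟩ := exists_lintegral_besselWeight_poissonOp_le (d := d) hβ k
  have h1 := ENNReal.Tendsto.const_mul (a := ENNReal.ofReal (C * (t ^ k)⁻¹)) h
    (Or.inr ENNReal.ofReal_ne_top)
  rw [mul_zero] at h1
  refine tendsto_of_tendsto_of_tendsto_of_le_of_le tendsto_const_nhds h1 (fun _ => zero_le)
    fun n => le_trans ?_ (hb t ht htk _ ((hu n).sub hf).1.aemeasurable)
  refine lintegral_mono_ae ?_
  filter_upwards [besselOp_sub hβ ht htk (hu n) hf] with x hx
  rw [← hx]
  exact enorm_besselOp_le hβ k t (fun y => u n y - f y) x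

lemma exists_tendsto_hermiteSum {q : ℝ≥0∞} (hq1 : 1 ≤ q) (hq2 : q ≤ 2) {f : Euc d → ℝ}
    (hf : MemLp f q (gaussianMeasure d)) :
    ∃ c : ℕ → (Fin d → ℕ) →₀ ℝ, Tendsto (fun n => eLpNorm (fun x => hermiteSum (c n) x - f x) q
      (gaussianMeasure d)) atTop (𝓝 0) := by
  choose c hc using fun n : ℕ => exists_hermiteSum_eLpNorm_le hq1 hq2 hf
    (ε := (n + 1 : ℝ≥0∞)⁻¹) (by simp)
  refine ⟨c, tendsto_of_tendsto_of_tendsto_of_le_of_le tendsto_const_nhds ?_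
    (fun _ => zero_le) hc⟩
  have := ENNReal.tendsto_inv_nat_nhds_zero.comp (tendsto_add_atTop_nat 1)
  refine this.congr fun n => ?_
  simp

lemma integrable_hermiteSum (c : (Fin d → ℕ) →₀ ℝ) :
    Integrable (hermiteSum c) (gaussianMeasure d) :=
  integrable_hermite_sum c.support c

/-- The semigroup property, differentiated. -/
lemma poissonOp_poissonOp (m k : ℕ) {s t : ℝ} (hs : 0 < s) (ht : 0 < t) {f : Euc d → ℝ}
    (hf : Integrable f (gaussianMeasure d)) :
    poissonOp (k + m) (t + s) f =ᵐ[gaussianMeasure d] poissonOp m s (poissonOp k t f) := by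
  obtain ⟨c, hc⟩ := exists_tendsto_hermiteSum le_rfl one_le_two (memLp_one_iff_integrable.2 hf)
  simp_rw [eLpNorm_one_eq_lintegral_enorm] at hc
  have hI := fun n => integrable_hermiteSum (c n)
  -- On polynomials both sides multiply `h_ν` by `(-√|ν|)^{k+m} e^{-√|ν|(t+s)}`; both sides are
  -- continuous in `L¹`.
  have heq : ∀ n, poissonOp (k + m) (t + s) (hermiteSum (c n)) =
      poissonOp m s (poissonOp k t (hermiteSum (c n))) := by
    intro n
    have e1 : poissonOp k t (hermiteSum (c n)) = fun x => ∑ ν ∈ (c n).support,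
        (c n ν * ((-Real.sqrt (multiLength ν)) ^ k *
        Real.exp (-Real.sqrt (multiLength ν) * t))) * hermite ν x :=
      funext fun x => poissonOp_hermite_sum k ht (c n).support (c n) x
    funext x
    rw [e1, poissonOp_hermite_sum m hs]
    refine (poissonOp_hermite_sum (k + m) (by linarith) (c n).support (c n) x).trans ?_
    refine Finset.sum_congr rfl fun ν _ => ?_
    rw [mul_add, Real.exp_add, pow_add]
    ring
  refine ae_eq_of_tendsto_lintegral (u := fun n => poissonOp (k + m) (t + s) (hermiteSum (c n)))
    (fun n => (measurable_poissonOp _ _ (hI n).1.aemeasurable).aemeasurable)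
    (measurable_poissonOp _ _ hf.1.aemeasurable).aemeasurable
    (measurable_poissonOp _ _ (measurable_poissonOp _ _ hf.1.aemeasurable).aemeasurable).aemeasurable
    (tendsto_poissonOp _ (by linarith) hI hf hc) ?_
  simp_rw [heq]
  exact tendsto_poissonOp _ hs (fun n => integrable_poissonOp k (hI n) ht)
    (integrable_poissonOp k hf ht) (tendsto_poissonOp _ ht hI hf hc)

lemma besselPoly_eq (β : ℝ) (c : (Fin d → ℕ) →₀ ℝ) :
    besselPoly β c = fun x => ∑ ν ∈ c.support,
      (c ν * (1 / (1 + Real.sqrt (multiLength ν)) ^ β)) * hermite ν x := by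
  funext x
  rw [besselPoly, Finsupp.sum]
  exact Finset.sum_congr rfl fun ν _ => by ring

lemma besselPoly_eq_besselOp {β : ℝ} (hβ : 0 < β) (c : (Fin d → ℕ) →₀ ℝ) :
    besselPoly β c = besselOp β 0 0 (hermiteSum c) := by
  funext x
  rw [besselPoly_eq]
  refine Eq.trans ?_ (besselOp_hermite_sum hβ 0 le_rfl c.support c x).symm
  refine Finset.sum_congr rfl fun ν _ => ?_
  simp

lemma poissonOp_besselPoly {β : ℝ} (hβ : 0 < β) (k : ℕ) {t : ℝ} (ht : 0 < t)
    (c : (Fin d → ℕ) →₀ ℝ) :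
    poissonOp k t (besselPoly β c) = besselOp β k t (hermiteSum c) := by
  funext x
  rw [besselPoly_eq, poissonOp_hermite_sum k ht]
  refine Eq.trans ?_ (besselOp_hermite_sum hβ k ht.le c.support c x).symm
  exact Finset.sum_congr rfl fun ν _ => by ring

lemma integrable_besselPoly (β : ℝ) (c : (Fin d → ℕ) →₀ ℝ) :
    Integrable (besselPoly β c) (gaussianMeasure d) := by
  rw [besselPoly_eq]
  exact integrable_hermite_sum _ _

lemma tendsto_lintegral_of_tendsto_eLpNorm {q : ℝ≥0∞} (hq : 1 ≤ q) {u : ℕ → Euc d → ℝ}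
    {f : Euc d → ℝ} (hu : ∀ n, Integrable (u n) (gaussianMeasure d))
    (hf : Integrable f (gaussianMeasure d))
    (h : Tendsto (fun n => eLpNorm (fun x => u n x - f x) q (gaussianMeasure d)) atTop (𝓝 0)) :
    Tendsto (fun n => ∫⁻ x, ‖u n x - f x‖ₑ ∂gaussianMeasure d) atTop (𝓝 0) := by
  simp_rw [← eLpNorm_one_eq_lintegral_enorm]
  exact tendsto_of_tendsto_of_tendsto_of_le_of_le tendsto_const_nhds h (fun _ => zero_le)
    fun n => eLpNorm_le_eLpNorm_of_exponent_le hq ((hu n).sub hf).1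

/-- A Bessel potential of `f` is given by the averages `besselOp`. -/
lemma IsBesselPotential.spec {β : ℝ} (hβ : 0 < β) {f g : Euc d → ℝ} (h : IsBesselPotential β f g) :
    Integrable g (gaussianMeasure d) ∧ g =ᵐ[gaussianMeasure d] besselOp β 0 0 f ∧
      ∀ k t, 0 < t → poissonOp k t g =ᵐ[gaussianMeasure d] besselOp β k t f := by
  obtain ⟨q, hq1, -, hf, hg, c, hcf, hcg⟩ := h
  have hfi := hf.integrable hq1.le
  have hgi := hg.integrable hq1.le
  have h1 := tendsto_lintegral_of_tendsto_eLpNorm hq1.le (fun n => integrable_hermiteSum (c n))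
    hfi hcf
  have h2 := tendsto_lintegral_of_tendsto_eLpNorm hq1.le (fun n => integrable_besselPoly β (c n))
    hgi hcg
  refine ⟨hgi, ?_, fun k t ht => ?_⟩
  · refine ae_eq_of_tendsto_lintegral (fun n => (integrable_besselPoly β (c n)).1.aemeasurable)
      hgi.1.aemeasurable (measurable_besselOp β 0 0 hfi.1.aemeasurable).aemeasurable h2 ?_
    simp_rw [besselPoly_eq_besselOp hβ]
    exact tendsto_besselOp hβ le_rfl (by simp) (fun n => integrable_hermiteSum (c n)) hfi h1
  · refine ae_eq_of_tendsto_lintegral (u := fun n => poissonOp k t (besselPoly β (c n)))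
      (fun n => (measurable_poissonOp k t
        (integrable_besselPoly β (c n)).1.aemeasurable).aemeasurable)
      (measurable_poissonOp k t hgi.1.aemeasurable).aemeasurable
      (measurable_besselOp β k t hfi.1.aemeasurable).aemeasurable
      (tendsto_poissonOp k ht (fun n => integrable_besselPoly β (c n)) hgi h2) ?_
    simp_rw [poissonOp_besselPoly hβ k ht]
    exact tendsto_besselOp hβ ht.le (by positivity) (fun n => integrable_hermiteSum (c n)) hfi h1

/-! ### The Luxemburg norm -/

/-- `f / l` belongs to the unit ball of the modular. -/
def VarBound (p f : Euc d → ℝ) (l : ℝ) : Prop := modular p (fun x => f x / l) ≤ 1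

lemma modular_eq {p : Euc d → ℝ} (hp1 : ∀ x, 1 ≤ p x) (f : Euc d → ℝ) :
    modular p f = ∫⁻ x, ‖f x‖ₑ ^ p x ∂gaussianMeasure d := by
  refine lintegral_congr fun x => ?_
  rw [Real.enorm_eq_ofReal_abs, ENNReal.ofReal_rpow_of_nonneg (abs_nonneg _)
    (by linarith [hp1 x])]

lemma modular_congr {p f g : Euc d → ℝ} (h : f =ᵐ[gaussianMeasure d] g) :
    modular p f = modular p g := by
  refine lintegral_congr_ae ?_
  filter_upwards [h] with x hx
  rw [hx]

lemma VarBound.congr {p f g : Euc d → ℝ} {l : ℝ} (hf : VarBound p f l)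
    (h : f =ᵐ[gaussianMeasure d] g) : VarBound p g l := by
  have he : modular p (fun x => f x / l) = modular p fun x => g x / l :=
    modular_congr (h.fun_comp fun a => a / l)
  exact he.symm.trans_le hf

lemma VarBound.varNorm_le {p f : Euc d → ℝ} {l : ℝ} (hf : VarBound p f l) (hl : 0 < l) :
    varNorm p f ≤ ENNReal.ofReal l :=
  sInf_le ⟨l, hl, hf, rfl⟩

lemma VarBound.mono {p f : Euc d → ℝ} (hp1 : ∀ x, 1 ≤ p x) {l l' : ℝ} (hf : VarBound p f l)
    (hl : 0 < l) (hll : l ≤ l') : VarBound p f l' := by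
  refine le_trans (lintegral_mono fun x => ENNReal.ofReal_le_ofReal ?_) hf
  refine Real.rpow_le_rpow (abs_nonneg _) ?_ (by linarith [hp1 x])
  rw [abs_div, abs_div, abs_of_pos hl, abs_of_pos (hl.trans_le hll)]
  gcongr

/-- The strict inequality avoids asking whether the infimum in the Luxemburg norm is attained; for
this reason constants are enlarged slightly in the Besov estimates below. -/
lemma varBound_of_varNorm_lt {p f : Euc d → ℝ} (hp1 : ∀ x, 1 ≤ p x) {l : ℝ}
    (h : varNorm p f < ENNReal.ofReal l) : VarBound p f l := by
  obtain ⟨a, ⟨l', hl', hf, rfl⟩, ha⟩ := sInf_lt_iff.1 h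
  exact VarBound.mono hp1 hf hl' ((ENNReal.ofReal_lt_ofReal_iff_of_nonneg hl'.le).1 ha).le

/-- Scaling a function of finite modular into the unit ball. -/
lemma lintegral_div_rpow_le_one {p : Euc d → ℝ} (hp1 : ∀ x, 1 ≤ p x)
    {F : Euc d → ℝ≥0∞} {c : ℝ} (hc : 1 ≤ c)
    (h : ∫⁻ x, F x ^ p x ∂gaussianMeasure d ≤ ENNReal.ofReal c) :
    ∫⁻ x, (F x / ENNReal.ofReal c) ^ p x ∂gaussianMeasure d ≤ 1 := by
  have hc0 : 0 < c := by linarith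
  have hne : (ENNReal.ofReal c)⁻¹ ≠ ∞ := by simpa using hc0
  calc _ ≤ ∫⁻ x, (ENNReal.ofReal c)⁻¹ * F x ^ p x ∂gaussianMeasure d := by
        refine lintegral_mono fun x => ?_
        have hpx := hp1 x
        rw [div_eq_mul_inv, mul_comm, ENNReal.mul_rpow_of_nonneg _ _ (by linarith)]
        gcongr
        refine ENNReal.rpow_le_self_of_le_one ?_ hpx
        rw [ENNReal.inv_le_one, ENNReal.one_le_ofReal]
        exact hc
    _ = (ENNReal.ofReal c)⁻¹ * ∫⁻ x, F x ^ p x ∂gaussianMeasure d :=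
        lintegral_const_mul' _ _ hne
    _ ≤ (ENNReal.ofReal c)⁻¹ * ENNReal.ofReal c := by gcongr
    _ = 1 := ENNReal.inv_mul_cancel (by simpa using hc0) ENNReal.ofReal_ne_top

lemma enorm_div_of_pos (a : ℝ) {c : ℝ} (hc : 0 < c) : ‖a / c‖ₑ = ‖a‖ₑ / ENNReal.ofReal c := by
  rw [Real.enorm_eq_ofReal_abs, Real.enorm_eq_ofReal_abs, abs_div, abs_of_pos hc,
    ENNReal.ofReal_div_of_pos hc]

lemma MemVarLp.exists_varBound {p f : Euc d → ℝ} (hp1 : ∀ x, 1 ≤ p x) (hf : MemVarLp p f) :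
    ∃ l, 0 < l ∧ VarBound p f l := by
  obtain ⟨-, l, hl, hfin⟩ := hf
  set M := modular p fun x => f x / l with hM
  set c := max 1 M.toReal with hc
  have hc1 : 1 ≤ c := le_max_left _ _
  refine ⟨l * c, by positivity, ?_⟩
  rw [VarBound, modular_eq hp1]
  have h1 : ∫⁻ x, ‖f x / l‖ₑ ^ p x ∂gaussianMeasure d ≤ ENNReal.ofReal c := by
    rw [← modular_eq hp1, ← hM, ← ENNReal.ofReal_toReal hfin.ne]
    exact ENNReal.ofReal_le_ofReal (le_max_right _ _)
  refine le_trans (le_of_eq (lintegral_congr fun x => ?_)) (lintegral_div_rpow_le_one hp1 hc1 h1)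
  rw [← enorm_div_of_pos _ (by linarith), div_div]

lemma poissonOp_div (k : ℕ) (t l : ℝ) (f : Euc d → ℝ) (x : Euc d) :
    poissonOp k t (fun y => f y / l) x = poissonOp k t f x / l := by
  simp only [poissonOp, mehlerInt, ← mul_div_assoc, integral_div]

/-- The operators `t^k ∂_t^k P_t` are uniformly bounded on `L^{p(·)}`. -/
lemma exists_varBound_poissonOp {p : Euc d → ℝ} {P C₁ C₂ pInf : ℝ}
    (hp : ExponentBounds p P C₁ C₂ pInf) (k : ℕ) :
    ∃ C : ℝ, 0 < C ∧ ∀ t, 0 < t → ∀ (f : Euc d → ℝ) (l : ℝ),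
      AEMeasurable f (gaussianMeasure d) → 0 < l → VarBound p f l →
      VarBound p (poissonOp k t f) (C * (t ^ k)⁻¹ * l) := by
  obtain ⟨C₀, hC₀, h₀⟩ := exists_lintegral_ouPos_rpow_le hp
  obtain ⟨C, hC, h⟩ := exists_enorm_poissonOp_le (d := d) k
  set c := max 1 C₀.toReal with hc
  have hc1 : 1 ≤ c := le_max_left _ _
  have hc0 : 0 < c := by linarith
  -- The factor `c ≥ 1` brings a modular bounded by `c` into the unit ball; `C + 1` is used to have
  -- a positive divisor.
  refine ⟨(C + 1) * c, by positivity, fun t ht f l hf hl hfl => ?_⟩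
  set u : Euc d → ℝ := fun y => hf.mk f y / l with hu
  have hum : Measurable u := hf.measurable_mk.div_const l
  have hu1 : ∫⁻ x, ‖u x‖ₑ ^ p x ∂gaussianMeasure d ≤ 1 := by
    rw [← modular_eq hp.one_le]
    exact VarBound.congr hfl hf.ae_eq_mk
  have h1 : ∫⁻ x, poissonPos (t / Real.sqrt 2) (fun y => ‖u y‖ₑ) x ^ p x ∂gaussianMeasure d ≤
      ENNReal.ofReal c := by
    refine (lintegral_poissonPos_rpow_le hp.measurable hp.one_le hum.enorm
      (fun r hr => h₀ r hr _ hum.enorm hu1) (by positivity)).trans ?_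
    rw [← ENNReal.ofReal_toReal hC₀]
    exact ENNReal.ofReal_le_ofReal (le_max_right _ _)
  rw [VarBound, modular_eq hp.one_le]
  refine (lintegral_mono fun x => ?_).trans (lintegral_div_rpow_le_one hp.one_le hc1 h1)
  refine ENNReal.rpow_le_rpow ?_ (by linarith [hp.one_le x])
  have e1 : poissonOp k t f x / ((C + 1) * c * (t ^ k)⁻¹ * l) =
      poissonOp k t u x / ((C + 1) * (t ^ k)⁻¹) / c := by
    rw [hu, poissonOp_div, poissonOp_congr hf.ae_eq_mk]
    field_simp
  rw [e1, enorm_div_of_pos _ hc0, enorm_div_of_pos _ (by positivity)]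
  gcongr
  refine ENNReal.div_le_of_le_mul' ((h t ht u x).trans ?_)
  gcongr
  linarith

/-- Minkowski's integral inequality for the Luxemburg norm. -/
lemma varBound_of_average {p : Euc d → ℝ} (hp : Measurable p) (hp1 : ∀ x, 1 ≤ p x)
    {w a : ℝ → ℝ} (hw : Measurable w) (ha : Measurable a)
    (ha0 : ∀ s, 0 < s → 0 < a s) {G : ℝ → Euc d → ℝ} (hG : Measurable (Function.uncurry G))
    (hGa : ∀ s, 0 < s → VarBound p (G s) (a s)) {N : ℝ} (hN : 0 < N)
    (hwa : ∫⁻ s in Set.Ioi (0 : ℝ), ENNReal.ofReal (w s) * ENNReal.ofReal (a s) ≤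
      ENNReal.ofReal N) {h : Euc d → ℝ}
    (hh : ∀ x, ‖h x‖ₑ ≤ ∫⁻ s in Set.Ioi (0 : ℝ), ENNReal.ofReal (w s) * ‖G s x‖ₑ) :
    VarBound p h N := by
  rw [VarBound, modular_eq hp1]
  have hN0 : ENNReal.ofReal N ≠ 0 := by simpa using hN
  have hNinv : (ENNReal.ofReal N)⁻¹ ≠ ∞ := by simpa using hN
  -- Writing `w G = (w a)(G / a)`, the weight `w a / N` has mass at most one and each `G s / a s`
  -- has modular at most one, so convexity of the modular applies.
  refine le_trans (lintegral_mono fun x => ?_) (lintegral_average_rpow_le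
    (μ := volume.restrict (Set.Ioi (0 : ℝ))) hp hp1
    (w := fun s => (ENNReal.ofReal N)⁻¹ * (ENNReal.ofReal (w s) * ENNReal.ofReal (a s)))
    (S := fun s x => ‖G s x / a s‖ₑ) (by fun_prop) ?_ ?_ (C := 1) ?_)
  · refine ENNReal.rpow_le_rpow ?_ (by linarith [hp1 x])
    rw [enorm_div_of_pos _ hN, div_eq_mul_inv, mul_comm]
    calc _ ≤ (ENNReal.ofReal N)⁻¹ *
          ∫⁻ s in Set.Ioi (0 : ℝ), ENNReal.ofReal (w s) * ‖G s x‖ₑ := by gcongr; exact hh x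
      _ = ∫⁻ s in Set.Ioi (0 : ℝ), (ENNReal.ofReal N)⁻¹ * (ENNReal.ofReal (w s) * ‖G s x‖ₑ) :=
          (lintegral_const_mul' _ _ hNinv).symm
      _ = _ := by
          refine setLIntegral_congr_fun measurableSet_Ioi fun s hs => ?_
          have h1 := ha0 s hs
          rw [enorm_div_of_pos _ h1, mul_assoc, mul_assoc, ENNReal.mul_div_cancel
            (by simpa using h1) ENNReal.ofReal_ne_top]
  · rw [lintegral_const_mul' _ _ hNinv]
    calc _ ≤ (ENNReal.ofReal N)⁻¹ * ENNReal.ofReal N := by gcongr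
      _ = 1 := ENNReal.inv_mul_cancel hN0 ENNReal.ofReal_ne_top
  · have h1 : Measurable fun z : ℝ × Euc d => G z.1 z.2 := hG
    refine Measurable.enorm ?_
    change Measurable fun z : ℝ × Euc d => G z.1 z.2 / a z.1
    fun_prop
  · refine (ae_restrict_mem measurableSet_Ioi).mono fun s hs => ?_
    rw [← modular_eq hp1]
    exact hGa s hs

/-- Drop `e^{-s}` and split at `s = t`. For `s ≤ t` use `t + s ≥ t` and the integrability of
`s^{β-1}` at `0`; for `s > t` use `t + s ≥ s` and the integrability of `s^{β-1-κ}` at infinity,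
which is where `β < κ` is needed. -/
lemma lintegral_besselWeight_mul_rpow_le {β κ : ℝ} (hβ : 0 < β) (hκ : β < κ) {t : ℝ} (ht : 0 < t) :
    ∫⁻ s in Set.Ioi (0 : ℝ), ENNReal.ofReal (besselWeight β s) *
      ENNReal.ofReal ((t + s) ^ (-κ)) ≤
      ENNReal.ofReal ((1 / β + 1 / (κ - β)) / Real.Gamma β * t ^ (-κ + β)) := by
  have hΓ := Real.Gamma_pos_of_pos hβ
  have hw : ∀ s, 0 < s → besselWeight β s ≤ s ^ (β - 1) / Real.Gamma β := by
    intro s hs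
    unfold besselWeight
    refine div_le_div_of_nonneg_right ?_ hΓ.le
    exact mul_le_of_le_one_right (by positivity) (Real.exp_le_one_iff.2 (by linarith))
  have hU : Set.Ioc 0 t ∪ Set.Ioi t = Set.Ioi (0 : ℝ) := Set.Ioc_union_Ioi_eq_Ioi ht.le
  have h1 : ∫⁻ s in Set.Ioc 0 t, ENNReal.ofReal (besselWeight β s) *
      ENNReal.ofReal ((t + s) ^ (-κ)) ≤
      ENNReal.ofReal (1 / β / Real.Gamma β * t ^ (-κ + β)) := by
    have hint : IntegrableOn (fun s : ℝ => s ^ (β - 1) / Real.Gamma β * t ^ (-κ))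
        (Set.Ioc 0 t) := by
      rw [← intervalIntegrable_iff_integrableOn_Ioc_of_le ht.le]
      exact ((intervalIntegral.intervalIntegrable_rpow' (by linarith)).div_const _).mul_const _
    calc _ ≤ ∫⁻ s in Set.Ioc 0 t, ENNReal.ofReal (s ^ (β - 1) / Real.Gamma β * t ^ (-κ)) := by
          refine setLIntegral_mono' measurableSet_Ioc fun s hs => ?_
          have hs0 : 0 < s := hs.1
          rw [← ENNReal.ofReal_mul (besselWeight_nonneg hβ hs0)]
          refine ENNReal.ofReal_le_ofReal (mul_le_mul (hw s hs0) ?_ (by positivity)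
            (by positivity))
          exact Real.rpow_le_rpow_of_nonpos ht (by linarith) (by linarith)
      _ = ENNReal.ofReal (∫ s in Set.Ioc 0 t, s ^ (β - 1) / Real.Gamma β * t ^ (-κ)) := by
          rw [ofReal_integral_eq_lintegral_ofReal hint]
          refine (ae_restrict_mem measurableSet_Ioc).mono fun s hs => ?_
          have hs0 : 0 < s := hs.1
          simp only [Pi.zero_apply]
          positivity
      _ = _ := by
          congr 1
          rw [← intervalIntegral.integral_of_le ht.le, intervalIntegral.integral_mul_const,
            intervalIntegral.integral_div, integral_rpow (Or.inl (by linarith)), sub_add_cancel,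
            Real.zero_rpow hβ.ne', sub_zero, Real.rpow_add ht]
          field_simp
  have h2 : ∫⁻ s in Set.Ioi t, ENNReal.ofReal (besselWeight β s) *
      ENNReal.ofReal ((t + s) ^ (-κ)) ≤
      ENNReal.ofReal (1 / (κ - β) / Real.Gamma β * t ^ (-κ + β)) := by
    have hexp : β - 1 + -κ < -1 := by linarith
    have hint : IntegrableOn (fun s : ℝ => s ^ (β - 1 + -κ) / Real.Gamma β) (Set.Ioi t) :=
      (integrableOn_Ioi_rpow_of_lt hexp ht).div_const _
    calc _ ≤ ∫⁻ s in Set.Ioi t, ENNReal.ofReal (s ^ (β - 1 + -κ) / Real.Gamma β) := by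
          refine setLIntegral_mono' measurableSet_Ioi fun s hs => ?_
          have hs0 : 0 < s := ht.trans hs
          rw [← ENNReal.ofReal_mul (besselWeight_nonneg hβ hs0)]
          refine ENNReal.ofReal_le_ofReal ?_
          calc _ ≤ s ^ (β - 1) / Real.Gamma β * s ^ (-κ) := by
                refine mul_le_mul (hw s hs0) ?_ (by positivity) (by positivity)
                exact Real.rpow_le_rpow_of_nonpos hs0 (by linarith) (by linarith)
            _ = _ := by rw [Real.rpow_add hs0]; ring
      _ = ENNReal.ofReal (∫ s in Set.Ioi t, s ^ (β - 1 + -κ) / Real.Gamma β) := by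
          rw [ofReal_integral_eq_lintegral_ofReal hint]
          refine (ae_restrict_mem measurableSet_Ioi).mono fun s hs => ?_
          have hs0 : 0 < s := ht.trans hs
          simp only [Pi.zero_apply]
          positivity
      _ = _ := by
          congr 1
          rw [integral_div, integral_Ioi_rpow_of_lt hexp ht,
            show β - 1 + -κ + 1 = -κ + β by ring]
          have : κ - β ≠ 0 := by linarith
          have : -κ + β ≠ 0 := by linarith
          field_simp
          ring
  rw [← hU]
  refine (lintegral_union_le _ _ _).trans ((add_le_add h1 h2).trans_eq ?_)
  have : 0 < κ - β := by linarith
  rw [← ENNReal.ofReal_add (by positivity) (by positivity)]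
  congr 1
  ring

/-! ### Consequences of the assumptions on the exponent -/

lemma one_le_log_exp_one_add {a : ℝ} (ha : 0 ≤ a) : 1 ≤ Real.log (Real.exp 1 + a) := by
  rw [Real.le_log_iff_exp_le (by positivity)]
  linarith

lemma IsLogHolder.continuous {p : Euc d → ℝ} (h : IsLogHolder p) : Continuous p := by
  obtain ⟨C, hC, h⟩ := h
  rw [Metric.continuous_iff]
  intro x ε hε
  refine ⟨Real.exp (-(2 * C / ε)), Real.exp_pos _, fun y hy => ?_⟩
  rw [Real.dist_eq]
  rcases eq_or_ne y x with rfl | hne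
  · simpa using hε
  have hn : 0 < ‖y - x‖ := by rw [norm_pos_iff, sub_ne_zero]; exact hne
  rw [dist_eq_norm] at hy
  have h1 : 2 * C / ε ≤ Real.log (Real.exp 1 + 1 / ‖y - x‖) := by
    rw [Real.le_log_iff_exp_le (by positivity)]
    have : Real.exp (2 * C / ε) ≤ 1 / ‖y - x‖ := by
      rw [le_one_div (Real.exp_pos _) hn, one_div, ← Real.exp_neg]
      exact hy.le
    linarith [Real.exp_pos 1]
  calc |p y - p x| ≤ C / Real.log (Real.exp 1 + 1 / ‖y - x‖) := h y x
    _ ≤ C / (2 * C / ε) := div_le_div_of_nonneg_left hC.le (by positivity) h1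
    _ = ε / 2 := by field_simp
    _ < ε := half_lt_self hε

/-- Since `log (e + 1/|x|) ≥ 1`, log-Hölder continuity keeps `p` within `C₁` of `p 0`, giving an
upper bound at every point; continuity upgrades almost everywhere measurability to measurability. -/
lemma exists_exponentBounds {p : Euc d → ℝ} (hp : IsGaussianExponent p) (hLH : IsLogHolder p) :
    ∃ P C₁ C₂ pInf, ExponentBounds p P C₁ C₂ pInf := by
  have hc := hLH.continuous
  obtain ⟨⟨-, h1⟩, C₂, hC₂, pInf, -, hdec⟩ := hp
  obtain ⟨C₁, hC₁, hlog⟩ := hLH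
  refine ⟨p 0 + C₁, C₁, C₂, pInf, hc.measurable, h1, fun x => ?_, hC₁.le, hC₂.le, hlog, hdec⟩
  have h2 := (le_abs_self _).trans (hlog x 0)
  have h3 : C₁ / Real.log (Real.exp 1 + 1 / ‖x - 0‖) ≤ C₁ :=
    div_le_self hC₁.le (one_le_log_exp_one_add (by positivity))
  linarith

/-- The condition `p_- > 1` enters only here: it places `L^{p(·)}` inside some `L^q` with `q > 1`,
as the definition of `J_β` requires. The cap at `2` matches the range in which polynomials are shown
to be dense. -/
lemma exists_lt_ae_le {p : Euc d → ℝ} (h : 1 < expMinus p) :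
    ∃ q : ℝ, 1 < q ∧ q ≤ 2 ∧ ∀ᵐ x ∂gaussianMeasure d, q ≤ p x := by
  obtain ⟨q, hq1, hq⟩ := exists_between h
  have hqtop : q ≠ ∞ := hq.ne_top
  have h1 : 1 < q.toReal := by
    have := (ENNReal.toReal_lt_toReal ENNReal.one_ne_top hqtop).2 hq1
    simpa using this
  refine ⟨min q.toReal 2, lt_min h1 one_lt_two, min_le_right _ _, ?_⟩
  filter_upwards [ae_lt_of_lt_essInf hq] with x hx
  refine (min_le_left _ _).trans ?_
  rw [← ENNReal.ofReal_toReal hqtop] at hx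
  exact (ENNReal.ofReal_lt_ofReal_iff_of_nonneg (by linarith)).1 hx |>.le

lemma MemVarLp.memLp {p f : Euc d → ℝ} (hp1 : ∀ x, 1 ≤ p x) (hf : MemVarLp p f) {q : ℝ}
    (hq : 0 < q) (hqp : ∀ᵐ x ∂gaussianMeasure d, q ≤ p x) :
    MemLp f (ENNReal.ofReal q) (gaussianMeasure d) := by
  obtain ⟨hfm, l, hl, hfin⟩ := hf
  rw [modular_eq hp1] at hfin
  have h1 : MemLp (fun x => f x / l) (ENNReal.ofReal q) (gaussianMeasure d) := by
    refine ⟨(hfm.div_const l).aestronglyMeasurable, ?_⟩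
    rw [eLpNorm_lt_top_iff_lintegral_rpow_enorm_lt_top (by simpa using hq) ENNReal.ofReal_ne_top,
      ENNReal.toReal_ofReal hq.le]
    have hle : ∫⁻ x, ‖f x / l‖ₑ ^ q ∂gaussianMeasure d ≤
        ∫⁻ x, (1 + ‖f x / l‖ₑ ^ p x) ∂gaussianMeasure d := by
      refine lintegral_mono_ae ?_
      filter_upwards [hqp] with x hx
      exact ennreal_rpow_le_one_add_rpow _ hq.le hx
    refine hle.trans_lt ?_
    rw [lintegral_add_left measurable_const]
    simp only [lintegral_one, measure_univ]
    exact ENNReal.add_lt_top.2 ⟨ENNReal.one_lt_top, hfin⟩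
  have h2 := h1.const_mul l
  refine h2.ae_eq (Eventually.of_forall fun x => ?_)
  field_simp

/-! ### Existence of Bessel potentials -/

lemma exists_lintegral_besselOp_rpow_le {β : ℝ} (hβ : 0 < β) {q : ℝ} (hq : 1 ≤ q) :
    ∃ C : ℝ≥0∞, C ≠ ∞ ∧ ∀ f : Euc d → ℝ, AEMeasurable f (gaussianMeasure d) →
      ∫⁻ x, ‖besselOp β 0 0 f x‖ₑ ^ q ∂gaussianMeasure d ≤
        C * ∫⁻ x, ‖f x‖ₑ ^ q ∂gaussianMeasure d := by
  obtain ⟨C, hC, h⟩ := exists_enorm_poissonOp_le (d := d) 0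
  have hq0 : 0 ≤ q := by linarith
  refine ⟨ENNReal.ofReal C ^ q, by finiteness, fun f hf => ?_⟩
  have he : ∫⁻ x, ‖f x‖ₑ ^ q ∂gaussianMeasure d = ∫⁻ x, ‖hf.mk f x‖ₑ ^ q ∂gaussianMeasure d :=
    lintegral_congr_ae (hf.ae_eq_mk.fun_comp fun a => ‖a‖ₑ ^ q)
  rw [besselOp_congr hf.ae_eq_mk, he]
  set u := hf.mk f
  have hu : Measurable u := hf.measurable_mk
  have hm := measurable_poissonOp_comp 0 (Ω := ℝ × Euc d) hu (t := fun z => 0 + z.1)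
    (x := fun z => z.2) (by fun_prop) (by fun_prop)
  refine le_trans (lintegral_mono fun x => ENNReal.rpow_le_rpow (enorm_besselOp_le hβ 0 0 u x) hq0)
    (lintegral_average_rpow_le (p := fun _ => q) measurable_const (fun _ => hq) (by fun_prop)
      (lintegral_besselWeight hβ).le (S := fun s x => ‖poissonOp 0 (0 + s) u x‖ₑ) hm.enorm ?_)
  refine (ae_restrict_mem measurableSet_Ioi).mono fun s hs => ?_
  have hs0 : 0 < s := hs
  calc _ ≤ ∫⁻ x, ENNReal.ofReal C ^ q * poissonPos (s / Real.sqrt 2) (fun y => ‖u y‖ₑ) x ^ q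
        ∂gaussianMeasure d := by
        refine lintegral_mono fun x => ?_
        rw [← ENNReal.mul_rpow_of_nonneg _ _ hq0, zero_add]
        gcongr
        simpa using h s hs0 u x
    _ = ENNReal.ofReal C ^ q * ∫⁻ x, poissonPos (s / Real.sqrt 2) (fun y => ‖u y‖ₑ) x ^ q
        ∂gaussianMeasure d := lintegral_const_mul' _ _ (by finiteness)
    _ ≤ _ := by
        refine mul_le_mul_right ?_ _
        exact lintegral_poissonPos_rpow_const_le hq hu.enorm (by positivity)

lemma exists_eLpNorm_besselOp_le {β : ℝ} (hβ : 0 < β) {q : ℝ} (hq : 1 ≤ q) :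
    ∃ C : ℝ≥0∞, C ≠ ∞ ∧ ∀ f : Euc d → ℝ, AEMeasurable f (gaussianMeasure d) →
      eLpNorm (besselOp β 0 0 f) (ENNReal.ofReal q) (gaussianMeasure d) ≤
        C * eLpNorm f (ENNReal.ofReal q) (gaussianMeasure d) := by
  obtain ⟨C, hC, h⟩ := exists_lintegral_besselOp_rpow_le (d := d) hβ hq
  have hq0 : 0 < q := by linarith
  refine ⟨C ^ (1 / q), by finiteness, fun f hf => ?_⟩
  rw [eLpNorm_eq_lintegral_rpow_enorm_toReal (by simpa using hq0) ENNReal.ofReal_ne_top,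
    eLpNorm_eq_lintegral_rpow_enorm_toReal (by simpa using hq0) ENNReal.ofReal_ne_top,
    ENNReal.toReal_ofReal hq0.le, ← ENNReal.mul_rpow_of_nonneg _ _ (by positivity)]
  gcongr
  exact h f hf

/-- The averaging operator is bounded on `L^q` and agrees with the Bessel potential on polynomials,
so it is the extension by continuity. -/
lemma exists_isBesselPotential {β : ℝ} (hβ : 0 < β) {q : ℝ} (hq1 : 1 < q) (hq2 : q ≤ 2)
    {f : Euc d → ℝ} (hf : MemLp f (ENNReal.ofReal q) (gaussianMeasure d)) :
    IsBesselPotential β f (besselOp β 0 0 f) := by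
  have hq1' : 1 < ENNReal.ofReal q := by simpa using hq1
  have hq2' : ENNReal.ofReal q ≤ 2 := by simpa using hq2
  have hfi := hf.integrable hq1'.le
  obtain ⟨C, hC, h⟩ := exists_eLpNorm_besselOp_le (d := d) hβ hq1.le
  obtain ⟨c, hc⟩ := exists_tendsto_hermiteSum hq1'.le hq2' hf
  refine ⟨ENNReal.ofReal q, hq1', ENNReal.ofReal_ne_top, hf,
    ⟨(measurable_besselOp β 0 0 hf.1.aemeasurable).aestronglyMeasurable,
      (h f hf.1.aemeasurable).trans_lt (ENNReal.mul_lt_top hC.lt_top hf.2)⟩, c, hc, ?_⟩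
  have h1 := ENNReal.Tendsto.const_mul (a := C) hc (Or.inr hC)
  rw [mul_zero] at h1
  refine tendsto_of_tendsto_of_tendsto_of_le_of_le tendsto_const_nhds h1 (fun _ => zero_le)
    fun n => ?_
  have hn := integrable_hermiteSum (c n)
  refine le_trans (le_of_eq (eLpNorm_congr_ae ?_)) (h _ (hn.sub hfi).1.aemeasurable)
  rw [besselPoly_eq_besselOp hβ]
  exact (besselOp_sub hβ le_rfl (by simp) hn hfi).symm

/-! ### Boundedness on the Besov-Lipschitz spaces -/

lemma exists_varBound_besselPotential {p : Euc d → ℝ} {P C₁ C₂ pInf : ℝ}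
    (hp : ExponentBounds p P C₁ C₂ pInf) {β : ℝ} (hβ : 0 < β) :
    ∃ C : ℝ, 0 < C ∧ ∀ (f g : Euc d → ℝ) (l : ℝ), AEMeasurable f (gaussianMeasure d) →
      IsBesselPotential β f g → 0 < l → VarBound p f l → VarBound p g (C * l) := by
  obtain ⟨C, hC, h⟩ := exists_varBound_poissonOp hp 0
  refine ⟨C, hC, fun f g l hf hfg hl hfl => ?_⟩
  have hm := measurable_poissonOp_comp 0 (Ω := ℝ × Euc d) hf.measurable_mk (t := fun z => 0 + z.1)
    (x := fun z => z.2) (by fun_prop) (by fun_prop)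
  refine VarBound.congr ?_ (hfg.spec hβ).2.1.symm
  refine varBound_of_average hp.measurable hp.one_le (measurable_besselWeight β)
    (a := fun _ => C * l) measurable_const (fun _ _ => by positivity)
    (G := fun s => poissonOp 0 (0 + s) (hf.mk f)) hm (fun s hs => ?_) (by positivity) ?_ ?_
  · have := h s hs f l hf hl hfl
    rw [poissonOp_congr hf.ae_eq_mk] at this
    simpa using this
  · rw [lintegral_mul_const _ (by fun_prop), lintegral_besselWeight hβ, one_mul]
  · intro x
    rw [besselOp_congr hf.ae_eq_mk]
    exact enorm_besselOp_le hβ 0 0 _ x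

lemma lt_besovOrder (a : ℝ) : a < besovOrder a := by
  have := Nat.lt_floor_add_one a
  unfold besovOrder
  exact_mod_cast this

lemma besovOrder_mono {a b : ℝ} (h : a ≤ b) : besovOrder a ≤ besovOrder b :=
  Nat.succ_le_succ (Nat.floor_mono h)

/-- Raising the order of the derivative in the defining estimate of a Besov-Lipschitz space. -/
lemma exists_varBound_poissonOp_higher {p : Euc d → ℝ} {P C₁ C₂ pInf : ℝ}
    (hp : ExponentBounds p P C₁ C₂ pInf) (α : ℝ) (k m : ℕ) :
    ∃ C : ℝ, 0 < C ∧ ∀ (f : Euc d → ℝ) (A : ℝ), Integrable f (gaussianMeasure d) → 0 < A →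
      (∀ t, 0 < t → VarBound p (poissonOp k t f) (A * t ^ (-(k : ℝ) + α))) →
      ∀ t, 0 < t → VarBound p (poissonOp (k + m) t f) (C * A * t ^ (-((k + m : ℕ) - α))) := by
  obtain ⟨C, hC, h⟩ := exists_varBound_poissonOp hp m
  -- The time is split into two equal halves; the power of `2` converts powers of `t/2` into powers
  -- of `t`.
  refine ⟨C * 2 ^ ((k + m : ℕ) - α), by positivity, fun f A hf hA hfA t ht => ?_⟩
  have ht2 : 0 < t / 2 := by positivity
  have h1 := h (t / 2) ht2 _ _ (measurable_poissonOp k (t / 2) hf.1.aemeasurable).aemeasurable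
    (by positivity) (hfA (t / 2) ht2)
  have h2 := poissonOp_poissonOp m k ht2 ht2 hf
  rw [add_halves] at h2
  have h3 : C * ((t / 2) ^ m)⁻¹ * (A * (t / 2) ^ (-(k : ℝ) + α)) =
      C * 2 ^ ((k + m : ℕ) - α) * A * t ^ (-((k + m : ℕ) - α)) := by
    have e1 : ((t / 2) ^ m)⁻¹ * (t / 2) ^ (-(k : ℝ) + α) = (t / 2) ^ (-((k + m : ℕ) - α)) := by
      rw [← Real.rpow_natCast, ← Real.rpow_neg ht2.le, ← Real.rpow_add ht2]
      congr 1
      push_cast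
      ring
    have e2 : (t / 2) ^ (-((k + m : ℕ) - α)) =
        2 ^ ((k + m : ℕ) - α) * t ^ (-((k + m : ℕ) - α)) := by
      rw [Real.div_rpow ht.le zero_le_two, Real.rpow_neg zero_le_two, div_inv_eq_mul, mul_comm]
    calc _ = C * A * (((t / 2) ^ m)⁻¹ * (t / 2) ^ (-(k : ℝ) + α)) := by ring
      _ = _ := by rw [e1, e2]; ring
  rw [h3] at h1
  exact h1.congr h2.symm

/-- Averaging the order `k + m` estimate over the times `t + s` against the Gamma density gains the
factor `t^β`. Taking `A'` strictly larger than `A` makes it positive and allows passing from norms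
to modulars. -/
lemma exists_besovBound_besselPotential {p : Euc d → ℝ} {P C₁ C₂ pInf : ℝ}
    (hp : ExponentBounds p P C₁ C₂ pInf) (α : ℝ) {β : ℝ} (hβ : 0 < β) :
    ∃ C : ℝ≥0, 0 < C ∧ ∀ (f g : Euc d → ℝ) (A A' : ℝ≥0), Integrable f (gaussianMeasure d) →
      IsBesselPotential β f g → BesovBound p α f A → A < A' →
      BesovBound p (α + β) g (C * A') := by
  obtain ⟨m, hm⟩ := Nat.exists_eq_add_of_le (besovOrder_mono (show α ≤ α + β by linarith))
  set k := besovOrder α with hk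
  obtain ⟨C, hC, h⟩ := exists_varBound_poissonOp_higher hp α k m
  have hΓ := Real.Gamma_pos_of_pos hβ
  -- The order `k + m` attached to `α + β` strictly exceeds `α + β`, which makes the time integral
  -- converge at infinity.
  have hκ : β < (k + m : ℕ) - α := by
    have := lt_besovOrder (α + β)
    rw [hm] at this
    linarith
  set κ : ℝ := (k + m : ℕ) - α with hκdef
  set D : ℝ := C * ((1 / β + 1 / (κ - β)) / Real.Gamma β) with hD
  have hκβ : 0 < κ - β := by linarith
  have hD0 : 0 < D := by positivity
  refine ⟨D.toNNReal, by simpa using hD0, fun f g A A' hf hfg hfA hAA' t ht => ?_⟩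
  have hA' : 0 < (A' : ℝ) := by exact_mod_cast (zero_le).trans_lt hAA'
  have hfb : ∀ s, 0 < s → VarBound p (poissonOp k s f) (A' * s ^ (-(k : ℝ) + α)) := by
    intro s hs
    refine varBound_of_varNorm_lt hp.one_le ?_
    rw [← poissonDeriv_eq k hf hs]
    refine (hfA s hs).trans_lt ?_
    rw [ENNReal.ofReal_mul (by positivity), ENNReal.ofReal_coe_nnreal]
    have hs' : 0 < s ^ (-(k : ℝ) + α) := by positivity
    refine ENNReal.mul_lt_mul_left ?_ ENNReal.ofReal_ne_top (by exact_mod_cast hAA')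
    simpa using hs'
  have hfm := hf.1.aemeasurable
  have hmeas := measurable_poissonOp_comp (k + m) (Ω := ℝ × Euc d) hfm.measurable_mk
    (t := fun z => t + z.1) (x := fun z => z.2) (by fun_prop) (by fun_prop)
  have hV : VarBound p (poissonOp (k + m) t g) (D * A' * t ^ (-κ + β)) := by
    refine VarBound.congr ?_ ((hfg.spec hβ).2.2 (k + m) t ht).symm
    refine varBound_of_average hp.measurable hp.one_le (measurable_besselWeight β)
      (a := fun s => C * A' * (t + |s|) ^ (-κ)) (by fun_prop) (fun s hs => by positivity)
      (G := fun s => poissonOp (k + m) (t + s) (hfm.mk f)) hmeas (fun s hs => ?_)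
      (by positivity) ?_ ?_
    · rw [abs_of_pos hs, ← poissonOp_congr hfm.ae_eq_mk]
      exact h f A' hf hA' hfb (t + s) (by linarith)
    · calc _ = ∫⁻ s in Set.Ioi (0 : ℝ), ENNReal.ofReal (C * A') *
            (ENNReal.ofReal (besselWeight β s) * ENNReal.ofReal ((t + s) ^ (-κ))) := by
            refine setLIntegral_congr_fun measurableSet_Ioi fun s hs => ?_
            rw [abs_of_pos hs, ENNReal.ofReal_mul (by positivity)]
            ring
        _ = ENNReal.ofReal (C * A') * ∫⁻ s in Set.Ioi (0 : ℝ),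
            (ENNReal.ofReal (besselWeight β s) * ENNReal.ofReal ((t + s) ^ (-κ))) :=
            lintegral_const_mul' _ _ ENNReal.ofReal_ne_top
        _ ≤ ENNReal.ofReal (C * A') * ENNReal.ofReal ((1 / β + 1 / (κ - β)) / Real.Gamma β *
            t ^ (-κ + β)) := by
            gcongr
            exact lintegral_besselWeight_mul_rpow_le hβ hκ ht
        _ = _ := by
            rw [← ENNReal.ofReal_mul (by positivity), hD]
            congr 1
            ring
    · intro x
      rw [besselOp_congr hfm.ae_eq_mk]
      exact enorm_besselOp_le hβ (k + m) t _ x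
  rw [hm, poissonDeriv_eq _ (hfg.spec hβ).1 ht]
  refine (hV.varNorm_le (by positivity)).trans_eq ?_
  rw [ENNReal.ofReal_mul (by positivity), ENNReal.ofReal_mul hD0.le, ENNReal.ofReal_coe_nnreal,
    ENNReal.coe_mul]
  congr 3
  rw [hκdef]
  ring

end GaussianBesov

end

/-- The Gaussian Bessel potential `J_β` is defined on all of `B^α_{p(·),∞}(γ_d)` and is bounded
from it into `B^{α+β}_{p(·),∞}(γ_d)`. -/
theorem mainTheorem1 (d : ℕ) (p : EuclideanSpace ℝ (Fin d) → ℝ)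
    (hp : GaussianBesov.IsGaussianExponent p) (hLH : GaussianBesov.IsLogHolder p)
    (hp1 : 1 < GaussianBesov.expMinus p) (hp2 : GaussianBesov.expPlus p < ∞)
    (α β : ℝ) (hα : 0 ≤ α) (hβ : 0 < β) :
    ∃ C : ℝ≥0, ∀ f : EuclideanSpace ℝ (Fin d) → ℝ, GaussianBesov.MemBesov p α f →
      (∃ g, GaussianBesov.IsBesselPotential β f g) ∧
      ∀ g, GaussianBesov.IsBesselPotential β f g →
        GaussianBesov.MemBesov p (α + β) g ∧
        GaussianBesov.besovNorm p (α + β) g ≤ C * GaussianBesov.besovNorm p α f := by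
  open GaussianBesov in
  obtain ⟨P, C₁, C₂, pInf, hE⟩ := exists_exponentBounds hp hLH
  obtain ⟨q, hq1, hq2, hqp⟩ := exists_lt_ae_le hp1
  obtain ⟨B, hB, hBound⟩ := exists_varBound_besselPotential hE hβ
  obtain ⟨D, hD, hBesov⟩ := exists_besovBound_besselPotential hE α hβ
  refine ⟨B.toNNReal + D, fun f hf => ?_⟩
  have hfq := hf.1.memLp hE.one_le (by linarith) hqp
  have hfi : MeasureTheory.Integrable f (gaussianMeasure d) :=
    hfq.integrable (by simpa using hq1.le)
  refine ⟨⟨_, exists_isBesselPotential hβ hq1 hq2 hfq⟩, fun g hfg => ⟨⟨⟨?_, ?_⟩, ?_⟩, ?_⟩⟩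
  · exact (hfg.spec hβ).1.1.aemeasurable
  · obtain ⟨l, hl, hfl⟩ := hf.1.exists_varBound hE.one_le
    exact ⟨B * l, by positivity, (hBound f g l hf.1.1 hfg hl hfl).trans_lt ENNReal.one_lt_top⟩
  · obtain ⟨A, hA⟩ := hf.2
    exact ⟨D * (A + 1), hBesov f g A (A + 1) hfi hfg hA (lt_add_one A)⟩
  · have h1 : varNorm p g ≤ ENNReal.ofReal B * varNorm p f := by
      have hB0 : ENNReal.ofReal B ≠ 0 := by simpa using hB
      rw [mul_comm, ← ENNReal.div_le_iff_le_mul (Or.inl hB0) (Or.inl ENNReal.ofReal_ne_top)]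
      refine le_sInf ?_
      rintro _ ⟨l, hl, hfl, rfl⟩
      rw [ENNReal.div_le_iff_le_mul (Or.inl hB0) (Or.inl ENNReal.ofReal_ne_top), mul_comm,
        ← ENNReal.ofReal_mul hB.le]
      exact (hBound f g l hf.1.1 hfg hl hfl).varNorm_le (by positivity)
    have h2 : sInf {b : ℝ≥0∞ | ∃ A : ℝ≥0, BesovBound p (α + β) g A ∧ b = A} ≤
        D * sInf {b : ℝ≥0∞ | ∃ A : ℝ≥0, BesovBound p α f A ∧ b = A} := by
      have hD0 : (D : ℝ≥0∞) ≠ 0 := by simpa using hD.ne'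
      rw [mul_comm, ← ENNReal.div_le_iff_le_mul (Or.inl hD0) (Or.inl ENNReal.coe_ne_top)]
      refine le_sInf ?_
      rintro _ ⟨A, hA, rfl⟩
      -- Admissibility transfers only to constants strictly larger than `A`; letting `ε` tend to `0`
      -- recovers the infimum.
      refine ENNReal.le_of_forall_pos_le_add fun ε hε _ => ?_
      rw [ENNReal.div_le_iff_le_mul (Or.inl hD0) (Or.inl ENNReal.coe_ne_top), mul_comm]
      refine sInf_le ⟨D * (A + ε), hBesov f g A (A + ε) hfi hfg hA (lt_add_of_pos_right A hε), ?_⟩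
      push_cast
      rfl
    rw [besovNorm, besovNorm, mul_add]
    refine add_le_add (h1.trans ?_) (h2.trans ?_)
    · gcongr
      rw [ENNReal.coe_add]
      exact le_self_add
    · gcongr
      exact le_add_self
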